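/- Let $K$ be a field, let $n\ge 1$ and $1\le m\le d$ be integers. Let $V=H^0(\mathbf P^n_K,\mathcal O(1))$, let $M_d=\mathbf P(\mathrm{Sym}^dV)$ be the space of (one-dimensional spaces spanned by) nonzero forms $F$ of degree $d$ in $x_0,\dots,x_n$, and let $\Gamma$ be the flag variety of pairs $(p,L)$ of a point $p\in\mathbf P^n$ and a line $L\ni p$. Let $Y_{d,m}\subset M_d\times\Gamma$ be the variety of all $([F],p,L)$ such that $L$ meets the hypersurface $F=0$ at $p$ with multiplicity $\ge m$ (lines contained in the hypersurface being included). For $([F],p,L)\in Y_{d,m}$ choose coordinates with $p=\{x_1=\dots=x_n=0\}$ and $L=\{x_2=\dots=x_n=0\}$, define polynomials $f_k(\xi,\zeta)$ in $\xi_1,\dots,\xi_n,\zeta_2,\dots,\zeta_n$ by $$F(1,\;t+\xi_1,\;\zeta_2t+\xi_2,\;\dots,\;\zeta_nt+\xi_n)=\sum_{k=0}^d f_k(\xi,\zeta)\,t^k ,$$ and let $J_m([F],p,L)$ be the $m\times(2n-1)$ Jacobian matrix of $f_0,\dots,f_{m-1}$ with respect to $\xi_1,\dots,\xi_n,\zeta_2,\dots,\zeta_n$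 at the origin; its rank does not depend on the coordinates. Put $$W_{d,m}=\{([F],p,L)\in Y_{d,m}\mid \operatorname{rank}J_m([F],p,L)<m\},\qquad W^0_{d,m}=W_{d,m}\setminus W_{d,2}.$$ Here points have coordinates in an algebraic closure of $K$, and codimensions are taken in the Zariski topology over $K$ (the codimension of a locally closed subset is that of its closure). Then: 1. If $m=1$ and $d\ge2$, then $\operatorname{codim}_{Y_{d,1}}W_{d,1}=n$. If $m=d=1$, then $W_{1,1}=\emptyset$. 2. If $m=2$ (so $d\ge 2$), then $\operatorname{codim}_{Y_{d,2}}W_{d,2}=n-1$. 3. If $m=2n-1$ is prime to the characteristic of $K$ and $d\ge 2$, then $\operatorname{codim}_{Y_{d,2n-1}}W_{d,2n-1}=1$. 4. If $3\le m\le 2n-2$ and $m$ is prime to the characteristic of $K$, then $\operatorname{codim}_{Y_{d,m}}W_{d,m}=\min\{n-1,2n-m\}$ and $\operatorname{codim}_{Y_{d,m}}W^0_{d,m}=2n-m$. 5. If $3\le m\le 2n-2$ and $m$ is divisible by the characteristic of $K$, then $\operatorname{codim}_{Y_{d,m}}W_{d,m}=\min\{n-1,2n-m-1\}$ and $\operatorname{codim}_{Y_{d,m}}W^0_{d,m}=2n-m-1$.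 (If $K$ has characteristic $0$, every $m\ge1$ counts as prime to the characteristic.) -/

import Mathlib

noncomputable section

namespace PointLine

/-! ### Codimension -/

/-- The codimension in `Y` of a subset `W` of `Y`, where `Y` carries the subspace topology: the
infimum of the codimensions (suprema of lengths of chains `Z = Z₀ ⊊ Z₁ ⊊ ⋯ ⊊ Zₗ` of irreducible
closed subsets of `Y`) of the irreducible closed subsets `Z` of `Y` contained in the closure of `W`.
It is `⊤` if `W` is empty. -/
def codim {X : Type*} [TopologicalSpace X] (Y W : Set X) : ℕ∞ :=
  ⨅ (Z : TopologicalSpace.IrreducibleCloseds Y)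
    (_ : (Z : Set Y) ⊆ closure ((Subtype.val : Y → X) ⁻¹' W)), Order.coheight Z

/-! ### Hypersurfaces, points and lines -/

/-- The space `Symᵈ V` of forms of degree `d` in `x₀, …, xₙ` with coefficients in `Ω`. -/
abbrev Form (Ω : Type*) [Field Ω] (n d : ℕ) : Type _ :=
  MvPolynomial.homogeneousSubmodule (Fin (n + 1)) Ω d

/-- The points `([F], p, L)` of `M_d × Γ` with coordinates in the field `Ω`: `[F]` is a hypersurface
of degree `d` in `ℙⁿ`, `p` is a point of `ℙⁿ` and `L` is a line in `ℙⁿ` through `p`, given as a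
two-dimensional subspace of `Ωⁿ⁺¹`. The field `K` is the base field of the Zariski topology below. -/
structure HypersurfaceFlag (K Ω : Type*) [Field Ω] (n d : ℕ) where
  /-- the hypersurface `[F]` -/
  F : Projectivization Ω (Form Ω n d)
  /-- the point `p` -/
  p : Projectivization Ω (Fin (n + 1) → Ω)
  /-- the line `L` -/
  L : Submodule Ω (Fin (n + 1) → Ω)
  finrank_L : Module.finrank Ω L = 2
  p_le_L : p.submodule ≤ L

/-! ### The Zariski topology -/

/-- The Zariski topology over `K` on the affine space `Ω^σ`: the closed sets are the common zero sets
of sets of polynomials with coefficients in `K`. It is the topology induced by the map to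
`Spec K[X_s | s ∈ σ]` which sends a point to the prime ideal of the polynomials vanishing at it. -/
@[reducible]
def affineZariski (K Ω σ : Type*) [Field K] [Field Ω] [Algebra K Ω] : TopologicalSpace (σ → Ω) :=
  TopologicalSpace.induced
    (fun x => (⟨RingHom.ker (MvPolynomial.aeval x : MvPolynomial σ K →ₐ[K] Ω),
      RingHom.ker_isPrime _⟩ : PrimeSpectrum (MvPolynomial σ K)))
    inferInstance

/-- Homogeneous coordinates of a point of `M_d × Γ`: a nonzero form `F` and two linearly independent
vectors `u`, `v`, which represent `([F], [u], ⟨u, v⟩)`. -/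
structure Frame (Ω : Type*) [Field Ω] (n d : ℕ) where
  /-- the form -/
  F : Form Ω n d
  /-- a vector spanning the point -/
  u : Fin (n + 1) → Ω
  /-- a second vector of the line -/
  v : Fin (n + 1) → Ω
  F_ne_zero : F ≠ 0
  linearIndependent : LinearIndependent Ω ![u, v]

/-- The index set of the affine coordinates of a frame: the monomials of degree `d` (for the
coefficients of `F`), and the coordinates of `u` and of `v`. -/
abbrev FrameCoord (n d : ℕ) : Type :=
  {e : Fin (n + 1) →₀ ℕ // e.degree = d} ⊕ Fin (n + 1) ⊕ Fin (n + 1)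

/-- The affine coordinates of a frame. -/
def Frame.coords {Ω : Type*} [Field Ω] {n d : ℕ} (x : Frame Ω n d) : FrameCoord n d → Ω :=
  Sum.elim (fun e => (x.F : MvPolynomial (Fin (n + 1)) Ω).coeff e.1) (Sum.elim x.u x.v)

theorem Frame.u_ne_zero {Ω : Type*} [Field Ω] {n d : ℕ} (x : Frame Ω n d) : x.u ≠ 0 :=
  x.linearIndependent.ne_zero 0

/-- The point `([F], [u], ⟨u, v⟩)` of `M_d × Γ` represented by the frame `(F, u, v)`. -/
def Frame.toFlag (K : Type*) {Ω : Type*} [Field Ω] {n d : ℕ} (x : Frame Ω n d) :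
    HypersurfaceFlag K Ω n d where
  F := Projectivization.mk Ω x.F x.F_ne_zero
  p := Projectivization.mk Ω x.u x.u_ne_zero
  L := Submodule.span Ω {x.u, x.v}
  finrank_L := by
    have h := finrank_span_eq_card x.linearIndependent
    rwa [Matrix.range_cons, Matrix.range_cons, Matrix.range_empty, Set.union_empty,
      Set.singleton_union, Fintype.card_fin] at h
  p_le_L := by
    rw [Projectivization.submodule_mk]
    exact Submodule.span_mono (by simp)

/-- The Zariski topology over `K` on `M_d × Γ`: a set is closed if and only if it is defined by
polynomial equations with coefficients in `K` in the homogeneous coordinates `(F, u, v)`. As for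
projective space, it is the quotient topology of the Zariski topology on homogeneous coordinates.
If `Ω` is an algebraic closure of `K`, the closed sets are those of the `K`-scheme `M_d × Γ`. -/
instance HypersurfaceFlag.zariski (K Ω : Type*) [Field K] [Field Ω] [Algebra K Ω] (n d : ℕ) :
    TopologicalSpace (HypersurfaceFlag K Ω n d) :=
  TopologicalSpace.coinduced (Frame.toFlag K)
    (TopologicalSpace.induced Frame.coords (affineZariski K Ω (FrameCoord n d)))

/-! ### The incidence variety `Y_{d,m}` -/

/-- The polynomial `F(u + t v)` in the variable `t`. -/
def restrictToLine {Ω : Type*} [Field Ω] {n : ℕ} (F : MvPolynomial (Fin (n + 1)) Ω)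
    (u v : Fin (n + 1) → Ω) : Polynomial Ω :=
  MvPolynomial.aeval (fun i => Polynomial.C (u i) + Polynomial.C (v i) * Polynomial.X) F

/-- `Y_{d,m}`: the set of all `([F], p, L)` such that `L` intersects the hypersurface `F = 0` at `p`
with multiplicity at least `m` (this includes the case that `L` lies in the hypersurface). -/
def Y (K Ω : Type*) [Field Ω] (n d m : ℕ) : Set (HypersurfaceFlag K Ω n d) :=
  {y | ∀ u v : Fin (n + 1) → Ω, y.p.submodule = Submodule.span Ω {u} →
    y.L = Submodule.span Ω {u, v} →
    Polynomial.X ^ m ∣ restrictToLine (y.F.rep : MvPolynomial (Fin (n + 1)) Ω) u v}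

/-! ### The local equations and the Jacobian matrix -/

/-- The indices of the local coordinates `ξ₁, …, ξₙ, ζ₂, …, ζₙ` of `Γ`. -/
abbrev LocalCoord (n : ℕ) : Type :=
  {i : Fin (n + 1) // 1 ≤ i.val} ⊕ {i : Fin (n + 1) // 2 ≤ i.val}

/-- The coordinates of the point `(1, ξ₁ + t, ξ₂ + ζ₂ t, …, ξₙ + ζₙ t)` of the line `L_{(ξ,ζ)}`, with
`t` as the polynomial variable and `ξ`, `ζ` as variables of the coefficients. -/
def movingPoint (Ω : Type*) [Field Ω] (n : ℕ) (i : Fin (n + 1)) :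
    Polynomial (MvPolynomial (LocalCoord n) Ω) :=
  if h₁ : 1 ≤ i.val then
    Polynomial.C (MvPolynomial.X (Sum.inl ⟨i, h₁⟩)) +
      (if h₂ : 2 ≤ i.val then Polynomial.C (MvPolynomial.X (Sum.inr ⟨i, h₂⟩)) else 1) *
        Polynomial.X
  else 1

/-- The local equation `f_k(ξ, ζ)`, the coefficient of `tᵏ` in
`G(1, ξ₁ + t, ξ₂ + ζ₂ t, …, ξₙ + ζₙ t)`. -/
def localEquation {Ω : Type*} [Field Ω] {n : ℕ} (G : MvPolynomial (Fin (n + 1)) Ω) (k : ℕ) :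
    MvPolynomial (LocalCoord n) Ω :=
  (MvPolynomial.aeval (movingPoint Ω n) G).coeff k

/-- The form `F` written in the coordinates `(x₀, …, xₙ)` dual to the basis `b` of `Ωⁿ⁺¹`, that is
`F(x₀ b₀ + ⋯ + xₙ bₙ)`. -/
def inBasis {Ω : Type*} [Field Ω] {n : ℕ} (b : Module.Basis (Fin (n + 1)) Ω (Fin (n + 1) → Ω))
    (F : MvPolynomial (Fin (n + 1)) Ω) : MvPolynomial (Fin (n + 1)) Ω :=
  MvPolynomial.aeval (fun i => ∑ j, MvPolynomial.C (b j i) * MvPolynomial.X j) F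

/-- The Jacobian matrix `J_m` at the origin of the local equations `f₀, …, f_{m-1}` with respect to
the local coordinates `ξ₁, …, ξₙ, ζ₂, …, ζₙ` given by the basis `b`. -/
def jacobian {Ω : Type*} [Field Ω] {n : ℕ} (m : ℕ)
    (b : Module.Basis (Fin (n + 1)) Ω (Fin (n + 1) → Ω)) (F : MvPolynomial (Fin (n + 1)) Ω) :
    Matrix (Fin m) (LocalCoord n) Ω :=
  Matrix.of fun k c =>
    MvPolynomial.eval 0 (MvPolynomial.pderiv c (localEquation (inBasis b F) k))

/-- A basis of `Ωⁿ⁺¹` is adapted to `(p, L)` if in the dual coordinates `p` is defined by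
`x₁ = ⋯ = xₙ = 0` and `L` is defined by `x₂ = ⋯ = xₙ = 0`. -/
def IsAdapted {K Ω : Type*} [Field Ω] {n d : ℕ} (y : HypersurfaceFlag K Ω n d)
    (b : Module.Basis (Fin (n + 1)) Ω (Fin (n + 1) → Ω)) : Prop :=
  y.p.submodule = Submodule.span Ω {b 0} ∧ y.L = Submodule.span Ω {b 0, b 1}

/-- The degeneracy locus `W_{d,m}` in `Y_{d,m}`, where the rank of `J_m` is less than `m`. The rank
does not depend on the choice of the adapted basis. -/
def W (K Ω : Type*) [Field Ω] (n d m : ℕ) : Set (HypersurfaceFlag K Ω n d) :=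
  {y ∈ Y K Ω n d m | ∃ b, IsAdapted y b ∧
    (jacobian m b (y.F.rep : MvPolynomial (Fin (n + 1)) Ω)).rank < m}

/-- `W⁰_{d,m} = W_{d,m} \ W_{d,2}`. -/
def W₀ (K Ω : Type*) [Field Ω] (n d m : ℕ) : Set (HypersurfaceFlag K Ω n d) :=
  W K Ω n d m \ W K Ω n d 2

end PointLine

end

/-! Everything is reduced to counting parameters for one explicit matrix. In coordinates adapted to
a flag $(p,L)$, with projective dimension written as $n+1$, a form in $Y_{d,m}$ has no monomials
$x_0^{d-k}x_1^k$ with $k<m$. Let $a$ be its coefficient at $x_0^{d-m}x_1^m$ and $g_{i,k}$ its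
coefficient at $x_0^{d-1-k}x_1^kx_i$, where $i$ runs over the $n$ coordinates that vanish on $L$.
The Jacobian matrix then has the columns $(0,\dots,0,ma)$, $(g_{i,0},\dots,g_{i,m-1})$ and
$(0,g_{i,0},\dots,g_{i,m-2})$; this is `contactMatrix`. The rank condition does not depend on the
frame: a change of frame multiplies by a unit and substitutes $t\mapsto tU$ modulo $t^m$
(`IsDegenerate.of_reparametrization`). Hence $Y_{d,m}$ is covered by open affine spaces
(`isOpenEmbedding_chartMap`) on which $W_{d,m}$ is the locus where the rows of `contactMatrix` are
dependent. Codimensions become heights of prime ideals in polynomial rings over $K$.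

If all $g_{i,0}$ vanish, the first row is zero as soon as $m\ge2$; these are $n$ equations, and for
$m=2$ they describe $W_{d,2}$ completely. If some $g_{i,0}\ne0$, let $\lambda$ be a dependency and
$s$ its last nonzero index. The columns force $s\ge2$ and express all $g_{i,s}$ and $g_{i,s-1}$
through earlier coefficients and the $s$ ratios $\lambda_k/\lambda_s$ (`exists_relations`). So $2n$
coefficients are bought with $s\le m-1$ parameters, and if $s=m-1$ and $m\ne0$ in $K$, then also
$a=0$. The codimension is therefore at least $2n+2-m$, or $2n+1-m$ if $m=0$ in $K$
(`le_height_add_of_rowDependent`). The count is made at a generic point of an irreducible subset, by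
comparing height and transcendence degree (`card_relations_le_height_add`).

Upper bounds come from Krull's height theorem: it suffices to give few equations that cut out the
locus on an open set, and one common zero there (`codim_le`). For the component with $g_{i,0}=0$
these are the $n$ coordinates themselves. For $W^0_{d,m}$ one takes the bordered minors around a
nonzero $(m-1)\times(m-1)$ minor, and $a$ if $m\neq0$ in $K$ (`codim_W₀_le`). The stated minima
arise because $W_{d,m}$ contains both loci. -/

noncomputable section

open TopologicalSpace Topology MvPolynomial
open scoped Matrix

namespace PointLine

/-! ### Affine space with the Zariski topology -/

/-- The affine space `Ω^σ`, carrying the Zariski topology over `K`. -/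
@[ext]
structure ZariskiSpace (K Ω σ : Type*) where
  /-- the coordinates of a point -/
  coord : σ → Ω

namespace ZariskiSpace

variable {K Ω σ : Type*} [Field K] [Field Ω] [Algebra K Ω]

instance : TopologicalSpace (ZariskiSpace K Ω σ) :=
  (affineZariski K Ω σ).induced coord

/-- The prime ideal of a point of affine space. -/
def toPrimeSpectrum (x : ZariskiSpace K Ω σ) : PrimeSpectrum (MvPolynomial σ K) :=
  ⟨RingHom.ker (aeval x.coord : MvPolynomial σ K →ₐ[K] Ω), RingHom.ker_isPrime _⟩

theorem isInducing_toPrimeSpectrum :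
    IsInducing (toPrimeSpectrum : ZariskiSpace K Ω σ → PrimeSpectrum (MvPolynomial σ K)) :=
  ⟨induced_compose⟩

theorem isTopologicalBasis : IsTopologicalBasis
    (Set.range fun f : MvPolynomial σ K => {x : ZariskiSpace K Ω σ | aeval x.coord f ≠ 0}) := by
  have h := PrimeSpectrum.isTopologicalBasis_basic_opens.isInducing
    (isInducing_toPrimeSpectrum (K := K) (Ω := Ω) (σ := σ))
  rw [← Set.range_comp] at h
  exact h

theorem isOpen_aeval_ne_zero (f : MvPolynomial σ K) :
    IsOpen {x : ZariskiSpace K Ω σ | aeval x.coord f ≠ 0} :=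
  isTopologicalBasis.isOpen ⟨f, rfl⟩

/-- The ideal of the polynomials vanishing on a set. -/
def ideal (S : Set (ZariskiSpace K Ω σ)) : Ideal (MvPolynomial σ K) :=
  vanishingIdeal K (coord '' S)

theorem mem_ideal {S : Set (ZariskiSpace K Ω σ)} {f : MvPolynomial σ K} :
    f ∈ ideal S ↔ ∀ x ∈ S, aeval x.coord f = 0 := by
  simp [ideal]

theorem ideal_anti {S S' : Set (ZariskiSpace K Ω σ)} (h : S ⊆ S') : ideal S' ≤ ideal S :=
  vanishingIdeal_anti_mono (Set.image_mono h)

/-- The zero set of an ideal. -/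
def zeros (I : Ideal (MvPolynomial σ K)) : Set (ZariskiSpace K Ω σ) :=
  coord ⁻¹' zeroLocus Ω I

theorem mem_zeros {I : Ideal (MvPolynomial σ K)} {x : ZariskiSpace K Ω σ} :
    x ∈ zeros I ↔ ∀ f ∈ I, aeval x.coord f = 0 := Iff.rfl

theorem zeros_anti {I J : Ideal (MvPolynomial σ K)} (h : I ≤ J) :
    (zeros J : Set (ZariskiSpace K Ω σ)) ⊆ zeros I := fun _ hx f hf => hx f (h hf)

/-- This is the Nullstellensatz for equations over $K$ and points over the algebraically closed
field $\Omega$. It makes the point set `ZariskiSpace` large enough to see every prime of the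
polynomial ring, so that chains of closed sets are chains of primes. -/
theorem ideal_zeros_eq [IsAlgClosed Ω] [Finite σ] (P : Ideal (MvPolynomial σ K)) [P.IsPrime] :
    ideal (zeros P : Set (ZariskiSpace K Ω σ)) = P := by
  refine Eq.trans ?_ (MvPolynomial.IsPrime.vanishingIdeal_zeroLocus (K := Ω) P)
  rw [ideal, zeros, Set.image_preimage_eq]
  exact fun x => ⟨⟨x⟩, rfl⟩

theorem closure_eq (S : Set (ZariskiSpace K Ω σ)) : closure S = zeros (ideal S) := by
  ext x
  rw [isTopologicalBasis.mem_closure_iff, mem_zeros]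
  refine ⟨fun h f hf => ?_, ?_⟩
  · by_contra hx
    obtain ⟨y, hy, hyS⟩ := h _ ⟨f, rfl⟩ hx
    exact hy (mem_ideal.1 hf y hyS)
  · rintro h _ ⟨f, rfl⟩ hx
    by_contra hne
    refine hx (h f (mem_ideal.2 fun y hy => ?_))
    by_contra hy'
    exact hne ⟨y, hy', hy⟩

theorem isClosed_zeros (I : Ideal (MvPolynomial σ K)) :
    IsClosed (zeros I : Set (ZariskiSpace K Ω σ)) := by
  refine isClosed_of_closure_subset ?_
  rw [closure_eq]
  exact zeros_anti fun f hf => mem_ideal.2 fun x hx => hx f hf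

theorem isIrreducible_iff {S : Set (ZariskiSpace K Ω σ)} :
    IsIrreducible S ↔ (ideal S).IsPrime := by
  constructor
  · intro h
    refine ⟨?_, ?_⟩
    · obtain ⟨x, hx⟩ := h.1
      intro htop
      have : (1 : MvPolynomial σ K) ∈ ideal S := htop ▸ Submodule.mem_top
      simpa using mem_ideal.1 this x hx
    · intro f g hfg
      by_contra! hcon
      simp only [mem_ideal, not_forall] at hcon
      obtain ⟨⟨x, hx, hfx⟩, y, hy, hgy⟩ := hcon
      obtain ⟨z, hz, hfz, hgz⟩ := h.2 _ _ (isOpen_aeval_ne_zero f) (isOpen_aeval_ne_zero g)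
        ⟨x, hx, hfx⟩ ⟨y, hy, hgy⟩
      have := mem_ideal.1 hfg z hz
      rw [map_mul] at this
      exact (mul_ne_zero hfz hgz) this
  · intro h
    refine ⟨?_, ?_⟩
    · by_contra hS
      rw [Set.not_nonempty_iff_eq_empty] at hS
      subst hS
      refine h.ne_top ((Ideal.eq_top_iff_one _).2 (mem_ideal.2 (by simp)))
    · rintro U V hU hV ⟨x, hxS, hxU⟩ ⟨y, hyS, hyV⟩
      obtain ⟨_, ⟨f, rfl⟩, hfx, hf⟩ := isTopologicalBasis.exists_subset_of_mem_open hxU hU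
      obtain ⟨_, ⟨g, rfl⟩, hgy, hg⟩ := isTopologicalBasis.exists_subset_of_mem_open hyV hV
      have hfg : f * g ∉ ideal S := fun hmem =>
        (h.mem_or_mem hmem).elim (fun h' => hfx (mem_ideal.1 h' x hxS))
          (fun h' => hgy (mem_ideal.1 h' y hyS))
      simp only [mem_ideal, not_forall] at hfg
      obtain ⟨z, hz, hfgz⟩ := hfg
      rw [map_mul] at hfgz
      exact ⟨z, hz, hf (left_ne_zero_of_mul hfgz), hg (right_ne_zero_of_mul hfgz)⟩

theorem ideal_closure (S : Set (ZariskiSpace K Ω σ)) : ideal (closure S) = ideal S := by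
  rw [closure_eq]
  exact le_antisymm (ideal_anti fun x hx => mem_zeros.2 fun f hf => mem_ideal.1 hf x hx)
    fun f hf => mem_ideal.2 fun x hx => hx f hf

variable [IsAlgClosed Ω] [Finite σ]

/-- Irreducible closed subsets of affine space correspond to prime ideals. -/
def irreducibleClosedsOrderIso :
    IrreducibleCloseds (ZariskiSpace K Ω σ) ≃o (PrimeSpectrum (MvPolynomial σ K))ᵒᵈ where
  toFun Z := OrderDual.toDual
    ⟨ideal (Z : Set (ZariskiSpace K Ω σ)), isIrreducible_iff.1 Z.isIrreducible⟩
  invFun P :=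
    { carrier := zeros (OrderDual.ofDual P).asIdeal
      isIrreducible' := isIrreducible_iff.2 <| by
        rw [ideal_zeros_eq]
        exact (OrderDual.ofDual P).isPrime
      isClosed' := isClosed_zeros _ }
  left_inv Z := by
    apply IrreducibleCloseds.ext
    change zeros (ideal (Z : Set (ZariskiSpace K Ω σ))) = _
    rw [← closure_eq, Z.isClosed.closure_eq]
  right_inv P := by
    refine congrArg OrderDual.toDual (PrimeSpectrum.ext ?_)
    exact ideal_zeros_eq (OrderDual.ofDual P).asIdeal
  map_rel_iff' := by
    intro Z Z'
    change ideal (Z' : Set (ZariskiSpace K Ω σ)) ≤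
      ideal (Z : Set (ZariskiSpace K Ω σ)) ↔ (Z : Set (ZariskiSpace K Ω σ)) ⊆ Z'
    refine ⟨fun h => ?_, fun h => ideal_anti h⟩
    have := zeros_anti (Ω := Ω) h
    rwa [← closure_eq, ← closure_eq, Z.isClosed.closure_eq, Z'.isClosed.closure_eq] at this

theorem coheight_eq_height_ideal (Z : IrreducibleCloseds (ZariskiSpace K Ω σ)) :
    Order.coheight Z = (ideal (Z : Set (ZariskiSpace K Ω σ))).height := by
  rw [← Order.coheight_orderIso irreducibleClosedsOrderIso Z]
  exact (PrimeSpectrum.height_eq_orderHeight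
    (OrderDual.ofDual (irreducibleClosedsOrderIso Z))).symm

end ZariskiSpace

/-! ### Codimension in a space with affine charts -/

section Charts

open ZariskiSpace

variable {K Ω : Type*} [Field K] [Field Ω] [Algebra K Ω] [IsAlgClosed Ω]
  {T : Type*} [TopologicalSpace T]

/-- Krull's height theorem: a minimal prime over the equations $g$ contained in the prime of $x_0$
has height at most the number of equations. Its zero set meets $O$ in $x_0$, so it is the closure of
its part in $O$, where the equations already imply membership in $S$. -/
theorem exists_irreducibleCloseds_coheight_le {σ : Type*} [Finite σ] {φ : ZariskiSpace K Ω σ → T}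
    (hφ : IsOpenEmbedding φ) {S : Set T} (g : Finset (MvPolynomial σ K))
    {O : Set (ZariskiSpace K Ω σ)} (hO : IsOpen O) {x₀ : ZariskiSpace K Ω σ} (hx₀ : x₀ ∈ O)
    (hg : ∀ p ∈ g, aeval x₀.coord p = 0) (h : ∀ x ∈ O, (∀ p ∈ g, aeval x.coord p = 0) → φ x ∈ S) :
    ∃ Z : IrreducibleCloseds T, (Z : Set T) ⊆ closure S ∧ Order.coheight Z ≤ g.card := by
  have hle : Ideal.span (g : Set (MvPolynomial σ K)) ≤
      RingHom.ker (aeval x₀.coord : MvPolynomial σ K →ₐ[K] Ω) := Ideal.span_le.2 fun p hp => hg p hp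
  have hprime : (RingHom.ker (aeval x₀.coord : MvPolynomial σ K →ₐ[K] Ω)).IsPrime := RingHom.ker_isPrime _
  obtain ⟨P, hP, hPx⟩ := Ideal.exists_minimalPrimes_le hle
  have hPprime : P.IsPrime := hP.1.1
  let Z : IrreducibleCloseds (ZariskiSpace K Ω σ) :=
    irreducibleClosedsOrderIso.symm (OrderDual.toDual ⟨P, hPprime⟩)
  have hZ : (Z : Set (ZariskiSpace K Ω σ)) = zeros P := rfl
  refine ⟨IrreducibleCloseds.map φ hφ.continuous Z, ?_, ?_⟩
  · have hxZ : x₀ ∈ (Z : Set (ZariskiSpace K Ω σ)) := fun p hp => hPx hp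
    have hdense : (Z : Set (ZariskiSpace K Ω σ)) ⊆ closure (Z ∩ O) :=
      subset_closure_inter_of_isPreirreducible_of_isOpen Z.isIrreducible.2 hO ⟨x₀, hxZ, hx₀⟩
    rw [IrreducibleCloseds.coe_map]
    refine closure_minimal ?_ isClosed_closure
    refine (Set.image_mono hdense).trans ((image_closure_subset_closure_image hφ.continuous).trans
      (closure_mono ?_))
    rintro _ ⟨x, ⟨hxZ, hxO⟩, rfl⟩
    exact h x hxO fun p hp => hxZ p (hP.1.2 (Ideal.subset_span hp))
  · rw [hφ.coheight_map, coheight_eq_height_ideal, hZ,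
      ideal_zeros_eq]
    exact Ideal.height_le_card_of_mem_minimalPrimes_span_finset hP

/-- Noetherianity gives finitely many irreducible components of $S$, so the irreducible set $Z$ lies
in the closure of one of them. That component is dense in its closure and meets some chart, so its
trace there determines the coheight. Since $S$ need not be closed, the hypothesis concerns
irreducible subsets $D$ that really map into $S$, not their closures. -/
theorem le_coheight_of_subset_closure [NoetherianSpace T] {ι : Type*} {σ : ι → Type*}
    [∀ i, Finite (σ i)] {φ : ∀ i, ZariskiSpace K Ω (σ i) → T} (hφ : ∀ i, IsOpenEmbedding (φ i))
    (hcover : ∀ t, ∃ i x, φ i x = t) {S : Set T} {c : ℕ∞}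
    (h : ∀ i (D : Set (ZariskiSpace K Ω (σ i))), IsIrreducible D → φ i '' D ⊆ S →
      c ≤ (ideal D).height)
    (Z : IrreducibleCloseds T) (hZ : (Z : Set T) ⊆ closure S) : c ≤ Order.coheight Z := by
  have hfin : (irreducibleComponents S).Finite := NoetherianSpace.finite_irreducibleComponents
  classical
  have hS : S ⊆ ⋃₀ ((fun C : Set S => closure (Subtype.val '' C)) '' irreducibleComponents S) := by
    intro s hs
    have : (⟨s, hs⟩ : S) ∈ ⋃₀ irreducibleComponents S := by
      rw [sUnion_irreducibleComponents]; trivial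
    obtain ⟨C, hC, hsC⟩ := this
    exact ⟨_, ⟨C, hC, rfl⟩, subset_closure ⟨_, hsC, rfl⟩⟩
  have hfin' := hfin.image (fun C : Set S => closure (Subtype.val '' C : Set T))
  have hclosed : IsClosed
      (⋃₀ ((fun C : Set S => closure (Subtype.val '' C)) '' irreducibleComponents S)) := by
    rw [Set.sUnion_eq_biUnion]
    refine hfin'.isClosed_biUnion ?_
    rintro _ ⟨C, -, rfl⟩
    exact isClosed_closure
  have hZ' := hZ.trans (closure_minimal hS hclosed)
  obtain ⟨_, hmem, hZC⟩ := isIrreducible_iff_sUnion_isClosed.1 Z.isIrreducible hfin'.toFinset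
    (by
      intro z hz
      obtain ⟨C, -, rfl⟩ := hfin'.mem_toFinset.1 hz
      exact isClosed_closure) (by rwa [hfin'.coe_toFinset])
  obtain ⟨C, hC, rfl⟩ := hfin'.mem_toFinset.1 hmem
  have hCirr : IsIrreducible (Subtype.val '' C : Set T) :=
    hC.1.image _ continuous_subtype_val.continuousOn
  obtain ⟨t, ht⟩ := hCirr.1
  obtain ⟨i, x, rfl⟩ := hcover t
  set E : Set T := Subtype.val '' C
  have hD : IsIrreducible (φ i ⁻¹' E) := ⟨⟨x, ht⟩, hCirr.2.preimage (hφ i)⟩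
  let Z' : IrreducibleCloseds (ZariskiSpace K Ω (σ i)) := ⟨closure (φ i ⁻¹' E), hD.closure,
    isClosed_closure⟩
  have hZZ' : Z ≤ IrreducibleCloseds.map (φ i) (hφ i).continuous Z' := by
    intro z hz
    have h1 : E ⊆ closure (E ∩ Set.range (φ i)) :=
      subset_closure_inter_of_isPreirreducible_of_isOpen hCirr.2 (hφ i).isOpen_range
        ⟨φ i x, ht, x, rfl⟩
    have h2 : z ∈ closure (E ∩ Set.range (φ i)) := closure_minimal h1 isClosed_closure (hZC hz)
    refine closure_mono ?_ h2
    rintro _ ⟨hy, y, rfl⟩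
    exact ⟨y, subset_closure hy, rfl⟩
  refine le_trans ?_ (Order.coheight_anti hZZ')
  rw [(hφ i).coheight_map, coheight_eq_height_ideal]
  change c ≤ (ideal (closure (φ i ⁻¹' E))).height
  rw [ideal_closure]
  refine h i _ hD ?_
  rintro _ ⟨y, hy, rfl⟩
  obtain ⟨s, -, hs⟩ := hy
  rw [← hs]
  exact s.2

end Charts

/-! ### Heights of prime ideals of polynomial rings -/

section Height

-- The extension $R\to R[X]$ has going-down, so
-- $\operatorname{ht}P=\operatorname{ht}q+\operatorname{ht}(P/qR[X])$ for the contraction $q$ of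
-- $P$. The last term is positive unless $P$ is extended from $q$.
open Polynomial in
theorem height_comap_C_add_one_le {R : Type*} [CommRing R] [IsNoetherianRing R] (P : Ideal R[X])
    [P.IsPrime] : (P.comap Polynomial.C).height ≤ P.height ∧
      (P ≠ (P.comap Polynomial.C).map Polynomial.C →
        (P.comap Polynomial.C).height + 1 ≤ P.height) := by
  set q := P.comap Polynomial.C with hq
  have : P.LiesOver q := ⟨rfl⟩
  have h := Ideal.height_eq_height_add_of_liesOver_of_hasGoingDown q P
  refine ⟨h ▸ le_self_add, fun hne => ?_⟩
  rw [h]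
  gcongr
  rw [Order.one_le_iff_pos, pos_iff_ne_zero]
  have : (q.map (algebraMap R R[X])).IsPrime := Ideal.isPrime_map_C_of_isPrime
  rw [Ne, Ideal.height_eq_zero_iff_eq_bot]
  intro h0
  apply hne
  refine le_antisymm ?_ Ideal.map_comap_le
  rw [Ideal.map_eq_bot_iff_le_ker, Ideal.mk_ker] at h0
  exact h0

/-- This is the half of "height plus transcendence degree equals dimension" that lower bounds for
heights require. Adding one variable either makes the height grow, or the prime is extended from the
smaller ring and the new coordinate is transcendental over the old ones. -/
theorem exists_algebraicIndepOn_card_le {K κ σ : Type*} [Field K] [Field κ] [Algebra K κ] [Finite σ]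
    (x : σ → κ) : ∃ s : Finset σ, AlgebraicIndepOn K x s ∧
      (Nat.card σ : ℕ∞) ≤
        (RingHom.ker (aeval x : MvPolynomial σ K →ₐ[K] κ)).height + s.card := by
  induction σ using Finite.induction_empty_option with
  | of_equiv e ih =>
    rename_i α β
    obtain ⟨s, hs, hle⟩ := ih (x ∘ e)
    refine ⟨s.map e.toEmbedding, ?_, ?_⟩
    · have : AlgebraicIndependent K (fun i : s => x (e i)) := hs
      unfold AlgebraicIndepOn
      let f : ↥(s.map e.toEmbedding) → s := fun i =>
        ⟨e.symm i, by simpa [Equiv.symm_apply_eq] using i.2⟩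
      have hf : Function.Injective f := fun a b hab => by
        have : e.symm a = e.symm b := congrArg Subtype.val hab
        exact Subtype.ext (e.symm.injective this)
      have h := this.comp f hf
      have heq : (fun i : s => x (e i)) ∘ f = fun i : ↥(s.map e.toEmbedding) => x i := by
        funext i
        simp [f]
      rw [heq] at h
      exact h
    · rw [Finset.card_map, ← Nat.card_congr e]
      refine hle.trans_eq ?_
      congr 1
      rw [← RingEquiv.height_comap (renameEquiv K e).toRingEquiv]
      congr 1
      ext p
      simp [RingHom.mem_ker, Ideal.mem_comap, aeval_rename]
  | h_empty =>
    refine ⟨∅, ?_, by simp⟩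
    have : IsEmpty ((∅ : Finset PEmpty) : Set PEmpty) := by simp
    exact algebraicIndependent_empty_type_iff.2 (algebraMap K κ).injective
  | @h_option α _ ih =>
    obtain ⟨s, hs, hle⟩ := ih (fun i => x (some i))
    classical
    let y : α → κ := fun i => x (some i)
    let ev : Polynomial (MvPolynomial α K) →+* κ := Polynomial.eval₂RingHom
      (aeval y : MvPolynomial α K →ₐ[K] κ).toRingHom (x none)
    let P : Ideal (Polynomial (MvPolynomial α K)) := RingHom.ker ev
    have hPp : P.IsPrime := RingHom.ker_isPrime _
    have hcomap : P.comap Polynomial.C = RingHom.ker (aeval y : MvPolynomial α K →ₐ[K] κ) := by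
      ext p
      simp [P, ev, Ideal.mem_comap, RingHom.mem_ker]
    have hev : ∀ p : MvPolynomial (Option α) K, ev (optionEquivLeft K α p) = aeval x p := by
      intro p
      induction p using MvPolynomial.induction_on with
      | C a => simp [ev]
      | add p q hp hq => simp [hp, hq]
      | mul_X p i hp =>
        rw [map_mul, map_mul, map_mul, hp]
        cases i <;> simp [ev, y]
    have hheight : (RingHom.ker (aeval x : MvPolynomial (Option α) K →ₐ[K] κ)).height
        = P.height := by
      rw [← RingEquiv.height_comap (optionEquivLeft K α).toRingEquiv]
      congr 1
      ext p
      simp [P, Ideal.mem_comap, RingHom.mem_ker, hev]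
    have hPle := height_comap_C_add_one_le P
    rw [hcomap] at hPle
    have hcard : (Nat.card (Option α) : ℕ∞) = Nat.card α + 1 := by
      rw [Finite.card_option]; push_cast; rfl
    rw [hheight, hcard]
    have hsome : AlgebraicIndepOn K x (Option.some '' (s : Set α)) := by
      have : AlgebraicIndependent K (fun i : s => x (some i)) := hs
      unfold AlgebraicIndepOn
      let f : (Option.some '' (s : Set α)) ≃ s :=
        (Equiv.Set.image _ _ (Option.some_injective α)).symm
      convert this.comp f f.injective with i
      obtain ⟨_, j, hj, rfl⟩ := i
      have : f ⟨some j, j, hj, rfl⟩ = ⟨j, hj⟩ := by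
        rw [Equiv.symm_apply_eq]; rfl
      simp only [Function.comp, this]
    by_cases hP : P = (RingHom.ker (aeval y : MvPolynomial α K →ₐ[K] κ)).map Polynomial.C
    · refine ⟨insert none (s.map ⟨some, Option.some_injective α⟩), ?_, ?_⟩
      · have hnone : none ∉ Option.some '' (s : Set α) := by simp
        rw [Finset.coe_insert, Finset.coe_map]
        refine (AlgebraicIndepOn.insert_iff hnone).2 ⟨hsome, ?_⟩
        rw [transcendental_iff]
        intro p hp
        have hsub : Set.range (algebraMap (Algebra.adjoin K (x '' (Option.some '' (s : Set α)))) κ)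
            ⊆ Set.range (aeval y : MvPolynomial α K →ₐ[K] κ) := by
          rintro _ ⟨⟨a, ha⟩, rfl⟩
          change a ∈ (aeval y : MvPolynomial α K →ₐ[K] κ).range
          refine Algebra.adjoin_le ?_ ha
          rintro _ ⟨_, ⟨j, _, rfl⟩, rfl⟩
          exact ⟨X j, by simp [y]⟩
        -- An algebraic relation for the new coordinate lifts to a polynomial over the polynomial
        -- ring and then lies in $P$. As $P$ is extended, all its coefficients vanish at `y`, so the
        -- relation was trivial.
        have hlift : ∃ q : Polynomial (MvPolynomial α K),
            q.map (aeval y : MvPolynomial α K →ₐ[K] κ).toRingHom = p.map (algebraMap _ κ) := by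
          have : p.map (algebraMap _ κ) ∈ Polynomial.lifts
              (aeval y : MvPolynomial α K →ₐ[K] κ).toRingHom := by
            rw [Polynomial.lifts_iff_coeff_lifts]
            intro k
            rw [Polynomial.coeff_map]
            exact hsub ⟨_, rfl⟩
          rwa [Polynomial.mem_lifts] at this
        obtain ⟨q, hq⟩ := hlift
        have hqP : q ∈ P := by
          change ev q = 0
          change Polynomial.eval₂ _ _ q = 0
          rw [← Polynomial.eval_map, hq, Polynomial.eval_map]
          exact hp
        rw [hP, Ideal.mem_map_C_iff] at hqP
        have h0 : p.map (algebraMap _ κ) = 0 := by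
          rw [← hq]
          ext k
          rw [Polynomial.coeff_map]
          simpa using hqP k
        exact (Polynomial.map_eq_zero_iff Subtype.val_injective).1 h0
      · rw [Finset.card_insert_of_notMem (by simp), Finset.card_map]
        push_cast
        rw [← add_assoc]
        gcongr
        exact hle.trans (by gcongr; exact hPle.1)
    · refine ⟨s.map ⟨some, Option.some_injective α⟩, ?_, ?_⟩
      · rw [Finset.coe_map]
        exact hsome
      · rw [Finset.card_map]
        calc (Nat.card α : ℕ∞) + 1 ≤ ((RingHom.ker (aeval y : MvPolynomial α K →ₐ[K] κ)).height +
              s.card) + 1 := by gcongr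
          _ = ((RingHom.ker (aeval y : MvPolynomial α K →ₐ[K] κ)).height + 1) + s.card := by ring
          _ ≤ _ := by gcongr; exact hPle.2 hP

/-- A comparison of ranks in the matroid of algebraic independence: elements of the field generated
by $t$ are algebraic over the ring generated by $t$, so they lie in the matroid closure of $t$. -/
theorem card_le_of_subset_adjoin {K κ σ : Type*} [Field K] [Field κ] [Algebra K κ] {x : σ → κ}
    {s : Finset σ} (hs : AlgebraicIndepOn K x s) (t : Finset κ)
    (h : ∀ i, x i ∈ IntermediateField.adjoin K (t : Set κ)) : s.card ≤ t.card := by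
  classical
  have hinj : Set.InjOn x s := by
    have := AlgebraicIndependent.injective (R := K) (x := fun i : (s : Set σ) => x i) hs
    exact Set.injOn_iff_injective.2 this
  have hind : (AlgebraicIndependent.matroid K κ).Indep (x '' s) :=
    AlgebraicIndependent.matroid_indep_iff.2 <| by
      have := AlgebraicIndependent.coe_range (R := K) (x := fun i : (s : Set σ) => x i) hs
      rwa [Set.range_comp' x Subtype.val, Subtype.range_val] at this
  have hsub : x '' s ⊆ (AlgebraicIndependent.matroid K κ).closure (t : Set κ) := by
    rw [AlgebraicIndependent.matroid_closure_eq]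
    rintro _ ⟨i, -, rfl⟩
    obtain ⟨a, ha, b, hb, hab⟩ := IntermediateField.mem_adjoin_iff_div.1 (h i)
    change IsAlgebraic (Algebra.adjoin K (t : Set κ)) (x i)
    rw [hab, div_eq_mul_inv]
    exact (isAlgebraic_algebraMap (⟨a, ha⟩ : Algebra.adjoin K (t : Set κ))).mul
      (isAlgebraic_algebraMap (⟨b, hb⟩ : Algebra.adjoin K (t : Set κ))).inv
  have h1 := (AlgebraicIndependent.matroid K κ).eRk_mono hsub
  rw [Matroid.eRk_closure_eq, hind.eRk_eq_encard, hinj.encard_image] at h1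
  have h2 := h1.trans ((AlgebraicIndependent.matroid K κ).eRk_le_encard _)
  simpa using h2

end Height

/-! ### Heights from linear relations between coordinates -/

section LinearRelations

variable {K κ : Type*} [Field K] [Field κ] [Algebra K κ]

theorem card_le_height_ker_add {σ : Type*} [Finite σ] (x : σ → κ) (t : Finset κ)
    (h : ∀ i, x i ∈ IntermediateField.adjoin K (t : Set κ)) :
    (Nat.card σ : ℕ∞) ≤
      (RingHom.ker (aeval x : MvPolynomial σ K →ₐ[K] κ)).height + t.card := by
  obtain ⟨s, hs, hle⟩ := exists_algebraicIndepOn_card_le (K := K) x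
  refine hle.trans ?_
  gcongr
  exact card_le_of_subset_adjoin hs t h

/-- The normalized value $1$ may itself have its index in $R$, so one cannot simply discard it from
the remaining generators. Instead a basis of their span is chosen that contains $1$; removing $1$
saves one element in either case. -/
theorem exists_finset_span_le {k E : Type*} [Field k] [Algebra k κ] [Fintype E]
    (G : E → κ) {e₀ : E} (hG : G e₀ = 1) (R : Finset E)
    (hR : ∀ e ∈ R, G e ∈ Submodule.span k (G '' (R : Set E)ᶜ)) :
    ∃ b : Finset κ, b.card + R.card + 1 ≤ Fintype.card E ∧
      ∀ e, G e ∈ Submodule.span k (insert 1 (b : Set κ)) := by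
  classical
  set V := Submodule.span k (G '' (R : Set E)ᶜ) with hV
  have hGV : ∀ e, G e ∈ V := fun e => by
    by_cases he : e ∈ R
    · exact hR e he
    · exact Submodule.subset_span ⟨e, by simpa using he, rfl⟩
  have h1 : LinearIndepOn k id ({1} : Set κ) := LinearIndepOn.singleton one_ne_zero
  have hsub : ({1} : Set κ) ⊆ insert 1 (G '' (R : Set E)ᶜ) := by simp
  set B := h1.extend hsub with hB
  have hBfin : B.Finite := (((R : Set E)ᶜ.toFinite.image G).insert 1).subset (h1.extend_subset hsub)
  have hspan : Submodule.span k B = V := by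
    rw [hB, LinearIndepOn.span_extend_eq_span, Submodule.span_insert_eq_span]
    exact hG ▸ hGV e₀
  have h1B : (1 : κ) ∈ B := h1.subset_extend hsub rfl
  have hBind : LinearIndepOn k id B := h1.linearIndepOn_extend hsub
  have hcard : hBfin.toFinset.card ≤ Fintype.card E - R.card := by
    have h2 : Module.finrank k (Submodule.span k B) = hBfin.toFinset.card := by
      have := hBfin.fintype
      rw [finrank_span_set_eq_card hBind]
      congr 1
      ext; simp
    rw [← h2, hspan, hV, ← Finset.card_compl, ← Finset.coe_compl, ← Finset.coe_image]
    exact (finrank_span_finset_le_card _).trans Finset.card_image_le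
  refine ⟨hBfin.toFinset.erase 1, ?_, fun e => ?_⟩
  · have := Finset.card_erase_add_one (s := hBfin.toFinset) (a := 1) (by simpa using h1B)
    have h3 : R.card ≤ Fintype.card E := Finset.card_le_univ R
    omega
  · have : insert 1 ((hBfin.toFinset.erase 1 : Finset κ) : Set κ) = B := by
      rw [← Finset.coe_insert, Finset.insert_erase (by simpa using h1B), hBfin.coe_toFinset]
    rw [this, hspan]
    exact hGV e

/-- Parameter count: all coordinates lie in the field generated by $\Lambda$, the coordinates
indexed by $L$, and at most $|E|-|R|-1$ further elements. Since there are $|L|+|E|-1$ variables,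
each relation in $R$ not paid for by an element of $\Lambda$ contributes to the height. -/
theorem card_relations_le_height_add {L E : Type*} [Fintype L] [Fintype E] {e₀ : E}
    (x : L ⊕ {e : E // e ≠ e₀} → κ) (G : E → κ) (hG : G e₀ = 1)
    (hx : ∀ e, x (Sum.inr e) = G e) (R : Finset E) (Λ : Finset κ)
    (hR : ∀ e ∈ R, G e ∈ Submodule.span (IntermediateField.adjoin K (Λ : Set κ))
      (G '' (R : Set E)ᶜ)) :
    (R.card : ℕ∞) ≤
      (RingHom.ker (aeval x : MvPolynomial (L ⊕ {e : E // e ≠ e₀}) K →ₐ[K] κ)).height + Λ.card := by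
  classical
  obtain ⟨b, hb, hspan⟩ := exists_finset_span_le G hG R hR
  set t : Finset κ := Λ ∪ (Finset.univ.image fun l => x (Sum.inl l)) ∪ b with ht
  have hle : IntermediateField.adjoin K (Λ : Set κ) ≤ IntermediateField.adjoin K (t : Set κ) :=
    IntermediateField.adjoin.mono _ _ _ (by
      intro a ha
      simp only [ht, Finset.coe_union]
      exact Or.inl (Or.inl ha))
  have hmem : ∀ i, x i ∈ IntermediateField.adjoin K (t : Set κ) := by
    rintro (l | e)
    · apply IntermediateField.subset_adjoin
      simp [ht]
    · rw [hx]
      refine Submodule.span_induction (p := fun z _ => z ∈ IntermediateField.adjoin K (t : Set κ))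
        ?_ ?_ ?_ ?_ (hspan e)
      · intro z hz
        rcases hz with rfl | hz
        · exact one_mem _
        · apply IntermediateField.subset_adjoin
          simp only [ht, Finset.coe_union]
          exact Or.inr hz
      · exact zero_mem _
      · exact fun _ _ _ _ h h' => add_mem h h'
      · intro a z _ hz
        exact mul_mem (hle a.2) hz
  have h := card_le_height_ker_add x t hmem
  have htc : t.card ≤ Λ.card + Fintype.card L + b.card := by
    refine (Finset.card_union_le _ _).trans ?_
    gcongr
    refine (Finset.card_union_le _ _).trans ?_
    gcongr
    exact Finset.card_image_le.trans_eq (by simp)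
  have hσ : Nat.card (L ⊕ {e : E // e ≠ e₀}) + 1 = Fintype.card L + Fintype.card E := by
    rw [Nat.card_eq_fintype_card, Fintype.card_sum, Fintype.card_subtype_compl,
      Fintype.card_subtype_eq]
    have : 0 < Fintype.card E := Fintype.card_pos_iff.2 ⟨e₀⟩
    omega
  generalize Nat.card (L ⊕ {e : E // e ≠ e₀}) = N at h hσ
  generalize (RingHom.ker (aeval x : MvPolynomial (L ⊕ {e : E // e ≠ e₀}) K →ₐ[K] κ)).height = h₀ at h ⊢
  cases h₀ with
  | top => simp
  | coe h₀ =>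
    norm_cast at h ⊢
    omega

end LinearRelations

/-! ### Regular functions -/

section Regular

variable {K Ω τ Z : Type*} [Field K] [Field Ω] [Algebra K Ω]

/-- The functions which on the set `V` are quotients of polynomials with coefficients in `K` in the
coordinates `c`, with a denominator that vanishes nowhere on `V`. -/
def regular (K : Type*) {Ω τ Z : Type*} [Field K] [Field Ω] [Algebra K Ω] (c : Z → τ → Ω)
    (V : Set Z) : Subalgebra K (Z → Ω) where
  carrier := {φ | ∃ p q : MvPolynomial τ K, ∀ z ∈ V,
    aeval (c z) q ≠ 0 ∧ φ z * aeval (c z) q = aeval (c z) p}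
  mul_mem' := by
    rintro φ ψ ⟨p, q, h⟩ ⟨p', q', h'⟩
    refine ⟨p * p', q * q', fun z hz => ⟨?_, ?_⟩⟩
    · rw [map_mul]
      exact mul_ne_zero (h z hz).1 (h' z hz).1
    · rw [map_mul, map_mul, ← (h z hz).2, ← (h' z hz).2, Pi.mul_apply]
      ring
  add_mem' := by
    rintro φ ψ ⟨p, q, h⟩ ⟨p', q', h'⟩
    refine ⟨p * q' + p' * q, q * q', fun z hz => ⟨?_, ?_⟩⟩
    · rw [map_mul]
      exact mul_ne_zero (h z hz).1 (h' z hz).1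
    · rw [map_mul, map_add, map_mul, map_mul, ← (h z hz).2, ← (h' z hz).2, Pi.add_apply]
      ring
  algebraMap_mem' r := ⟨C r, 1, fun z _ => by simp⟩

variable {c : Z → τ → Ω} {V V' : Set Z}

theorem coord_mem_regular (t : τ) : (fun z => c z t) ∈ regular K c V :=
  ⟨X t, 1, fun z _ => by simp⟩

theorem regular_anti (h : V' ⊆ V) : regular K c V ≤ regular K c V' := by
  rintro φ ⟨p, q, hpq⟩
  exact ⟨p, q, fun z hz => hpq z (h hz)⟩

theorem inv_mem_regular {φ : Z → Ω} (hφ : φ ∈ regular K c V) (h0 : ∀ z ∈ V, φ z ≠ 0) :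
    (fun z => (φ z)⁻¹) ∈ regular K c V := by
  obtain ⟨p, q, hpq⟩ := hφ
  refine ⟨q, p, fun z hz => ⟨?_, ?_⟩⟩
  · rw [← (hpq z hz).2]
    exact mul_ne_zero (h0 z hz) (hpq z hz).1
  · rw [← (hpq z hz).2, ← mul_assoc, inv_mul_cancel₀ (h0 z hz), one_mul]

theorem div_mem_regular {φ ψ : Z → Ω} (hφ : φ ∈ regular K c V) (hψ : ψ ∈ regular K c V)
    (h0 : ∀ z ∈ V, ψ z ≠ 0) : (fun z => φ z / ψ z) ∈ regular K c V := by
  simp only [div_eq_mul_inv]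
  exact mul_mem hφ (inv_mem_regular hψ h0)

theorem aeval_mem_regular {σ : Type*} {r : Z → σ → Ω} (hr : ∀ s, (fun z => r z s) ∈ regular K c V)
    (f : MvPolynomial σ K) : (fun z => aeval (r z) f) ∈ regular K c V := by
  have : (fun z => aeval (r z) f) = aeval (fun s z => r z s) f := by
    funext z
    have h := comp_aeval_apply (fun (s : σ) (z : Z) => r z s)
      (Pi.evalAlgHom K (fun _ : Z => Ω) z) f
    exact h.symm
  rw [this]
  have h2 := comp_aeval_apply (fun s => (⟨fun z => r z s, hr s⟩ : regular K c V))
    (regular K c V).val f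
  change _ = aeval (fun s z => r z s) f at h2
  rw [← h2]
  exact Subtype.property _

variable [TopologicalSpace Z]

theorem isOpen_regular_ne_zero (hc : Continuous fun z => (⟨c z⟩ : ZariskiSpace K Ω τ))
    (hV : IsOpen V) {φ : Z → Ω} (hφ : φ ∈ regular K c V) : IsOpen {z | z ∈ V ∧ φ z ≠ 0} := by
  obtain ⟨p, q, hpq⟩ := hφ
  have : {z | z ∈ V ∧ φ z ≠ 0} =
      V ∩ (fun z => (⟨c z⟩ : ZariskiSpace K Ω τ)) ⁻¹' {x | aeval x.coord p ≠ 0} := by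
    ext z
    simp only [Set.mem_ofPred_eq, Set.mem_inter_iff, Set.mem_preimage]
    refine and_congr_right fun hz => ?_
    rw [← (hpq z hz).2]
    simp [(hpq z hz).1]
  rw [this]
  exact hV.inter ((ZariskiSpace.isOpen_aeval_ne_zero p).preimage hc)

theorem continuous_of_regular {σ : Type*} (hc : Continuous fun z => (⟨c z⟩ : ZariskiSpace K Ω τ))
    {r : Z → σ → Ω} (hr : ∀ s, (fun z => r z s) ∈ regular K c Set.univ) :
    Continuous fun z => (⟨r z⟩ : ZariskiSpace K Ω σ) := by
  refine ZariskiSpace.isTopologicalBasis.continuous_iff.2 ?_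
  rintro _ ⟨f, rfl⟩
  have := isOpen_regular_ne_zero hc isOpen_univ (aeval_mem_regular hr f)
  simpa using this

end Regular

/-! ### Linear substitutions -/

section Substitution

variable {ι R S : Type*} [Fintype ι] [CommRing R] [CommRing S]

/-- The substitution `x ↦ M x` in a polynomial. -/
def substitute (M : Matrix ι ι R) : MvPolynomial ι R →ₐ[R] MvPolynomial ι R :=
  bind₁ M.toMvPolynomial

theorem substitute_mul (M N : Matrix ι ι R) (p : MvPolynomial ι R) :
    substitute N (substitute M p) = substitute (M * N) p := by
  rw [substitute, substitute, substitute, bind₁_bind₁]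
  congr 2
  funext i
  rw [Matrix.toMvPolynomial_mul]

theorem substitute_one [DecidableEq ι] (p : MvPolynomial ι R) :
    substitute (1 : Matrix ι ι R) p = p := by
  rw [substitute, Matrix.toMvPolynomial_one, bind₁_X_left, AlgHom.id_apply]

theorem substitute_isHomogeneous (M : Matrix ι ι R) {p : MvPolynomial ι R} {d : ℕ}
    (hp : p.IsHomogeneous d) : (substitute M p).IsHomogeneous d := by
  have := hp.aeval M.toMvPolynomial (fun i => Matrix.toMvPolynomial_isHomogeneous M i)
  rwa [one_mul] at this

theorem map_substitute (f : R →+* S) (M : Matrix ι ι R) (p : MvPolynomial ι R) :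
    map f (substitute M p) = substitute (M.map f) (map f p) := by
  rw [substitute, map_bind₁, substitute]
  congr 2
  funext i
  rw [Matrix.toMvPolynomial_map]

theorem aeval_substitute {A : Type*} [CommRing A] [Algebra R A] (M : Matrix ι ι R) (x : ι → A)
    (p : MvPolynomial ι R) :
    aeval x (substitute M p) = aeval (fun i => ∑ j, algebraMap R A (M i j) * x j) p := by
  rw [substitute, aeval_bind₁]
  congr 2
  funext i
  simp only [Matrix.toMvPolynomial, map_sum, aeval_monomial]
  simp

theorem pderiv_substitute (M : Matrix ι ι R) (j : ι) (p : MvPolynomial ι R) :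
    pderiv j (substitute M p) = ∑ i, C (M i j) * substitute M (pderiv i p) := by
  classical
  induction p using MvPolynomial.induction_on with
  | C a => simp [substitute]
  | add p q hp hq => simp only [map_add, hp, hq, mul_add, Finset.sum_add_distrib]
  | mul_X p k hp =>
    have hk : pderiv j (substitute M (X k)) = C (M k j) := by
      rw [substitute, bind₁_X_right, Matrix.toMvPolynomial, map_sum, Finset.sum_eq_single j]
      · rw [pderiv_monomial]; simp
      · intro l _ hl
        rw [pderiv_monomial]
        simp [hl]
      · simp
    simp only [map_mul, pderiv_mul, hp, hk, map_add, mul_add, Finset.sum_add_distrib,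
      Finset.sum_mul, pderiv_X]
    congr 1
    · exact Finset.sum_congr rfl fun i _ => by ring
    · rw [Finset.sum_eq_single k]
      · simp [mul_comm]
      · intro l _ hl
        simp [hl.symm]
      · simp

end Substitution

theorem inBasis_eq_substitute {Ω : Type*} [Field Ω] {n : ℕ}
    (b : Module.Basis (Fin (n + 1)) Ω (Fin (n + 1) → Ω)) (F : MvPolynomial (Fin (n + 1)) Ω) :
    inBasis b F = substitute (Matrix.of fun i j => b j i) F := by
  rw [inBasis, substitute, bind₁]
  congr 2
  funext i
  simp [Matrix.toMvPolynomial, C_mul_X_eq_monomial]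

/-! ### Restriction to the first coordinate line -/

section Line

variable {R : Type*} [CommRing R] {n : ℕ}

/-- The point `(1, t, 0, …, 0)`. -/
def linePoint (R : Type*) [CommRing R] (n : ℕ) : Fin (n + 1 + 1) → Polynomial R :=
  Fin.cons 1 (Fin.cons Polynomial.X fun _ => 0)

@[simp] theorem linePoint_zero : linePoint R n 0 = 1 := rfl
@[simp] theorem linePoint_one : linePoint R n 1 = Polynomial.X := rfl
@[simp] theorem linePoint_succ_succ (i : Fin n) : linePoint R n i.succ.succ = 0 := rfl

/-- The exponent of the monomial `x₀ ^ (d - k) x₁ ^ k`. -/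
def lineExp (n d k : ℕ) : Fin (n + 1 + 1) →₀ ℕ :=
  Finsupp.single 0 (d - k) + Finsupp.single 1 k

@[simp] theorem lineExp_zero (d k : ℕ) : lineExp n d k 0 = d - k := by simp [lineExp]
@[simp] theorem lineExp_one (d k : ℕ) : lineExp n d k 1 = k := by simp [lineExp]
@[simp] theorem lineExp_succ_succ (d k : ℕ) (i : Fin n) : lineExp n d k i.succ.succ = 0 := by
  have h1 : (1 : Fin (n + 1 + 1)) ≠ i.succ.succ := by
    rw [← Fin.succ_zero_eq_one, Ne, Fin.succ_inj]
    exact (Fin.succ_ne_zero _).symm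
  simp [lineExp, h1]

theorem degree_lineExp {d k : ℕ} (h : k ≤ d) : (lineExp n d k).degree = d := by
  rw [lineExp, map_add, Finsupp.degree_single, Finsupp.degree_single]
  omega

theorem degree_eq_sum (e : Fin (n + 1 + 1) →₀ ℕ) :
    e.degree = e 0 + (e 1 + ∑ i : Fin n, e i.succ.succ) := by
  rw [Finsupp.degree_eq_sum, Fin.sum_univ_succ, Fin.sum_univ_succ]
  rfl

theorem eq_lineExp {d : ℕ} {e : Fin (n + 1 + 1) →₀ ℕ} (he : e.degree = d)
    (h : ∀ i : Fin n, e i.succ.succ = 0) : e = lineExp n d (e 1) := by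
  have h0 : e 0 = d - e 1 := by
    rw [degree_eq_sum] at he
    simp only [h, Finset.sum_const_zero] at he
    omega
  ext i
  refine Fin.cases ?_ (fun i => Fin.cases ?_ (fun i => ?_) i) i
  · simpa using h0
  · simp [Fin.succ_zero_eq_one]
  · simp [h]

/-- Only monomials in $x_0,x_1$ survive on the line. No bound on $k$ is needed: for $k>d$ the
truncated exponent `lineExp n d k` has degree $k\ne d$, so both sides vanish. -/
theorem coeff_aeval_linePoint {d : ℕ} {G : MvPolynomial (Fin (n + 1 + 1)) R}
    (hG : G.IsHomogeneous d) (k : ℕ) :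
    (aeval (linePoint R n) G).coeff k = coeff (lineExp n d k) G := by
  rw [aeval_def, eval₂_eq', Polynomial.finsetSum_coeff]
  have hterm : ∀ e ∈ G.support, (algebraMap R (Polynomial R) (coeff e G) *
      ∏ i, linePoint R n i ^ e i).coeff k = if e = lineExp n d k then coeff e G else 0 := by
    intro e he
    have hdeg : e.degree = d := by
      have := hG (mem_support_iff.1 he)
      rw [Finsupp.degree_eq_weight_one]
      exact this
    rw [Fin.prod_univ_succ, Fin.prod_univ_succ, linePoint_zero, one_pow, one_mul,
      Fin.succ_zero_eq_one, linePoint_one]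
    simp only [linePoint_succ_succ]
    by_cases h : ∀ i : Fin n, e i.succ.succ = 0
    · simp only [h, pow_zero, Finset.prod_const_one, mul_one, ← Polynomial.C_eq_algebraMap,
        Polynomial.coeff_C_mul, Polynomial.coeff_X_pow]
      have heq := eq_lineExp hdeg h
      by_cases hke : k = e 1
      · rw [if_pos hke, if_pos (by rw [hke]; exact heq), mul_one]
      · rw [if_neg hke, if_neg, mul_zero]
        intro h'
        apply hke
        rw [h', lineExp_one]
    · rw [not_forall] at h
      obtain ⟨i, hi⟩ := h
      rw [Finset.prod_eq_zero (Finset.mem_univ i) (zero_pow hi), if_neg]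
      · simp
      · rintro rfl
        simp at hi
  rw [Finset.sum_congr rfl hterm, Finset.sum_ite_eq']
  split_ifs with h
  · rfl
  · exact (notMem_support_iff.1 h).symm

/-- The exponent of the monomial `x₀ ^ (d - 1 - k) x₁ ^ k xᵢ`, where `i` indexes the coordinates
other than the first two. -/
def normalExp (n d : ℕ) (i : Fin n) (k : ℕ) : Fin (n + 1 + 1) →₀ ℕ :=
  lineExp n (d - 1) k + Finsupp.single i.succ.succ 1

theorem degree_normalExp {d k : ℕ} (h : k < d) (i : Fin n) : (normalExp n d i k).degree = d := by
  rw [normalExp, map_add, degree_lineExp (by omega), Finsupp.degree_single]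
  omega

@[simp] theorem normalExp_one (d k : ℕ) (i : Fin n) : normalExp n d i k 1 = k := by
  have h1 : i.succ.succ ≠ (1 : Fin (n + 1 + 1)) := by
    rw [← Fin.succ_zero_eq_one, Ne, Fin.succ_inj]
    exact Fin.succ_ne_zero _
  simp [normalExp, h1]

theorem normalExp_succ_succ (d k : ℕ) (i j : Fin n) :
    normalExp n d i k j.succ.succ = if i = j then 1 else 0 := by
  simp [normalExp, Finsupp.single_apply]

theorem normalExp_ne_lineExp (d k d' k' : ℕ) (i : Fin n) : normalExp n d i k ≠ lineExp n d' k' := by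
  intro h
  have := DFunLike.congr_fun h i.succ.succ
  simp [normalExp_succ_succ] at this

theorem normalExp_inj {d k k' : ℕ} {i i' : Fin n} :
    normalExp n d i k = normalExp n d i' k' ↔ i = i' ∧ k = k' := by
  refine ⟨fun h => ⟨?_, ?_⟩, fun h => by rw [h.1, h.2]⟩
  · have := DFunLike.congr_fun h i.succ.succ
    rw [normalExp_succ_succ, normalExp_succ_succ, if_pos rfl] at this
    by_contra hne
    rw [if_neg (Ne.symm hne)] at this
    omega
  · simpa using DFunLike.congr_fun h 1

theorem coeff_aeval_linePoint_pderiv {d : ℕ} {G : MvPolynomial (Fin (n + 1 + 1)) R}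
    (hG : G.IsHomogeneous d) (k : ℕ) (j : Fin (n + 1 + 1)) :
    (aeval (linePoint R n) (pderiv j G)).coeff k =
      coeff (lineExp n (d - 1) k + Finsupp.single j 1) G * (lineExp n (d - 1) k j + 1) := by
  rw [coeff_aeval_linePoint hG.pderiv, coeff_pderiv]

theorem coeff_aeval_linePoint_pderiv_zero {d : ℕ} {G : MvPolynomial (Fin (n + 1 + 1)) R}
    (hG : G.IsHomogeneous d) {k : ℕ} (hk : k < d) (h0 : coeff (lineExp n d k) G = 0) :
    (aeval (linePoint R n) (pderiv 0 G)).coeff k = 0 := by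
  rw [coeff_aeval_linePoint_pderiv hG]
  have : lineExp n (d - 1) k + Finsupp.single 0 1 = lineExp n d k := by
    refine (eq_lineExp (d := d) ?_ fun i => ?_).trans ?_
    · rw [map_add, degree_lineExp (by omega), Finsupp.degree_single]
      omega
    · simp
    · simp
  rw [this, h0, zero_mul]

theorem coeff_aeval_linePoint_pderiv_one {d : ℕ} {G : MvPolynomial (Fin (n + 1 + 1)) R}
    (hG : G.IsHomogeneous d) {k : ℕ} (hk : k < d) :
    (aeval (linePoint R n) (pderiv 1 G)).coeff k =
      coeff (lineExp n d (k + 1)) G * ((k + 1 : ℕ) : R) := by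
  rw [coeff_aeval_linePoint_pderiv hG]
  have : lineExp n (d - 1) k + Finsupp.single 1 1 = lineExp n d (k + 1) := by
    refine (eq_lineExp (d := d) ?_ fun i => ?_).trans ?_
    · rw [map_add, degree_lineExp (by omega), Finsupp.degree_single]
      omega
    · have h1 : (1 : Fin (n + 1 + 1)) ≠ i.succ.succ := by
        rw [← Fin.succ_zero_eq_one, Ne, Fin.succ_inj]
        exact (Fin.succ_ne_zero _).symm
      simp [h1]
    · simp
  rw [this, lineExp_one]
  push_cast
  rfl

theorem coeff_aeval_linePoint_pderiv_succ_succ {d : ℕ} {G : MvPolynomial (Fin (n + 1 + 1)) R}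
    (hG : G.IsHomogeneous d) (k : ℕ) (i : Fin n) :
    (aeval (linePoint R n) (pderiv i.succ.succ G)).coeff k = coeff (normalExp n d i k) G := by
  rw [coeff_aeval_linePoint_pderiv hG, lineExp_succ_succ, normalExp]
  simp

end Line

/-! ### Matrices of deficient row rank -/

section Degenerate

variable {F ι : Type*} [Field F] {m : ℕ}

/-- The rows of a matrix are linearly dependent. -/
def RowDependent [Fintype ι] (A : Matrix (Fin m) ι F) : Prop := ∃ l ≠ 0, Matrix.vecMul l A = 0

theorem rowDependent_iff_not_linearIndependent [Fintype ι] {A : Matrix (Fin m) ι F} :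
    RowDependent A ↔ ¬ LinearIndependent F A.row := by
  rw [← Matrix.vecMul_injective_iff]
  constructor
  · rintro ⟨l, hl, h⟩ hinj
    exact hl (hinj (by simpa using h))
  · intro h
    have h2 : ¬ ∀ l, A.vecMulLinear l = 0 → l = 0 := fun h' =>
      h ((injective_iff_map_eq_zero A.vecMulLinear).2 h')
    push Not at h2
    obtain ⟨l, h1, h2⟩ := h2
    exact ⟨l, h2, h1⟩

theorem rank_lt_iff_rowDependent [Fintype ι] {A : Matrix (Fin m) ι F} :
    A.rank < m ↔ RowDependent A := by
  rw [rowDependent_iff_not_linearIndependent, linearIndependent_iff_card_eq_finrank_span,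
    Fintype.card_fin]
  have h : A.rank ≤ m := A.rank_le_card_height.trans_eq (Fintype.card_fin m)
  rw [A.rank_eq_finrank_span_row] at h ⊢
  exact ⟨fun h' => (ne_of_lt h').symm, fun h' => lt_of_le_of_ne h (Ne.symm h')⟩

/-- Expressing dependence by maximal minors makes it a polynomial condition, which can be
transported to generic points. -/
theorem rowDependent_iff_det_eq_zero [Fintype ι] {A : Matrix (Fin m) ι F} :
    RowDependent A ↔ ∀ c : Fin m → ι, (A.submatrix id c).det = 0 := by
  constructor
  · rintro ⟨l, hl, h⟩ c
    refine Matrix.exists_vecMul_eq_zero_iff.1 ⟨l, hl, ?_⟩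
    funext k
    exact congrFun h (c k)
  · intro h
    rw [← rank_lt_iff_rowDependent]
    by_contra hr
    have hrank : A.rank = m := le_antisymm (A.rank_le_card_height.trans_eq (Fintype.card_fin m)) (not_lt.1 hr)
    rw [A.rank_eq_finrank_span_cols] at hrank
    have hf := Submodule.exists_fun_fin_finrank_span_eq F (Set.range A.col)
    rw [hrank] at hf
    obtain ⟨f, hf, -, hli⟩ := hf
    choose c hc using hf
    have hcol : LinearIndependent F (A.submatrix id c).col := by
      have : (A.submatrix id c).col = f := funext hc
      rwa [this]
    have hunit := Matrix.linearIndependent_cols_iff_isUnit.1 hcol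
    rw [Matrix.isUnit_iff_isUnit_det, h c] at hunit
    exact hunit.ne_zero rfl

end Degenerate

/-! ### The Jacobian matrix in terms of coefficients -/

section Jacobian

variable {Ω : Type*} [Field Ω] {n : ℕ}

theorem map_eval_movingPoint (i : Fin (n + 1 + 1)) :
    (movingPoint Ω (n + 1) i).map (eval 0) = linePoint Ω n i := by
  refine Fin.cases ?_ (fun i => Fin.cases ?_ (fun i => ?_) i) i
  · simp [movingPoint]
  · simp [movingPoint, linePoint]
  · simp [movingPoint]

theorem map_eval_aeval_movingPoint (G : MvPolynomial (Fin (n + 1 + 1)) Ω) :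
    (aeval (movingPoint Ω (n + 1)) G).map (eval 0) = aeval (linePoint Ω n) G := by
  induction G using MvPolynomial.induction_on with
  | C a => simp [algebraMap_eq, Polynomial.algebraMap_apply]
  | add p q hp hq => simp only [map_add, Polynomial.map_add, hp, hq]
  | mul_X p i hp => simp only [map_mul, Polynomial.map_mul, hp, aeval_X, map_eval_movingPoint]

/-- The derivative at the origin of `movingPoint` with respect to a local coordinate. -/
def movingPointDeriv (Ω : Type*) [Field Ω] (n : ℕ) (c : LocalCoord (n + 1))
    (i : Fin (n + 1 + 1)) : Polynomial Ω :=
  match c with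
  | Sum.inl j => if i = j then 1 else 0
  | Sum.inr j => if i = j then Polynomial.X else 0

theorem eval_pderiv_coeff_movingPoint (c : LocalCoord (n + 1)) (i : Fin (n + 1 + 1)) (k : ℕ) :
    eval 0 (pderiv c ((movingPoint Ω (n + 1) i).coeff k)) =
      (movingPointDeriv Ω n c i).coeff k := by
  unfold movingPoint
  have hone : pderiv c ((1 : Polynomial (MvPolynomial (LocalCoord (n + 1)) Ω)).coeff k) = 0 := by
    rw [Polynomial.coeff_one]
    split_ifs <;> simp
  have hX : pderiv c ((Polynomial.X : Polynomial (MvPolynomial (LocalCoord (n + 1)) Ω)).coeff k)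
      = 0 := by
    rw [Polynomial.coeff_X]
    split_ifs <;> simp
  split_ifs with h₁ h₂
  · rw [Polynomial.coeff_add, Polynomial.coeff_C_mul, Polynomial.coeff_C, map_add, pderiv_mul, hX]
    rcases c with ⟨j, hj⟩ | ⟨j, hj⟩
    · by_cases hij : i = j
      · subst hij
        simp [movingPointDeriv, Polynomial.coeff_one, apply_ite (pderiv _)]
      · have hij' : (Sum.inl ⟨i, h₁⟩ : LocalCoord (n + 1)) ≠ Sum.inl ⟨j, hj⟩ := by simpa using hij
        simp [movingPointDeriv, hij, apply_ite (pderiv _), pderiv_X_of_ne hij']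
    · by_cases hij : i = j
      · subst hij
        simp [movingPointDeriv, apply_ite (pderiv _), Polynomial.coeff_X]
      · have hij' : (Sum.inr ⟨i, h₂⟩ : LocalCoord (n + 1)) ≠ Sum.inr ⟨j, hj⟩ := by simpa using hij
        simp [movingPointDeriv, hij, apply_ite (pderiv _), pderiv_X_of_ne hij']
  · rw [one_mul, Polynomial.coeff_add, Polynomial.coeff_C, map_add, hX]
    rcases c with ⟨j, hj⟩ | ⟨j, hj⟩
    · by_cases hij : i = j
      · subst hij
        simp [movingPointDeriv, Polynomial.coeff_one, apply_ite (pderiv _)]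
      · have hij' : (Sum.inl ⟨i, h₁⟩ : LocalCoord (n + 1)) ≠ Sum.inl ⟨j, hj⟩ := by simpa using hij
        simp [movingPointDeriv, hij, apply_ite (pderiv _), pderiv_X_of_ne hij']
    · have hij : i ≠ j := by rintro rfl; exact h₂ hj
      simp [movingPointDeriv, hij, apply_ite (pderiv _)]
  · rw [hone]
    rcases c with ⟨j, hj⟩ | ⟨j, hj⟩
    · have hij : i ≠ j := by rintro rfl; exact h₁ hj
      simp [movingPointDeriv, hij]
    · have hij : i ≠ j := by rintro rfl; exact h₁ (by omega)
      simp [movingPointDeriv, hij]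

/-- The Leibniz rule for the derivation $\sum_i\delta_i\,\partial_i$ along $x$; it is the inductive
step of the chain rule below. -/
theorem sum_aeval_pderiv_mul_X {ι A : Type*} [Fintype ι] [CommRing A] [Algebra Ω A] (x : ι → A)
    (δ : ι → A) (p : MvPolynomial ι Ω) (j : ι) :
    ∑ i, aeval x (pderiv i (p * X j)) * δ i =
      (∑ i, aeval x (pderiv i p) * δ i) * x j + aeval x p * δ j := by
  classical
  have h : ∀ i, aeval x (pderiv i (p * X j)) * δ i =
      aeval x (pderiv i p) * δ i * x j + if i = j then aeval x p * δ j else 0 := by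
    intro i
    rw [pderiv_mul, map_add, map_mul, map_mul, aeval_X]
    split_ifs with h
    · subst h
      rw [pderiv_X_self, map_one]
      ring
    · rw [pderiv_X_of_ne (Ne.symm h), map_zero]
      ring
  rw [Finset.sum_congr rfl fun i _ => h i, Finset.sum_add_distrib, ← Finset.sum_mul,
    Finset.sum_ite_eq' Finset.univ j, if_pos (Finset.mem_univ j)]

/-- The chain rule at the origin: a column $\xi_j$ of the Jacobian lists the coefficients of
$\partial_jG(1,t,0,\dots,0)$, and a column $\zeta_j$ those of $t$ times this polynomial. -/
theorem eval_pderiv_localEquation (G : MvPolynomial (Fin (n + 1 + 1)) Ω)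
    (c : LocalCoord (n + 1)) (k : ℕ) :
    eval 0 (pderiv c (localEquation G k)) =
      (∑ i, aeval (linePoint Ω n) (pderiv i G) * movingPointDeriv Ω n c i).coeff k := by
  unfold localEquation
  induction G using MvPolynomial.induction_on generalizing k with
  | C a =>
    simp only [algHom_C, pderiv_C, map_zero, zero_mul, Finset.sum_const_zero, Polynomial.coeff_zero,
      Polynomial.algebraMap_apply, Polynomial.coeff_C, algebraMap_eq]
    split_ifs <;> simp
  | add p q hp hq =>
    simp only [map_add, Polynomial.coeff_add, hp, hq, add_mul, Finset.sum_add_distrib]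
  | mul_X p j hp =>
    rw [sum_aeval_pderiv_mul_X, map_mul, aeval_X, Polynomial.coeff_mul, map_sum, map_sum, Polynomial.coeff_add,
      Polynomial.coeff_mul, Polynomial.coeff_mul, ← Finset.sum_add_distrib]
    refine Finset.sum_congr rfl fun a _ => ?_
    rw [pderiv_mul, map_add, map_mul, map_mul, hp, eval_pderiv_coeff_movingPoint,
      ← map_eval_movingPoint, ← map_eval_aeval_movingPoint, Polynomial.coeff_map,
      Polynomial.coeff_map]

theorem jacobian_inl {m : ℕ} (b : Module.Basis (Fin (n + 1 + 1)) Ω (Fin (n + 1 + 1) → Ω))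
    (F : MvPolynomial (Fin (n + 1 + 1)) Ω) (k : Fin m) (j : {i : Fin (n + 1 + 1) // 1 ≤ i.val}) :
    jacobian m b F k (Sum.inl j) = (aeval (linePoint Ω n) (pderiv j.1 (inBasis b F))).coeff k := by
  refine (eval_pderiv_localEquation _ _ _).trans ?_
  simp [movingPointDeriv]

theorem jacobian_inr {m : ℕ} (b : Module.Basis (Fin (n + 1 + 1)) Ω (Fin (n + 1 + 1) → Ω))
    (F : MvPolynomial (Fin (n + 1 + 1)) Ω) (k : Fin m) (j : {i : Fin (n + 1 + 1) // 2 ≤ i.val}) :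
    jacobian m b F k (Sum.inr j) =
      (Polynomial.X * aeval (linePoint Ω n) (pderiv j.1 (inBasis b F))).coeff k := by
  refine (eval_pderiv_localEquation _ _ _).trans ?_
  simp [movingPointDeriv, mul_comm]

/-- The matrix to which the Jacobian matrix specializes: `g` are the coefficients of a form of
degree `d`, written in coordinates adapted to the flag. -/
def contactMatrix {R : Type*} [CommRing R] (d m : ℕ) (g : (Fin (n + 1 + 1) →₀ ℕ) → R) :
    Matrix (Fin m) (Option (Fin n ⊕ Fin n)) R :=
  Matrix.of fun k c => match c with
    | none => if k.val + 1 = m then g (lineExp n d m) * (m : R) else 0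
    | some (Sum.inl i) => g (normalExp n d i k)
    | some (Sum.inr i) => if k.val = 0 then 0 else g (normalExp n d i (k - 1))

theorem contactMatrix_map {R S : Type*} [CommRing R] [CommRing S] (f : R →+* S) (d m : ℕ)
    (g : (Fin (n + 1 + 1) →₀ ℕ) → R) :
    (contactMatrix d m g).map f = contactMatrix d m fun e => f (g e) := by
  ext k c
  rcases c with _ | i | i
  · simp [contactMatrix, apply_ite f]
  · simp [contactMatrix]
  · simp [contactMatrix, apply_ite f]

theorem coeff_aeval_linePoint_pderiv_one_eq {d m : ℕ} (hmd : m ≤ d)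
    {G : MvPolynomial (Fin (n + 1 + 1)) Ω} (hG : G.IsHomogeneous d)
    (h0 : ∀ k < m, coeff (lineExp n d k) G = 0) {k : ℕ} (hk : k < m) :
    (aeval (linePoint Ω n) (pderiv 1 G)).coeff k =
      if k + 1 = m then coeff (lineExp n d m) G * (m : Ω) else 0 := by
  rw [coeff_aeval_linePoint_pderiv_one hG (by omega)]
  split_ifs with h
  · rw [h]
  · rw [h0 _ (by omega), zero_mul]

theorem fin_cases_one_le {i : Fin (n + 1 + 1)} (hi : 1 ≤ i.val) :
    i = 1 ∨ ∃ j : Fin n, i = j.succ.succ := by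
  revert hi
  refine Fin.cases ?_ (fun i => Fin.cases ?_ (fun i => ?_) i) i
  · intro h; simp at h
  · intro _; exact Or.inl rfl
  · intro _; exact Or.inr ⟨i, rfl⟩

/-- The two matrices agree column by column. In the column of $\xi_1$ the entry in row $k$ is
$(k+1)$ times the coefficient of $x_0^{d-k-1}x_1^{k+1}$, which vanishes on $Y_{d,m}$ except in the
last row; this is where the factor $m$, and hence the characteristic, enters. -/
theorem jacobian_rank_lt_iff {d m : ℕ} (hmd : m ≤ d)
    (b : Module.Basis (Fin (n + 1 + 1)) Ω (Fin (n + 1 + 1) → Ω))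
    (F : MvPolynomial (Fin (n + 1 + 1)) Ω) (hF : (inBasis b F).IsHomogeneous d)
    (h0 : ∀ k < m, coeff (lineExp n d k) (inBasis b F) = 0) :
    (jacobian m b F).rank < m ↔
      RowDependent (contactMatrix d m fun e => coeff e (inBasis b F)) := by
  rw [rank_lt_iff_rowDependent]
  refine exists_congr fun l => and_congr_right fun _ => ?_
  have e1 : ∀ k : Fin m, ∀ h, jacobian m b F k (Sum.inl ⟨1, h⟩) =
      contactMatrix d m (fun e => coeff e (inBasis b F)) k none := fun k h => by
    rw [jacobian_inl, coeff_aeval_linePoint_pderiv_one_eq hmd hF h0 k.2]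
    rfl
  have e2 : ∀ k : Fin m, ∀ (i : Fin n) h, jacobian m b F k (Sum.inl ⟨i.succ.succ, h⟩) =
      contactMatrix d m (fun e => coeff e (inBasis b F)) k (some (Sum.inl i)) := fun k i h => by
    rw [jacobian_inl, coeff_aeval_linePoint_pderiv_succ_succ hF]
    rfl
  have e3 : ∀ k : Fin m, ∀ (i : Fin n) h, jacobian m b F k (Sum.inr ⟨i.succ.succ, h⟩) =
      contactMatrix d m (fun e => coeff e (inBasis b F)) k (some (Sum.inr i)) := fun k i h => by
    rw [jacobian_inr]
    change _ = if k.val = 0 then 0 else coeff (normalExp n d i (k - 1)) (inBasis b F)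
    rcases hk : k.val with _ | k'
    · simp
    · rw [Polynomial.coeff_X_mul, coeff_aeval_linePoint_pderiv_succ_succ hF]
      simp
  constructor
  · intro h
    funext c
    rcases c with _ | i | i
    · have := congrFun h (Sum.inl ⟨1, by simp⟩)
      simpa only [Matrix.vecMul, dotProduct, Pi.zero_apply, e1] using this
    · have := congrFun h (Sum.inl ⟨i.succ.succ, by simp⟩)
      simpa only [Matrix.vecMul, dotProduct, Pi.zero_apply, e2] using this
    · have := congrFun h (Sum.inr ⟨i.succ.succ, by simp⟩)
      simpa only [Matrix.vecMul, dotProduct, Pi.zero_apply, e3] using this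
  · intro h
    funext c
    rcases c with ⟨j, hj⟩ | ⟨j, hj⟩
    · obtain rfl | ⟨i, rfl⟩ := fin_cases_one_le hj
      · simpa only [Matrix.vecMul, dotProduct, Pi.zero_apply, e1] using congrFun h none
      · simpa only [Matrix.vecMul, dotProduct, Pi.zero_apply, e2] using congrFun h (some (Sum.inl i))
    · obtain rfl | ⟨i, rfl⟩ := fin_cases_one_le (by omega : 1 ≤ j.val)
      · simp at hj
      · simpa only [Matrix.vecMul, dotProduct, Pi.zero_apply, e3] using congrFun h (some (Sum.inr i))

end Jacobian

/-! ### Independence of the adapted basis -/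

section Reparametrization

variable {Ω ι : Type*} [Field Ω]

/-- The point `u + t v`. -/
def affineLine (u v : ι → Ω) (i : ι) : Polynomial Ω :=
  Polynomial.C (u i) + Polynomial.C (v i) * Polynomial.X

theorem aeval_mul_of_isHomogeneous {R A : Type*} [CommRing R] [CommRing A] [Algebra R A]
    {D : ℕ} {H : MvPolynomial ι R} (hH : H.IsHomogeneous D) (r : A) (x : ι → A) :
    aeval (fun i => r * x i) H = r ^ D * aeval x H := by
  rw [aeval_def, aeval_def, eval₂_eq, eval₂_eq, Finset.mul_sum]
  refine Finset.sum_congr rfl fun e he => ?_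
  have hdeg : e.degree = D := by
    rw [Finsupp.degree_eq_weight_one]
    exact hH (mem_support_iff.1 he)
  simp only [mul_pow, Finset.prod_mul_distrib]
  rw [Finset.prod_pow_eq_pow_sum, ← hdeg, Finsupp.degree_apply]
  ring

theorem dvd_aeval_sub_aeval {A : Type*} [CommRing A] [Algebra Ω A] (H : MvPolynomial ι Ω) {a : A}
    {x y : ι → A} (h : ∀ i, a ∣ x i - y i) : a ∣ aeval x H - aeval y H := by
  have hxy : (fun i => Ideal.Quotient.mkₐ Ω (Ideal.span {a}) (x i)) =
      fun i => Ideal.Quotient.mkₐ Ω (Ideal.span {a}) (y i) := by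
    funext i
    exact Ideal.Quotient.eq.2 (Ideal.mem_span_singleton.2 (h i))
  rw [← Ideal.mem_span_singleton, ← Ideal.Quotient.eq]
  change Ideal.Quotient.mkₐ Ω (Ideal.span {a}) _ = Ideal.Quotient.mkₐ Ω (Ideal.span {a}) _
  exact (comp_aeval_apply x _ H).trans ((congrArg (fun z => aeval z H) hxy).trans
    (comp_aeval_apply y _ H).symm)

theorem aeval_affineLine_comp (u v : ι → Ω) (s : Polynomial Ω) (H : MvPolynomial ι Ω) :
    (aeval (affineLine u v) H).comp s =
      aeval (fun i => Polynomial.C (u i) + Polynomial.C (v i) * s) H := by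
  have := comp_aeval_apply (affineLine u v) (Polynomial.aeval s : Polynomial Ω →ₐ[Ω] Polynomial Ω) H
  refine Eq.trans ?_ (this.trans ?_)
  · rfl
  congr 2
  funext i
  simp [affineLine]

/-- With $\rho=\alpha+\gamma t$, the point $\alpha u+t(\beta v+\gamma u)$ equals $\rho u+\beta tv$.
As $\rho$ is a unit modulo $t^m$, this is $\rho\,(u+tUv)$ with $U\equiv\beta\rho^{-1}$, and
homogeneity extracts $\rho^D$. -/
theorem exists_reparametrization (m : ℕ) {α β : Ω} (γ : Ω) (hα : α ≠ 0) (hβ : β ≠ 0)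
    (u v : ι → Ω) : ∃ U : Polynomial Ω, U.coeff 0 ≠ 0 ∧
      Polynomial.X ^ m ∣ (Polynomial.C α + Polynomial.C γ * Polynomial.X) * (Polynomial.X * U) -
        Polynomial.C β * Polynomial.X ∧
      ∀ (D : ℕ) (H : MvPolynomial ι Ω), H.IsHomogeneous D →
        Polynomial.X ^ m ∣ aeval (affineLine (α • u) (β • v + γ • u)) H -
          (Polynomial.C α + Polynomial.C γ * Polynomial.X) ^ D *
            (aeval (affineLine u v) H).comp (Polynomial.X * U) := by
  set ρ : Polynomial Ω := Polynomial.C α + Polynomial.C γ * Polynomial.X with hρ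
  have hcop : IsCoprime ρ (Polynomial.X ^ m) := by
    apply IsCoprime.pow_right
    refine ⟨Polynomial.C α⁻¹, - Polynomial.C (α⁻¹ * γ), ?_⟩
    rw [hρ, mul_add, ← Polynomial.C_mul, inv_mul_cancel₀ hα]
    simp only [Polynomial.C_mul, Polynomial.C_1]
    ring
  obtain ⟨a, b, hab⟩ := hcop
  have hmod : Polynomial.X ^ m ∣ ρ * (Polynomial.X * (Polynomial.C β * a)) -
      Polynomial.C β * Polynomial.X :=
    ⟨- (b * Polynomial.C β * Polynomial.X), by
      linear_combination (Polynomial.C β * Polynomial.X) * hab⟩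
  have hhom : ∀ U : Polynomial Ω, Polynomial.X ^ m ∣ ρ * (Polynomial.X * U) -
        Polynomial.C β * Polynomial.X → ∀ (D : ℕ) (H : MvPolynomial ι Ω), H.IsHomogeneous D →
        Polynomial.X ^ m ∣ aeval (affineLine (α • u) (β • v + γ • u)) H -
          ρ ^ D * (aeval (affineLine u v) H).comp (Polynomial.X * U) := by
    intro U hU D H hH
    rw [aeval_affineLine_comp, ← aeval_mul_of_isHomogeneous hH]
    refine dvd_aeval_sub_aeval H fun i => ?_
    have : affineLine (α • u) (β • v + γ • u) i -
        ρ * (Polynomial.C (u i) + Polynomial.C (v i) * (Polynomial.X * U)) =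
        - Polynomial.C (v i) * (ρ * (Polynomial.X * U) - Polynomial.C β * Polynomial.X) := by
      simp only [affineLine, Pi.add_apply, Pi.smul_apply, smul_eq_mul, Polynomial.C_add,
        Polynomial.C_mul, hρ]
      ring
    rw [this]
    exact hU.mul_left _
  -- For $m=0$ the Bézout identity gives no control over the constant term of `a`, but the
  -- congruences are void and $U=1$ serves.
  rcases m with _ | m
  · exact ⟨1, by simp, by simp, by simp⟩
  · refine ⟨Polynomial.C β * a, ?_, hmod, hhom _ hmod⟩
    have h0 := congrArg (fun p => Polynomial.eval 0 p) hab
    simp only [Polynomial.eval_add, Polynomial.eval_mul, hρ, Polynomial.eval_C, Polynomial.eval_X,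
      mul_zero, add_zero, Polynomial.eval_pow, zero_pow (Nat.succ_ne_zero m),
      Polynomial.eval_one] at h0
    rw [Polynomial.coeff_zero_eq_eval_zero, Polynomial.eval_mul, Polynomial.eval_C]
    refine mul_ne_zero hβ fun h => ?_
    rw [h, zero_mul] at h0
    exact zero_ne_one h0

theorem X_pow_dvd_aeval_affineLine {m D : ℕ} {α β : Ω} (γ : Ω) (hα : α ≠ 0) (hβ : β ≠ 0)
    {u v : ι → Ω} {H : MvPolynomial ι Ω} (hH : H.IsHomogeneous D)
    (h : Polynomial.X ^ m ∣ aeval (affineLine u v) H) :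
    Polynomial.X ^ m ∣ aeval (affineLine (α • u) (β • v + γ • u)) H := by
  obtain ⟨U, -, -, hU⟩ := exists_reparametrization m γ hα hβ u v
  refine (dvd_iff_dvd_of_dvd_sub (hU D H hH)).2 (Dvd.dvd.mul_left ?_ _)
  obtain ⟨Q, hQ⟩ := h
  rw [hQ, Polynomial.mul_comp, Polynomial.X_pow_comp, mul_pow]
  exact (dvd_mul_right _ _).mul_right _

variable [Fintype ι]

/-- The derivative of `F` in the direction `w`, restricted to the line `u + t v`. -/
def lineDeriv (F : MvPolynomial ι Ω) (u v : ι → Ω) : (ι → Ω) →ₗ[Ω] Polynomial Ω :=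
  ∑ i, (LinearMap.toSpanSingleton Ω (Polynomial Ω) (aeval (affineLine u v) (pderiv i F))).comp
    (LinearMap.proj i)

theorem lineDeriv_apply (F : MvPolynomial ι Ω) (u v w : ι → Ω) :
    lineDeriv F u v w = aeval (affineLine u v) (∑ i, C (w i) * pderiv i F) := by
  simp [lineDeriv, Polynomial.smul_eq_C_mul]

/-- Modulo `t ^ m`, the polynomials `D_w F (u + t v)` and `t D_w F (u + t v)` do not span. -/
def IsDegenerate (m : ℕ) (F : MvPolynomial ι Ω) (u v : ι → Ω) : Prop :=
  ∃ l : Polynomial Ω →ₗ[Ω] Ω, l ≠ 0 ∧ (∀ Q, l (Polynomial.X ^ m * Q) = 0) ∧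
    ∀ w, l (lineDeriv F u v w) = 0 ∧ l (Polynomial.X * lineDeriv F u v w) = 0

/-- The functional is pulled back along $Q\mapsto\rho^dQ(tU)$, which is bijective modulo $t^m$. If
$T$ and $T'$ are the derivatives along the old and the new parametrization, then
$T'\equiv\rho^{d-1}T(tU)$. Hence $T$ is sent to $\rho T'=\alpha T'+\gamma tT'$ and $tT$ to $\beta
tT'$ modulo $t^m$, and the given functional kills both. -/
theorem IsDegenerate.of_reparametrization {m d : ℕ} {α β γ : Ω} (hα : α ≠ 0) (hβ : β ≠ 0)
    {u v : ι → Ω} {F : MvPolynomial ι Ω} (hF : F.IsHomogeneous d)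
    (h : IsDegenerate m F (α • u) (β • v + γ • u)) : IsDegenerate m F u v := by
  obtain ⟨l, hl0, hlm, hl⟩ := h
  obtain ⟨U, hU0, hUβ, hU⟩ := exists_reparametrization m γ hα hβ u v
  set ρ : Polynomial Ω := Polynomial.C α + Polynomial.C γ * Polynomial.X with hρ
  have hcongr : ∀ {P Q : Polynomial Ω}, Polynomial.X ^ m ∣ P - Q → l P = l Q := by
    rintro P Q ⟨R, hR⟩
    rw [← sub_eq_zero, ← map_sub, hR, hlm]
  let ν : Polynomial Ω →ₗ[Ω] Ω := l.comp ((LinearMap.mulLeft Ω (ρ ^ d)).comp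
    (Polynomial.aeval (Polynomial.X * U) : Polynomial Ω →ₐ[Ω] Polynomial Ω).toLinearMap)
  have hν : ∀ Q, ν Q = l (ρ ^ d * Q.comp (Polynomial.X * U)) := fun Q => rfl
  refine ⟨ν, ?_, ?_, fun w => ?_⟩
  · intro h0
    apply hl0
    -- The map $Q\mapsto\rho^dQ(tU)$ sends $t^k$ to $t^k$ times a polynomial with nonzero constant
    -- term. If the pullback is zero, descending induction on the order $k$ shows that `l` kills
    -- every multiple of $t^k$.
    have key : ∀ j ≤ m, ∀ Q, l (Polynomial.X ^ (m - j) * Q) = 0 := by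
      intro j hj
      induction j with
      | zero => simpa using hlm
      | succ j ih =>
        intro Q
        set k := m - (j + 1) with hk
        have hk' : m - j = k + 1 := by omega
        have hρ0 : ρ.coeff 0 ≠ 0 := by simpa [hρ] using hα
        have hc : (ρ ^ d * U ^ k).coeff 0 ≠ 0 := by
          rw [Polynomial.mul_coeff_zero, Polynomial.coeff_zero_eq_eval_zero,
            Polynomial.coeff_zero_eq_eval_zero, Polynomial.eval_pow, Polynomial.eval_pow,
            ← Polynomial.coeff_zero_eq_eval_zero, ← Polynomial.coeff_zero_eq_eval_zero]
          exact mul_ne_zero (pow_ne_zero _ hρ0) (pow_ne_zero _ hU0)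
        set c := Q.coeff 0 / (ρ ^ d * U ^ k).coeff 0 with hcdef
        have hdvd : Polynomial.X ∣ Q - Polynomial.C c * (ρ ^ d * U ^ k) := by
          rw [Polynomial.X_dvd_iff, Polynomial.coeff_sub, Polynomial.coeff_C_mul, hcdef,
            div_mul_cancel₀ _ hc, sub_self]
        obtain ⟨R, hR⟩ := hdvd
        have hQ : Polynomial.X ^ k * Q = c • (ρ ^ d * (Polynomial.X ^ k).comp (Polynomial.X * U)) +
            Polynomial.X ^ (m - j) * R := by
          rw [hk', Polynomial.smul_eq_C_mul, Polynomial.X_pow_comp, mul_pow, pow_succ]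
          linear_combination Polynomial.X ^ k * hR
        rw [hQ, map_add, map_smul, ← hν, h0, ih (by omega)]
        simp
    ext Q
    have := key m le_rfl (Polynomial.X ^ Q)
    simpa [Polynomial.monomial_one_right_eq_X_pow] using this
  · intro Q
    rw [hν, Polynomial.mul_comp, Polynomial.X_pow_comp, mul_pow]
    have : ρ ^ d * (Polynomial.X ^ m * U ^ m * Q.comp (Polynomial.X * U)) =
        Polynomial.X ^ m * (ρ ^ d * U ^ m * Q.comp (Polynomial.X * U)) := by ring
    rw [this, hlm]
  · have hhom : (∑ i, C (w i) * pderiv i F).IsHomogeneous (d - 1) :=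
      IsHomogeneous.sum _ _ _ fun i _ => by
        simpa using (isHomogeneous_C ι (w i)).mul hF.pderiv
    have hT := hU _ _ hhom
    rw [← lineDeriv_apply, ← lineDeriv_apply] at hT
    obtain ⟨h1, h2⟩ := hl w
    set T := lineDeriv F u v w with hTdef
    set T' := lineDeriv F (α • u) (β • v + γ • u) w with hTdef'
    -- For $d=0$ the truncated degree $d-1$ breaks the relation between $T$ and $T'$, but then all
    -- derivatives are zero.
    rcases d with _ | d
    · have hF0 : ∀ i, pderiv i F = 0 := by
        intro i
        rw [totalDegree_eq_zero_iff_eq_C.1 (Nat.le_zero.1 hF.totalDegree_le), pderiv_C]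
      have hT0 : T = 0 := by simp [hTdef, lineDeriv_apply, hF0]
      simp [hT0]
    · rw [Nat.add_sub_cancel] at hT
      constructor
      · rw [hν]
        have : l (ρ ^ (d + 1) * T.comp (Polynomial.X * U)) = l (ρ * T') :=
          hcongr (by
            have := (hT.mul_left ρ).neg_right
            refine this.trans (dvd_of_eq ?_)
            ring)
        rw [this]
        have hρT : ρ * T' = α • T' + γ • (Polynomial.X * T') := by
          rw [Polynomial.smul_eq_C_mul, Polynomial.smul_eq_C_mul, hρ]
          ring
        rw [hρT, map_add, map_smul, map_smul, h1, h2]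
        simp
      · rw [hν]
        have : l (ρ ^ (d + 1) * (Polynomial.X * T).comp (Polynomial.X * U)) =
            l (β • (Polynomial.X * T')) := hcongr (by
            rw [Polynomial.mul_comp, Polynomial.X_comp, Polynomial.smul_eq_C_mul]
            have h3 := ((hT.mul_left (ρ * (Polynomial.X * U))).neg_right).add (hUβ.mul_left T')
            refine h3.trans (dvd_of_eq ?_)
            ring)
        rw [this, map_smul, h2, smul_zero]

theorem lineDeriv_smul (c : Ω) (F : MvPolynomial ι Ω) (u v w : ι → Ω) :
    lineDeriv (c • F) u v w = c • lineDeriv F u v w := by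
  simp [lineDeriv, Finset.smul_sum, smul_comm c]

theorem isDegenerate_smul_iff {m : ℕ} {c : Ω} (hc : c ≠ 0) {F : MvPolynomial ι Ω} {u v : ι → Ω} :
    IsDegenerate m (c • F) u v ↔ IsDegenerate m F u v := by
  simp [IsDegenerate, lineDeriv_smul, hc]

end Reparametrization

/-! ### Degeneracy in adapted coordinates -/

section Adapted

variable {Ω : Type*} [Field Ω] {n : ℕ}

theorem aeval_linePoint_substitute {S : Matrix (Fin (n + 1 + 1)) (Fin (n + 1 + 1)) Ω}
    (F : MvPolynomial (Fin (n + 1 + 1)) Ω) :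
    aeval (linePoint Ω n) (substitute S F) =
      aeval (affineLine (fun i => S i 0) (fun i => S i 1)) F := by
  rw [aeval_substitute]
  congr 2
  funext i
  rw [Fin.sum_univ_succ, Fin.sum_univ_succ]
  simp [affineLine]

/-- Derivatives in the directions of a basis become partial derivatives in the dual coordinates;
this links the coordinate-free condition to the matrix. -/
theorem lineDeriv_col (S : Matrix (Fin (n + 1 + 1)) (Fin (n + 1 + 1)) Ω)
    (F : MvPolynomial (Fin (n + 1 + 1)) Ω) (j : Fin (n + 1 + 1)) :
    lineDeriv F (fun i => S i 0) (fun i => S i 1) (fun i => S i j) =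
      aeval (linePoint Ω n) (pderiv j (substitute S F)) := by
  rw [lineDeriv_apply, pderiv_substitute, map_sum, map_sum]
  refine Finset.sum_congr rfl fun i _ => ?_
  rw [map_mul, map_mul, aeval_linePoint_substitute]
  simp

theorem linearMap_eq_sum {m : ℕ} {l : Polynomial Ω →ₗ[Ω] Ω}
    (hl : ∀ Q, l (Polynomial.X ^ m * Q) = 0) (Q : Polynomial Ω) :
    l Q = ∑ k : Fin m, l (Polynomial.X ^ k.val) * Q.coeff k := by
  have h : ∀ P : Polynomial Ω, l P - ∑ k : Fin m, l (Polynomial.X ^ k.val) * P.coeff k = 0 := by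
    intro P
    induction P using Polynomial.induction_on' with
    | add p q hp hq =>
      simp only [map_add, Polynomial.coeff_add, mul_add, Finset.sum_add_distrib]
      linear_combination hp + hq
    | monomial j a =>
      rw [← Polynomial.C_mul_X_pow_eq_monomial, ← Polynomial.smul_eq_C_mul, map_smul]
      by_cases hj : j < m
      · rw [Finset.sum_eq_single ⟨j, hj⟩]
        · simp [mul_comm]
        · intro k _ hk
          have : k.val ≠ j := fun h => hk (Fin.ext h)
          simp [Polynomial.coeff_X_pow, this]
        · simp
      · have h1 : l (Polynomial.X ^ j) = 0 := by
          rw [← Nat.add_sub_cancel' (not_lt.1 hj), pow_add, hl]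
        rw [h1, Finset.sum_eq_zero]
        · simp
        · intro k _
          have : k.val ≠ j := by omega
          simp [Polynomial.coeff_X_pow, this]
  exact sub_eq_zero.1 (h Q)

/-- A functional on $\Omega[t]/t^m$ is a row vector of its values on the powers of $t$. The
coordinate-free condition tests more directions than the matrix has columns, but the extra ones are
automatic: modulo $t^m$, the derivative along $u$ is zero, and so is $t$ times the derivative along
$v$. -/
theorem isDegenerate_iff_rowDependent {d m : ℕ} (hmd : m ≤ d)
    {S : Matrix (Fin (n + 1 + 1)) (Fin (n + 1 + 1)) Ω} (hS : IsUnit S)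
    {F : MvPolynomial (Fin (n + 1 + 1)) Ω} (hF : F.IsHomogeneous d)
    (h0 : ∀ k < m, coeff (lineExp n d k) (substitute S F) = 0) :
    IsDegenerate m F (fun i => S i 0) (fun i => S i 1) ↔
      RowDependent (contactMatrix d m fun e => coeff e (substitute S F)) := by
  set G := substitute S F with hGdef
  have hG : G.IsHomogeneous d := substitute_isHomogeneous S hF
  have c0 : ∀ k < m, (aeval (linePoint Ω n) (pderiv 0 G)).coeff k = 0 := fun k hk =>
    coeff_aeval_linePoint_pderiv_zero hG (by omega) (h0 k hk)
  have c1 : ∀ k < m, (aeval (linePoint Ω n) (pderiv 1 G)).coeff k =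
      if k + 1 = m then coeff (lineExp n d m) G * (m : Ω) else 0 := fun k hk =>
    coeff_aeval_linePoint_pderiv_one_eq hmd hG h0 hk
  have c2 : ∀ (i : Fin n) (k : ℕ), (aeval (linePoint Ω n) (pderiv i.succ.succ G)).coeff k =
      coeff (normalExp n d i k) G := fun i k => coeff_aeval_linePoint_pderiv_succ_succ hG k i
  constructor
  · rintro ⟨l, hl0, hlm, hl⟩
    have hsum := linearMap_eq_sum hlm
    refine ⟨fun k => l (Polynomial.X ^ k.val), ?_, ?_⟩
    · intro h
      apply hl0
      ext Q
      have := hsum (Polynomial.X ^ Q)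
      simp only [fun k : Fin m => congrFun h k, Pi.zero_apply, zero_mul,
        Finset.sum_const_zero] at this
      simpa [Polynomial.monomial_one_right_eq_X_pow] using this
    · funext c
      simp only [Matrix.vecMul, dotProduct, Pi.zero_apply]
      rcases c with _ | i | i
      · have h1 := (hl fun i => S i 1).1
        rw [lineDeriv_col, hsum] at h1
        simp only [← hGdef, fun k : Fin m => c1 k k.2] at h1
        exact h1
      · have h1 := (hl fun j => S j i.succ.succ).1
        rw [lineDeriv_col, hsum] at h1
        simp only [← hGdef, c2] at h1
        exact h1
      · have h1 := (hl fun j => S j i.succ.succ).2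
        rw [lineDeriv_col, hsum] at h1
        rw [← h1]
        refine Finset.sum_congr rfl fun k _ => ?_
        congr 1
        change (if k.val = 0 then 0 else coeff (normalExp n d i (k - 1)) G) = _
        rcases hk : k.val with _ | k'
        · simp
        · rw [Polynomial.coeff_X_mul, c2]
          simp
  · rintro ⟨lam, hlam0, hlam⟩
    let l : Polynomial Ω →ₗ[Ω] Ω := ∑ k : Fin m, lam k • Polynomial.lcoeff Ω k.val
    have hl : ∀ Q, l Q = ∑ k : Fin m, lam k * Q.coeff k := fun Q => by simp [l]
    have hX : ∀ j : Fin m, l (Polynomial.X ^ j.val) = lam j := fun j => by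
      rw [hl, Finset.sum_eq_single j]
      · simp
      · intro k _ hk
        have : k.val ≠ j.val := fun h => hk (Fin.ext h)
        simp [Polynomial.coeff_X_pow, this]
      · simp
    refine ⟨l, ?_, ?_, ?_⟩
    · intro h
      apply hlam0
      funext j
      rw [← hX j, h]
      rfl
    · intro Q
      rw [hl]
      refine Finset.sum_eq_zero fun k _ => ?_
      rw [Polynomial.coeff_X_pow_mul', if_neg (by omega), mul_zero]
    · have hcols : ∀ j, l (lineDeriv F (fun i => S i 0) (fun i => S i 1) fun i => S i j) = 0 ∧
          l (Polynomial.X * lineDeriv F (fun i => S i 0) (fun i => S i 1) fun i => S i j) = 0 := by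
        intro j
        rw [lineDeriv_col, ← hGdef, hl, hl]
        have hshift : ∀ k : Fin m, ∀ P : Polynomial Ω, (Polynomial.X * P).coeff k =
            if k.val = 0 then 0 else P.coeff (k - 1) := fun k P => by
          rcases hk : k.val with _ | k'
          · simp
          · simp [Polynomial.coeff_X_mul]
        simp only [hshift]
        refine Fin.cases ?_ (fun j => Fin.cases ?_ (fun i => ?_) j) j
        · constructor
          · exact Finset.sum_eq_zero fun k _ => by rw [c0 k k.2, mul_zero]
          · refine Finset.sum_eq_zero fun k _ => ?_
            rw [c0 (k - 1) (by omega)]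
            simp
        · rw [Fin.succ_zero_eq_one]
          constructor
          · simp only [fun k : Fin m => c1 k k.2]
            exact congrFun hlam none
          · refine Finset.sum_eq_zero fun k _ => ?_
            split_ifs with hk
            · simp
            · rw [c1 _ (by omega), if_neg (by omega), mul_zero]
        · simp only [c2]
          exact ⟨congrFun hlam (some (Sum.inl i)), congrFun hlam (some (Sum.inr i))⟩
      intro w
      have hw : w = ∑ j, (S⁻¹ *ᵥ w) j • fun i => S i j := by
        have h1 : S *ᵥ (S⁻¹ *ᵥ w) = w := by
          rw [Matrix.mulVec_mulVec, Matrix.mul_nonsing_inv S ((Matrix.isUnit_iff_isUnit_det S).1 hS),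
            Matrix.one_mulVec]
        conv_lhs => rw [← h1]
        funext i
        simp [Matrix.mulVec, dotProduct, mul_comm]
      rw [hw]
      simp only [map_sum, map_smul, Finset.mul_sum, mul_smul_comm, hcols, smul_zero,
        Finset.sum_const_zero, and_self]

end Adapted

/-! ### Membership in `Y` and `W` in adapted coordinates -/

section Flags

variable {K Ω : Type*} [Field Ω] {n d m : ℕ}

theorem exists_smul_of_span_eq {V : Type*} [AddCommGroup V] [Module Ω V] {u v u' v' : V}
    (h : LinearIndependent Ω ![u, v]) (hu : Submodule.span Ω {u} = Submodule.span Ω {u'})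
    (hv : Submodule.span Ω {u, v} = Submodule.span Ω {u', v'}) :
    ∃ α β γ : Ω, α ≠ 0 ∧ β ≠ 0 ∧ u' = α • u ∧ v' = β • v + γ • u := by
  obtain ⟨α, hα⟩ := Submodule.span_singleton_eq_span_singleton.1 hu
  have hv' : v' ∈ Submodule.span Ω {u, v} := by
    rw [hv]
    exact Submodule.subset_span (by simp)
  obtain ⟨γ, β, hβγ⟩ := Submodule.mem_span_pair.1 hv'
  refine ⟨α, β, γ, α.ne_zero, ?_, hα.symm, by rw [← hβγ, add_comm]⟩
  rintro rfl
  have hvu : v ∈ Submodule.span Ω {u} := by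
    have h1 : v ∈ Submodule.span Ω {u, v} := Submodule.subset_span (by simp)
    rw [hv] at h1
    refine (Submodule.span_le.2 ?_) h1
    rintro x (rfl | rfl)
    · rw [hu]
      exact Submodule.mem_span_singleton_self _
    · rw [← hβγ, zero_smul, add_zero]
      exact Submodule.smul_mem _ _ (Submodule.mem_span_singleton_self _)
  obtain ⟨a, rfl⟩ := Submodule.mem_span_singleton.1 hvu
  have := LinearIndependent.pair_iff.1 h a (-1) (by simp)
  simp at this

theorem Frame.exists_rep_eq_smul (z : Frame Ω n d) : ∃ c : Ω, c ≠ 0 ∧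
    ((z.toFlag K).F.rep : MvPolynomial (Fin (n + 1)) Ω) = c • (z.F : MvPolynomial _ Ω) := by
  obtain ⟨a, ha⟩ := Projectivization.exists_smul_eq_mk_rep Ω z.F z.F_ne_zero
  refine ⟨a, a.ne_zero, ?_⟩
  change ((Projectivization.mk Ω z.F z.F_ne_zero).rep : MvPolynomial (Fin (n + 1)) Ω) = _
  rw [← ha]
  rfl

theorem Frame.toFlag_p_submodule (z : Frame Ω n d) :
    (z.toFlag K).p.submodule = Submodule.span Ω {z.u} :=
  Projectivization.submodule_mk _ _

theorem X_pow_dvd_restrictToLine_iff {F : MvPolynomial (Fin (n + 1 + 1)) Ω} (hF : F.IsHomogeneous d)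
    (S : Matrix (Fin (n + 1 + 1)) (Fin (n + 1 + 1)) Ω) :
    Polynomial.X ^ m ∣ restrictToLine F (fun i => S i 0) (fun i => S i 1) ↔
      ∀ k < m, coeff (lineExp n d k) (substitute S F) = 0 := by
  rw [Polynomial.X_pow_dvd_iff]
  refine forall₂_congr fun k _ => ?_
  rw [← coeff_aeval_linePoint (substitute_isHomogeneous S hF), aeval_linePoint_substitute]
  rfl

variable {z : Frame Ω (n + 1) d} {S : Matrix (Fin (n + 1 + 1)) (Fin (n + 1 + 1)) Ω}

theorem Frame.toFlag_mem_Y_iff (hu : (fun i => S i 0) = z.u) (hv : (fun i => S i 1) = z.v) :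
    z.toFlag K ∈ Y K Ω (n + 1) d m ↔
      ∀ k < m, coeff (lineExp n d k) (substitute S (z.F : MvPolynomial _ Ω)) = 0 := by
  have hF : (z.F : MvPolynomial (Fin (n + 1 + 1)) Ω).IsHomogeneous d := z.F.2
  obtain ⟨c, hc, hrep⟩ := z.exists_rep_eq_smul (K := K)
  rw [← X_pow_dvd_restrictToLine_iff hF, hu, hv]
  constructor
  · intro h
    have := h z.u z.v z.toFlag_p_submodule rfl
    rw [hrep] at this
    have h2 : restrictToLine (c • (z.F : MvPolynomial _ Ω)) z.u z.v =
        Polynomial.C c * restrictToLine (z.F : MvPolynomial _ Ω) z.u z.v := by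
      rw [restrictToLine, map_smul, Polynomial.smul_eq_C_mul]
      rfl
    rw [h2] at this
    exact (IsUnit.dvd_mul_left (Polynomial.isUnit_C.2 hc.isUnit)).1 this
  · intro h u' v' hp hL
    rw [z.toFlag_p_submodule] at hp
    obtain ⟨α, β, γ, hα, hβ, rfl, rfl⟩ := exists_smul_of_span_eq z.linearIndependent hp hL
    have h1 := X_pow_dvd_aeval_affineLine γ hα hβ hF h
    rw [hrep, restrictToLine, map_smul, Polynomial.smul_eq_C_mul]
    exact Dvd.dvd.mul_left h1 _

variable (S) in
theorem exists_basis_of_isUnit (hS : IsUnit S) :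
    ∃ b : Module.Basis (Fin (n + 1 + 1)) Ω (Fin (n + 1 + 1) → Ω), ∀ j, b j = fun i => S i j := by
  have h := Matrix.linearIndependent_cols_iff_isUnit.2 hS
  refine ⟨basisOfLinearIndependentOfCardEqFinrank h (by simp), fun j => ?_⟩
  rw [coe_basisOfLinearIndependentOfCardEqFinrank]
  rfl

theorem isUnit_of_basis (b : Module.Basis (Fin (n + 1 + 1)) Ω (Fin (n + 1 + 1) → Ω)) :
    IsUnit (Matrix.of fun i j => b j i) :=
  Matrix.linearIndependent_cols_iff_isUnit.1 b.linearIndependent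

/-- Any basis extending the frame may be used to test membership. The basis provided by `W` differs
from it on the flag by some $\alpha,\beta,\gamma$, which the coordinate-free form `IsDegenerate`
absorbs, and the representative of $[F]$ differs by a scalar. -/
theorem Frame.toFlag_mem_W_iff (hmd : m ≤ d) (hS : IsUnit S) (hu : (fun i => S i 0) = z.u)
    (hv : (fun i => S i 1) = z.v) :
    z.toFlag K ∈ W K Ω (n + 1) d m ↔
      (∀ k < m, coeff (lineExp n d k) (substitute S (z.F : MvPolynomial _ Ω)) = 0) ∧
      RowDependent (contactMatrix d m fun e =>
        coeff e (substitute S (z.F : MvPolynomial _ Ω))) := by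
  have hF : (z.F : MvPolynomial (Fin (n + 1 + 1)) Ω).IsHomogeneous d := z.F.2
  have hrepF : ((z.toFlag K).F.rep : MvPolynomial (Fin (n + 1 + 1)) Ω).IsHomogeneous d := (z.toFlag K).F.rep.2
  rw [W, Set.mem_ofPred_eq, Frame.toFlag_mem_Y_iff hu hv]
  refine and_congr_right fun h0 => ?_
  have hY : z.toFlag K ∈ Y K Ω (n + 1) d m := (Frame.toFlag_mem_Y_iff hu hv).2 h0
  obtain ⟨c, hc, hrep⟩ := z.exists_rep_eq_smul (K := K)
  rw [← isDegenerate_iff_rowDependent hmd hS hF h0, hu, hv]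
  have hcoeff : ∀ b, IsAdapted (z.toFlag K) b → ∀ k < m, coeff (lineExp n d k)
      (substitute (Matrix.of fun i j => b j i) ((z.toFlag K).F.rep : MvPolynomial _ Ω)) = 0 := by
    intro b hb
    rw [← X_pow_dvd_restrictToLine_iff hrepF]
    exact hY (b 0) (b 1) hb.1 hb.2
  have hkey : ∀ b, IsAdapted (z.toFlag K) b → ((jacobian m b
      ((z.toFlag K).F.rep : MvPolynomial _ Ω)).rank < m ↔
      IsDegenerate m (z.F : MvPolynomial _ Ω) (b 0) (b 1)) := by
    intro b hb
    have h1 := hcoeff b hb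
    have h2 := isDegenerate_iff_rowDependent hmd (isUnit_of_basis b) hrepF h1
    rw [jacobian_rank_lt_iff hmd b _ (by
      rw [inBasis_eq_substitute]
      exact substitute_isHomogeneous _ hrepF) (by rwa [inBasis_eq_substitute]),
      inBasis_eq_substitute, ← h2, hrep, isDegenerate_smul_iff hc]
    rfl
  constructor
  · rintro ⟨b, hb, hrank⟩
    have h1 := (hkey b hb).1 hrank
    have hp := hb.1
    rw [z.toFlag_p_submodule] at hp
    obtain ⟨α, β, γ, hα, hβ, hb0, hb1⟩ := exists_smul_of_span_eq z.linearIndependent hp hb.2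
    rw [hb0, hb1] at h1
    exact h1.of_reparametrization hα hβ hF
  · intro h
    obtain ⟨b, hb⟩ := exists_basis_of_isUnit S hS
    have hb0 : b 0 = z.u := by rw [hb, hu]
    have hb1 : b 1 = z.v := by rw [hb, hv]
    have hadapted : IsAdapted (z.toFlag K) b :=
      ⟨by rw [z.toFlag_p_submodule, hb0], by rw [hb0, hb1]; rfl⟩
    refine ⟨b, hadapted, (hkey b hadapted).2 ?_⟩
    rwa [hb0, hb1]

end Flags

/-! ### Forms with prescribed coefficients -/

section FormOf

variable {ι R S : Type*} [CommRing R] [CommRing S] {p : (ι →₀ ℕ) → Prop} [Fintype (Subtype p)]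

/-- The polynomial with coefficients `g`, which are indexed by some of the exponents. -/
def formOf (g : Subtype p → R) : MvPolynomial ι R := ∑ e, monomial e.1 (g e)

theorem coeff_formOf (g : Subtype p → R) (e : Subtype p) : coeff e.1 (formOf g) = g e := by
  classical
  rw [formOf, coeff_sum, Finset.sum_eq_single e]
  · simp
  · intro e' _ h
    rw [coeff_monomial, if_neg fun h' => h (Subtype.ext h')]
  · simp

theorem coeff_formOf_of_not (g : Subtype p → R) {e : ι →₀ ℕ} (he : ¬ p e) :
    coeff e (formOf g) = 0 := by
  classical
  rw [formOf, coeff_sum]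
  refine Finset.sum_eq_zero fun e' _ => ?_
  rw [coeff_monomial, if_neg]
  rintro rfl
  exact he e'.2

theorem map_formOf (f : R →+* S) (g : Subtype p → R) :
    map f (formOf g) = formOf fun e => f (g e) := by
  simp [formOf, map_monomial]

theorem formOf_isHomogeneous {d : ℕ} (hp : ∀ e, p e → e.degree = d) (g : Subtype p → R) :
    (formOf g).IsHomogeneous d :=
  IsHomogeneous.sum _ _ _ fun e _ => isHomogeneous_monomial _ (hp e.1 e.2)

theorem eq_formOf {G : MvPolynomial ι R} (hG : ∀ e, ¬ p e → coeff e G = 0) :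
    G = formOf fun e : Subtype p => coeff e.1 G := by
  ext e
  by_cases he : p e
  · exact (coeff_formOf (fun e : Subtype p => coeff e.1 G) ⟨e, he⟩).symm
  · rw [coeff_formOf_of_not _ he, hG e he]

end FormOf

instance {ι : Type*} [Finite ι] (d : ℕ) : Finite {e : ι →₀ ℕ // e.degree = d} :=
  (Finsupp.finite_of_degree_eq d).to_subtype

instance {ι : Type*} [Finite ι] (d : ℕ) : Fintype {e : ι →₀ ℕ // e.degree = d} :=
  Fintype.ofFinite _

/-- The exponents of the monomials of degree `d` other than `x₀ ^ (d - k) x₁ ^ k` for `k < m`. -/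
abbrev ContactExp (n d m : ℕ) : Type :=
  {e : Fin (n + 1 + 1) →₀ ℕ // e.degree = d ∧ ∀ k < m, e ≠ lineExp n d k}

instance (n d m : ℕ) : Finite (ContactExp n d m) :=
  ((Finsupp.finite_of_degree_eq d).subset fun _ he => he.1 :
    {e : Fin (n + 1 + 1) →₀ ℕ | e.degree = d ∧ ∀ k < m, e ≠ lineExp n d k}.Finite).to_subtype

instance (n d m : ℕ) : Fintype (ContactExp n d m) := Fintype.ofFinite _

/-! ### Normalized frames -/

section FrameMatrix

variable {n : ℕ} {R S : Type*} [CommRing R] [CommRing S]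

/-- The matrix with columns `(1, ξ)`, `(0, 1, ζ)`, `e₂, …`, where `y = (ξ, ζ)`. -/
def unipotentMatrix (y : Fin (n + 1) ⊕ Fin n → R) :
    Matrix (Fin (n + 1 + 1)) (Fin (n + 1 + 1)) R :=
  1 + Matrix.vecMulVec (Fin.cons 0 fun i => y (Sum.inl i)) (Pi.single 0 1) +
    Matrix.vecMulVec (Fin.cons 0 (Fin.cons 0 fun i => y (Sum.inr i))) (Pi.single 1 1)

/-- The inverse of `unipotentMatrix y`. -/
def unipotentMatrixInv (y : Fin (n + 1) ⊕ Fin n → R) :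
    Matrix (Fin (n + 1 + 1)) (Fin (n + 1 + 1)) R :=
  (1 - Matrix.vecMulVec (Fin.cons 0 (Fin.cons 0 fun i => y (Sum.inr i))) (Pi.single 1 1)) *
    (1 - Matrix.vecMulVec (Fin.cons 0 fun i => y (Sum.inl i)) (Pi.single 0 1))

/-- The matrix is $1+A+B$ with $A^2=AB=B^2=0$. Thus $(1-A)(1+A+B)=1+B$ and $(1-B)(1+B)=1$; the
product $BA$ need not vanish, which dictates the order of the factors. -/
theorem unipotentMatrixInv_mul (y : Fin (n + 1) ⊕ Fin n → R) :
    unipotentMatrixInv y * unipotentMatrix y = 1 := by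
  unfold unipotentMatrixInv unipotentMatrix
  set A : Matrix (Fin (n + 1 + 1)) (Fin (n + 1 + 1)) R :=
    Matrix.vecMulVec (Fin.cons 0 fun i => y (Sum.inl i)) (Pi.single 0 1) with hA
  set B : Matrix (Fin (n + 1 + 1)) (Fin (n + 1 + 1)) R :=
    Matrix.vecMulVec (Fin.cons 0 (Fin.cons 0 fun i => y (Sum.inr i))) (Pi.single 1 1) with hB
  have hAA : A * A = 0 := by
    rw [hA, Matrix.vecMulVec_mul_vecMulVec]
    simp
  have hAB : A * B = 0 := by
    rw [hA, hB, Matrix.vecMulVec_mul_vecMulVec]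
    simp
  have hBB : B * B = 0 := by
    rw [hB, Matrix.vecMulVec_mul_vecMulVec, ← Fin.succ_zero_eq_one]
    simp
  have : (1 - A) * (1 + A + B) = 1 + B := by
    have : (1 - A) * (1 + A + B) = 1 + B - A * A - A * B := by noncomm_ring
    rw [this, hAA, hAB, sub_zero, sub_zero]
  rw [Matrix.mul_assoc, this]
  have : (1 - B) * (1 + B) = 1 - B * B := by noncomm_ring
  rw [this, hBB, sub_zero]

/-- The columns of this matrix are a frame: the first two columns are `(1, ξ)` and `(0, 1, ζ)` with
the coordinates permuted by `σ`. -/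
def frameMatrix (σ : Equiv.Perm (Fin (n + 1 + 1))) (y : Fin (n + 1) ⊕ Fin n → R) :
    Matrix (Fin (n + 1 + 1)) (Fin (n + 1 + 1)) R :=
  (unipotentMatrix y).submatrix σ.symm id

/-- The inverse of `frameMatrix σ y`. -/
def frameMatrixInv (σ : Equiv.Perm (Fin (n + 1 + 1))) (y : Fin (n + 1) ⊕ Fin n → R) :
    Matrix (Fin (n + 1 + 1)) (Fin (n + 1 + 1)) R :=
  (unipotentMatrixInv y).submatrix id σ.symm

variable (σ : Equiv.Perm (Fin (n + 1 + 1))) (y : Fin (n + 1) ⊕ Fin n → R)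

theorem frameMatrixInv_mul : frameMatrixInv σ y * frameMatrix σ y = 1 := by
  rw [frameMatrixInv, frameMatrix, Matrix.submatrix_mul_equiv, unipotentMatrixInv_mul,
    Matrix.submatrix_id_id]

theorem frameMatrix_mul_inv : frameMatrix σ y * frameMatrixInv σ y = 1 :=
  mul_eq_one_comm.1 (frameMatrixInv_mul σ y)

theorem isUnit_frameMatrix : IsUnit (frameMatrix σ y) :=
  ⟨⟨_, _, frameMatrix_mul_inv σ y, frameMatrixInv_mul σ y⟩, rfl⟩

theorem map_vecMulVec_single (f : R →+* S) (w : Fin (n + 1 + 1) → R) (j : Fin (n + 1 + 1)) :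
    (Matrix.vecMulVec w (Pi.single j 1)).map f =
      Matrix.vecMulVec (fun i => f (w i)) (Pi.single j 1) := by
  ext i k
  simp [Matrix.vecMulVec_apply, Pi.single_apply, apply_ite f]

theorem map_cons_zero {k : ℕ} (f : R →+* S) (w : Fin k → R) :
    (fun i => f ((Fin.cons 0 w : Fin (k + 1) → R) i)) = Fin.cons 0 fun i => f (w i) := by
  funext i
  refine Fin.cases ?_ (fun i => ?_) i <;> simp

theorem unipotentMatrix_map (f : R →+* S) :
    (unipotentMatrix y).map f = unipotentMatrix fun l => f (y l) := by
  unfold unipotentMatrix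
  rw [Matrix.map_add _ (map_add f), Matrix.map_add _ (map_add f), Matrix.map_one _ (map_zero f)
    (map_one f), map_vecMulVec_single, map_vecMulVec_single, map_cons_zero, map_cons_zero,
    map_cons_zero]

theorem unipotentMatrixInv_map (f : R →+* S) :
    (unipotentMatrixInv y).map f = unipotentMatrixInv fun l => f (y l) := by
  unfold unipotentMatrixInv
  rw [Matrix.map_mul, Matrix.map_sub _ (map_sub f), Matrix.map_sub _ (map_sub f),
    Matrix.map_one _ (map_zero f) (map_one f), map_vecMulVec_single, map_vecMulVec_single,
    map_cons_zero, map_cons_zero, map_cons_zero]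

theorem frameMatrix_map (f : R →+* S) :
    (frameMatrix σ y).map f = frameMatrix σ fun l => f (y l) := by
  rw [frameMatrix, ← Matrix.submatrix_map, unipotentMatrix_map]
  rfl

theorem frameMatrixInv_map (f : R →+* S) :
    (frameMatrixInv σ y).map f = frameMatrixInv σ fun l => f (y l) := by
  rw [frameMatrixInv, ← Matrix.submatrix_map, unipotentMatrixInv_map]
  rfl

theorem unipotentMatrix_col_zero (i : Fin (n + 1 + 1)) :
    unipotentMatrix y i 0 = (Fin.cons 1 fun i => y (Sum.inl i) : Fin (n + 1 + 1) → R) i := by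
  refine Fin.cases ?_ (fun i => ?_) i
  · simp [unipotentMatrix, Matrix.vecMulVec_apply]
  · simp [unipotentMatrix, Matrix.vecMulVec_apply, Matrix.one_apply_ne]

theorem unipotentMatrix_col_one (i : Fin (n + 1 + 1)) :
    unipotentMatrix y i 1 =
      (Fin.cons 0 (Fin.cons 1 fun i => y (Sum.inr i)) : Fin (n + 1 + 1) → R) i := by
  refine Fin.cases ?_ (fun i => Fin.cases ?_ (fun i => ?_) i) i
  · simp [unipotentMatrix, Matrix.vecMulVec_apply]
  · simp [unipotentMatrix, Matrix.vecMulVec_apply]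
  · have : i.succ.succ ≠ (1 : Fin (n + 1 + 1)) := by
      rw [← Fin.succ_zero_eq_one, Ne, Fin.succ_inj]
      exact Fin.succ_ne_zero _
    simp [unipotentMatrix, Matrix.vecMulVec_apply, Matrix.one_apply_ne this]

theorem frameMatrix_apply_col_zero (i : Fin (n + 1 + 1)) :
    frameMatrix σ y (σ i) 0 = (Fin.cons 1 fun i => y (Sum.inl i) : Fin (n + 1 + 1) → R) i := by
  rw [← unipotentMatrix_col_zero, frameMatrix, Matrix.submatrix_apply, Equiv.symm_apply_apply, id]

theorem frameMatrix_apply_col_one (i : Fin (n + 1 + 1)) :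
    frameMatrix σ y (σ i) 1 =
      (Fin.cons 0 (Fin.cons 1 fun i => y (Sum.inr i)) : Fin (n + 1 + 1) → R) i := by
  rw [← unipotentMatrix_col_one, frameMatrix, Matrix.submatrix_apply, Equiv.symm_apply_apply, id]

end FrameMatrix

/-! ### Charts -/

section Chart

variable {n d m : ℕ}

/-- The coordinates of the affine charts of `Y`: the coordinates `ξ`, `ζ` of the flag, and the
coefficients of the form except for one which is normalized to be `1`. -/
abbrev ChartCoord (n d m : ℕ) (e₀ : ContactExp n d m) : Type :=
  (Fin (n + 1) ⊕ Fin n) ⊕ {e : ContactExp n d m // e ≠ e₀}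

variable {R S : Type*} [CommRing R] [CommRing S] {e₀ : ContactExp n d m}

open Classical in
/-- All the coefficients of the form with given chart coordinates. -/
def fullCoeff (x : ChartCoord n d m e₀ → R) (e : ContactExp n d m) : R :=
  if h : e = e₀ then 1 else x (Sum.inr ⟨e, h⟩)

theorem fullCoeff_self (x : ChartCoord n d m e₀ → R) : fullCoeff x e₀ = 1 := by simp [fullCoeff]

theorem fullCoeff_of_ne (x : ChartCoord n d m e₀ → R) (e : {e : ContactExp n d m // e ≠ e₀}) :
    fullCoeff x e.1 = x (Sum.inr e) := by simp [fullCoeff, e.2]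

theorem map_fullCoeff (f : R →+* S) (x : ChartCoord n d m e₀ → R) (e : ContactExp n d m) :
    f (fullCoeff x e) = fullCoeff (fun s => f (x s)) e := by
  unfold fullCoeff
  split_ifs <;> simp

variable {K Ω : Type*} [Field Ω]

/-- The frame with given chart coordinates. -/
def chartFrame (σ : Equiv.Perm (Fin (n + 1 + 1))) (x : ChartCoord n d m e₀ → Ω) :
    Frame Ω (n + 1) d where
  F := ⟨substitute (frameMatrixInv σ fun l => x (Sum.inl l)) (formOf (fullCoeff x)),
    substitute_isHomogeneous _ (formOf_isHomogeneous (fun _ he => he.1) _)⟩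
  u i := frameMatrix σ (fun l => x (Sum.inl l)) i 0
  v i := frameMatrix σ (fun l => x (Sum.inl l)) i 1
  F_ne_zero h := by
    have h1 := congrArg (fun p => coeff e₀.1 (substitute (frameMatrix σ fun l => x (Sum.inl l)) p))
      (congrArg Subtype.val h)
    simp only [substitute_mul, frameMatrixInv_mul, substitute_one, coeff_formOf, fullCoeff_self,
      ZeroMemClass.coe_zero, map_zero, coeff_zero] at h1
    exact one_ne_zero h1
  linearIndependent := by
    have h := Matrix.linearIndependent_cols_iff_isUnit.2
      (isUnit_frameMatrix σ fun l => x (Sum.inl l))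
    have h2 := h.comp ![0, 1] (by
      intro a b hab
      fin_cases a <;> fin_cases b <;> simp_all)
    convert h2 using 1
    funext i
    fin_cases i <;> rfl

variable (σ : Equiv.Perm (Fin (n + 1 + 1)))

theorem substitute_chartFrame (x : ChartCoord n d m e₀ → Ω) :
    substitute (frameMatrix σ fun l => x (Sum.inl l)) (chartFrame σ x).F.1 =
      formOf (fullCoeff x) := by
  change substitute _ (substitute _ _) = _
  rw [substitute_mul, frameMatrixInv_mul, substitute_one]

theorem chartFrame_mem_Y (x : ChartCoord n d m e₀ → Ω) :
    (chartFrame σ x).toFlag K ∈ Y K Ω (n + 1) d m := by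
  rw [Frame.toFlag_mem_Y_iff (S := frameMatrix σ fun l => x (Sum.inl l)) rfl rfl]
  intro k hk
  rw [substitute_chartFrame, coeff_formOf_of_not]
  exact fun h => h.2 k hk rfl

theorem chartFrame_mem_W_iff {m' : ℕ} (hm : m' ≤ m) (hmd : m ≤ d)
    (x : ChartCoord n d m e₀ → Ω) :
    (chartFrame σ x).toFlag K ∈ W K Ω (n + 1) d m' ↔
      RowDependent (contactMatrix d m' fun e => coeff e (formOf (fullCoeff x))) := by
  rw [Frame.toFlag_mem_W_iff (hm.trans hmd) (isUnit_frameMatrix σ _) rfl rfl,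
    substitute_chartFrame]
  refine and_iff_right fun k hk => ?_
  exact coeff_formOf_of_not _ fun h => h.2 k (by omega) rfl

/-- The local coordinates `ξ`, `ζ` of the flag of a frame. -/
def Frame.flagCoord (z : Frame Ω (n + 1) d) : Fin (n + 1) ⊕ Fin n → Ω
  | Sum.inl i => z.u (σ i.succ) / z.u (σ 0)
  | Sum.inr i => (z.u (σ 0) * z.v (σ i.succ.succ) - z.v (σ 0) * z.u (σ i.succ.succ)) /
      (z.u (σ 0) * z.v (σ 1) - z.v (σ 0) * z.u (σ 1))

/-- The frames whose flag lies in the chart given by `σ`. -/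
def flagChart (Ω : Type*) [Field Ω] (n d : ℕ) (σ : Equiv.Perm (Fin (n + 1 + 1))) :
    Set (Frame Ω (n + 1) d) :=
  {z | z.u (σ 0) ≠ 0 ∧ z.u (σ 0) * z.v (σ 1) - z.v (σ 0) * z.u (σ 1) ≠ 0}

/-- The form of a frame in normalized coordinates. -/
def Frame.normalForm (z : Frame Ω (n + 1) d) : MvPolynomial (Fin (n + 1 + 1)) Ω :=
  substitute (frameMatrix σ (z.flagCoord σ)) z.F.1

/-- The frames which lie in the chart given by `σ` and `e₀`. -/
def frameChart (Ω : Type*) [Field Ω] (σ : Equiv.Perm (Fin (n + 1 + 1))) (e₀ : ContactExp n d m) :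
    Set (Frame Ω (n + 1) d) :=
  {z | z ∈ flagChart Ω n d σ ∧ coeff e₀.1 (z.normalForm σ) ≠ 0}

/-- The chart coordinates of a frame. -/
def Frame.chartCoord (e₀ : ContactExp n d m) (z : Frame Ω (n + 1) d) : ChartCoord n d m e₀ → Ω
  | Sum.inl l => z.flagCoord σ l
  | Sum.inr e => coeff e.1.1 (z.normalForm σ) / coeff e₀.1 (z.normalForm σ)

theorem flagCoord_chartFrame (x : ChartCoord n d m e₀ → Ω) :
    (chartFrame σ x).flagCoord σ = fun l => x (Sum.inl l) := by
  have h0 : ∀ i, (chartFrame σ x).u (σ i) =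
      (Fin.cons 1 fun i => x (Sum.inl (Sum.inl i)) : Fin (n + 1 + 1) → Ω) i :=
    frameMatrix_apply_col_zero σ _
  have h1 : ∀ i, (chartFrame σ x).v (σ i) =
      (Fin.cons 0 (Fin.cons 1 fun i => x (Sum.inl (Sum.inr i))) : Fin (n + 1 + 1) → Ω) i :=
    frameMatrix_apply_col_one σ _
  funext l
  rcases l with i | i
  · simp [Frame.flagCoord, h0]
  · have h2 : (Fin.cons 0 (Fin.cons 1 fun i => x (Sum.inl (Sum.inr i))) : Fin (n + 1 + 1) → Ω) 1
        = 1 := rfl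
    simp [Frame.flagCoord, h0, h1, h2]

theorem chartFrame_mem_flagChart (x : ChartCoord n d m e₀ → Ω) :
    chartFrame σ x ∈ flagChart Ω n d σ := by
  have h0 : ∀ i, (chartFrame σ x).u (σ i) =
      (Fin.cons 1 fun i => x (Sum.inl (Sum.inl i)) : Fin (n + 1 + 1) → Ω) i :=
    frameMatrix_apply_col_zero σ _
  have h1 : ∀ i, (chartFrame σ x).v (σ i) =
      (Fin.cons 0 (Fin.cons 1 fun i => x (Sum.inl (Sum.inr i))) : Fin (n + 1 + 1) → Ω) i :=
    frameMatrix_apply_col_one σ _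
  have h2 : (Fin.cons 0 (Fin.cons 1 fun i => x (Sum.inl (Sum.inr i))) : Fin (n + 1 + 1) → Ω) 1
      = 1 := rfl
  simp [flagChart, h0, h1, h2]

theorem normalForm_chartFrame (x : ChartCoord n d m e₀ → Ω) :
    (chartFrame σ x).normalForm σ = formOf (fullCoeff x) := by
  rw [Frame.normalForm, flagCoord_chartFrame, substitute_chartFrame]

theorem chartFrame_mem_frameChart (x : ChartCoord n d m e₀ → Ω) :
    chartFrame σ x ∈ frameChart Ω σ e₀ := by
  refine ⟨chartFrame_mem_flagChart σ x, ?_⟩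
  rw [normalForm_chartFrame, coeff_formOf, fullCoeff_self]
  exact one_ne_zero

theorem chartCoord_chartFrame (x : ChartCoord n d m e₀ → Ω) :
    (chartFrame σ x).chartCoord σ e₀ = x := by
  funext s
  rcases s with l | e
  · simp [Frame.chartCoord, flagCoord_chartFrame]
  · simp [Frame.chartCoord, normalForm_chartFrame, coeff_formOf, fullCoeff_self, fullCoeff_of_ne]

theorem toFlag_eq_iff {z z' : Frame Ω n d} : z.toFlag K = z'.toFlag K ↔
    (∃ c : Ω, c ≠ 0 ∧ z'.F.1 = c • z.F.1) ∧
      ∃ α β γ : Ω, α ≠ 0 ∧ β ≠ 0 ∧ z'.u = α • z.u ∧ z'.v = β • z.v + γ • z.u := by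
  constructor
  · intro h
    have hF : (z'.toFlag K).F = (z.toFlag K).F := by rw [h]
    have hp : (z'.toFlag K).p = (z.toFlag K).p := by rw [h]
    have hL : (z.toFlag K).L = (z'.toFlag K).L := by rw [h]
    obtain ⟨c, hc⟩ := (Projectivization.mk_eq_mk_iff Ω _ _ z'.F_ne_zero z.F_ne_zero).1 hF
    refine ⟨⟨c, c.ne_zero, by rw [← hc]; rfl⟩, exists_smul_of_span_eq z.linearIndependent ?_ hL⟩
    rw [← z.toFlag_p_submodule (K := K), ← z'.toFlag_p_submodule (K := K), hp]
  · rintro ⟨⟨c, hc, hF⟩, α, β, γ, hα, hβ, hu, hv⟩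
    have hF' : (z.toFlag K).F = (z'.toFlag K).F :=
      ((Projectivization.mk_eq_mk_iff' Ω _ _ z'.F_ne_zero z.F_ne_zero).2
        ⟨c, Subtype.ext hF.symm⟩).symm
    have hp' : (z.toFlag K).p = (z'.toFlag K).p :=
      ((Projectivization.mk_eq_mk_iff' Ω _ _ z'.u_ne_zero z.u_ne_zero).2 ⟨α, hu.symm⟩).symm
    have hL' : (z.toFlag K).L = (z'.toFlag K).L := by
      change Submodule.span Ω {z.u, z.v} = Submodule.span Ω {z'.u, z'.v}
      apply le_antisymm
      · have hu' : z.u ∈ Submodule.span Ω {z'.u, z'.v} := by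
          have : z.u = α⁻¹ • z'.u := by rw [hu, smul_smul, inv_mul_cancel₀ hα, one_smul]
          rw [this]
          exact Submodule.smul_mem _ _ (Submodule.subset_span (by simp))
        have hv' : z.v ∈ Submodule.span Ω {z'.u, z'.v} := by
          have : z.v = β⁻¹ • (z'.v - γ • z.u) := by
            rw [hv, add_sub_cancel_right, smul_smul, inv_mul_cancel₀ hβ, one_smul]
          rw [this]
          exact Submodule.smul_mem _ _ (sub_mem (Submodule.subset_span (by simp))
            (Submodule.smul_mem _ _ hu'))
        exact Submodule.span_le.2 (by rintro _ (rfl | rfl) <;> assumption)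
      · have hu' : z.u ∈ Submodule.span Ω {z.u, z.v} := Submodule.subset_span (by simp)
        have hv' : z.v ∈ Submodule.span Ω {z.u, z.v} := Submodule.subset_span (by simp)
        refine Submodule.span_le.2 ?_
        rintro _ (rfl | rfl)
        · rw [hu]
          exact Submodule.smul_mem _ _ hu'
        · rw [hv]
          exact add_mem (Submodule.smul_mem _ _ hv') (Submodule.smul_mem _ _ hu')
    revert hF' hp' hL'
    generalize z.toFlag K = a
    generalize z'.toFlag K = b
    rcases a with ⟨aF, ap, aL, _, _⟩
    rcases b with ⟨bF, bp, bL, _, _⟩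
    rintro ⟨⟩ ⟨⟩ ⟨⟩
    rfl

/-- Another frame of the same flag multiplies the entries of $u$ by $\alpha$ and the $2\times2$
minors by $\alpha\beta$; both cancel in the quotients. -/
theorem flagCoord_congr {z z' : Frame Ω (n + 1) d} (h : z.toFlag K = z'.toFlag K)
    (hz : z ∈ flagChart Ω n d σ) :
    z' ∈ flagChart Ω n d σ ∧ z'.flagCoord σ = z.flagCoord σ := by
  obtain ⟨-, α, β, γ, hα, hβ, hu, hv⟩ := toFlag_eq_iff.1 h
  have hdet : ∀ i, z'.u (σ 0) * z'.v (σ i) - z'.v (σ 0) * z'.u (σ i) =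
      (α * β) * (z.u (σ 0) * z.v (σ i) - z.v (σ 0) * z.u (σ i)) := by
    intro i
    simp only [hu, hv, Pi.add_apply, Pi.smul_apply, smul_eq_mul]
    ring
  refine ⟨⟨?_, ?_⟩, ?_⟩
  · rw [hu]
    exact mul_ne_zero hα hz.1
  · rw [hdet]
    exact mul_ne_zero (mul_ne_zero hα hβ) hz.2
  · funext l
    rcases l with i | i
    · simp only [Frame.flagCoord, hu, Pi.smul_apply, smul_eq_mul]
      exact mul_div_mul_left _ _ hα
    · simp only [Frame.flagCoord, hdet]
      exact mul_div_mul_left _ _ (mul_ne_zero hα hβ)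

theorem chartCoord_congr {z z' : Frame Ω (n + 1) d} (h : z.toFlag K = z'.toFlag K)
    (hz : z ∈ frameChart Ω σ e₀) :
    z' ∈ frameChart Ω σ e₀ ∧ z'.chartCoord σ e₀ = z.chartCoord σ e₀ := by
  obtain ⟨h1, h2⟩ := flagCoord_congr σ h hz.1
  obtain ⟨⟨c, hc, hF⟩, -⟩ := toFlag_eq_iff.1 h
  have hG : z'.normalForm σ = c • z.normalForm σ := by
    rw [Frame.normalForm, Frame.normalForm, h2, hF, map_smul]
  refine ⟨⟨h1, ?_⟩, ?_⟩
  · rw [hG, coeff_smul]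
    exact mul_ne_zero hc hz.2
  · funext s
    rcases s with l | e
    · simp [Frame.chartCoord, h2]
    · simp only [Frame.chartCoord, hG, coeff_smul, smul_eq_mul]
      exact mul_div_mul_left _ _ hc

theorem frame_eq_smul_frameMatrix {z : Frame Ω (n + 1) d} (hz : z ∈ flagChart Ω n d σ) :
    ∃ α β γ : Ω, α ≠ 0 ∧ β ≠ 0 ∧
      (fun i => frameMatrix σ (z.flagCoord σ) i 0) = α • z.u ∧
      (fun i => frameMatrix σ (z.flagCoord σ) i 1) = β • z.v + γ • z.u := by
  obtain ⟨h0, h1⟩ := hz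
  set a := z.u (σ 0) with ha
  set D := a * z.v (σ 1) - z.v (σ 0) * z.u (σ 1) with hD
  refine ⟨a⁻¹, a / D, - (z.v (σ 0) / D), inv_ne_zero h0, div_ne_zero h0 h1, ?_, ?_⟩
  · funext i
    obtain ⟨j, rfl⟩ := σ.surjective i
    rw [frameMatrix_apply_col_zero]
    refine Fin.cases ?_ (fun j => ?_) j
    · simp [← ha, h0]
    · simp [Frame.flagCoord, ← ha, div_eq_inv_mul]
  · funext i
    obtain ⟨j, rfl⟩ := σ.surjective i
    rw [frameMatrix_apply_col_one]
    refine Fin.cases ?_ (fun j => Fin.cases ?_ (fun j => ?_) j) j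
    · simp only [Fin.cons_zero, Pi.add_apply, Pi.smul_apply, smul_eq_mul, ← ha]
      field_simp
      ring
    · rw [Fin.cons_succ, Fin.cons_zero, Fin.succ_zero_eq_one]
      simp only [Pi.add_apply, Pi.smul_apply, smul_eq_mul]
      field_simp
      rw [hD]
      ring
    · rw [Fin.cons_succ, Fin.cons_succ]
      simp only [Pi.add_apply, Pi.smul_apply, smul_eq_mul, Frame.flagCoord, ← ha, ← hD]
      field_simp
      ring

theorem coeff_normalForm_lineExp {z : Frame Ω (n + 1) d} (hz : z ∈ flagChart Ω n d σ)
    (hY : z.toFlag K ∈ Y K Ω (n + 1) d m) {k : ℕ} (hk : k < m) :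
    coeff (lineExp n d k) (z.normalForm σ) = 0 := by
  obtain ⟨α, β, γ, hα, hβ, hu, hv⟩ := frame_eq_smul_frameMatrix σ hz
  have hli := (Matrix.linearIndependent_cols_iff_isUnit.2
    (isUnit_frameMatrix σ (z.flagCoord σ))).comp ![0, 1] (by
      intro a b hab
      fin_cases a <;> fin_cases b <;> simp_all)
  let z' : Frame Ω (n + 1) d :=
    { F := z.F
      u := fun i => frameMatrix σ (z.flagCoord σ) i 0
      v := fun i => frameMatrix σ (z.flagCoord σ) i 1
      F_ne_zero := z.F_ne_zero
      linearIndependent := by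
        convert hli using 1
        funext i
        fin_cases i <;> rfl }
  have hzz' : z.toFlag K = z'.toFlag K :=
    toFlag_eq_iff.2 ⟨⟨1, one_ne_zero, by simp [z']⟩, α, β, γ, hα, hβ, hu, hv⟩
  rw [hzz', Frame.toFlag_mem_Y_iff (S := frameMatrix σ (z.flagCoord σ)) rfl rfl] at hY
  exact hY k hk

/-- On $Y$ the normal form has no monomials outside `ContactExp`, so its chart coordinates determine
it up to the scalar that was divided out. -/
theorem toFlag_chartFrame_chartCoord {z : Frame Ω (n + 1) d} (hz : z ∈ frameChart Ω σ e₀)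
    (hY : z.toFlag K ∈ Y K Ω (n + 1) d m) :
    z.toFlag K = (chartFrame σ (z.chartCoord σ e₀)).toFlag K := by
  obtain ⟨α, β, γ, hα, hβ, hu, hv⟩ := frame_eq_smul_frameMatrix σ hz.1
  have hhom : (z.normalForm σ).IsHomogeneous d := substitute_isHomogeneous _ z.F.2
  have hform : z.normalForm σ = coeff e₀.1 (z.normalForm σ) •
      formOf (fullCoeff (z.chartCoord σ e₀)) := by
    ext e
    rw [coeff_smul, smul_eq_mul]
    by_cases he : e.degree = d ∧ ∀ k < m, e ≠ lineExp n d k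
    · have h1 := coeff_formOf (fullCoeff (z.chartCoord σ e₀)) ⟨e, he⟩
      rw [h1]
      by_cases hee : (⟨e, he⟩ : ContactExp n d m) = e₀
      · rw [hee, fullCoeff_self, mul_one, ← hee]
      · rw [fullCoeff_of_ne _ ⟨_, hee⟩, Frame.chartCoord, mul_div_cancel₀ _ hz.2]
    · rw [coeff_formOf_of_not _ he, mul_zero]
      by_contra h
      have hdeg : e.degree = d := by
        rw [Finsupp.degree_eq_weight_one]
        exact hhom h
      refine he ⟨hdeg, fun k hk => ?_⟩
      rintro rfl
      exact h (coeff_normalForm_lineExp σ hz.1 hY hk)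
  refine toFlag_eq_iff.2 ⟨⟨(coeff e₀.1 (z.normalForm σ))⁻¹, inv_ne_zero hz.2, ?_⟩,
    α, β, γ, hα, hβ, hu, hv⟩
  change substitute (frameMatrixInv σ (z.flagCoord σ)) _ = _
  have h2 : substitute (frameMatrixInv σ (z.flagCoord σ)) (z.normalForm σ) = z.F.1 := by
    rw [Frame.normalForm, substitute_mul, frameMatrix_mul_inv, substitute_one]
  have h3 := congrArg (substitute (frameMatrixInv σ (z.flagCoord σ))) hform
  rw [h2, map_smul] at h3
  rw [h3, smul_smul, inv_mul_cancel₀ hz.2, one_smul]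

theorem exists_mem_frameChart {z : Frame Ω (n + 1) d} (hY : z.toFlag K ∈ Y K Ω (n + 1) d m) :
    ∃ (σ : Equiv.Perm (Fin (n + 1 + 1))) (e₀ : ContactExp n d m), z ∈ frameChart Ω σ e₀ := by
  obtain ⟨i, hi⟩ := Function.ne_iff.1 z.u_ne_zero
  have hj : ∃ j, z.u i * z.v j - z.v i * z.u j ≠ 0 := by
    by_contra! h
    have h0 : (-(z.v i)) • z.u + z.u i • z.v = 0 := by
      funext j
      simp only [Pi.add_apply, Pi.smul_apply, smul_eq_mul, Pi.zero_apply]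
      linear_combination h j
    exact hi (LinearIndependent.pair_iff.1 z.linearIndependent _ _ h0).2
  obtain ⟨j, hj⟩ := hj
  have hij : j ≠ i := by
    rintro rfl
    apply hj
    ring
  obtain ⟨σ, hσ0, hσ1⟩ : ∃ σ : Equiv.Perm (Fin (n + 1 + 1)), σ 0 = i ∧ σ 1 = j := by
    -- The first transposition moves $0$ to $i$, and the second corrects the image of $1$ without
    -- disturbing $i$.
    refine ⟨Equiv.swap 0 i |>.trans (Equiv.swap (Equiv.swap 0 i 1) j), ?_, ?_⟩
    · rw [Equiv.trans_apply, Equiv.swap_apply_left, Equiv.swap_apply_of_ne_of_ne]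
      · intro h
        have := (Equiv.swap 0 i).injective ((Equiv.swap_apply_left 0 i).trans h)
        exact zero_ne_one this
      · exact hij.symm
    · rw [Equiv.trans_apply, Equiv.swap_apply_left]
  have hz : z ∈ flagChart Ω n d σ := by
    refine ⟨?_, ?_⟩
    · rw [hσ0]
      exact hi
    · rw [hσ0, hσ1]
      exact hj
  have hne : z.normalForm σ ≠ 0 := by
    intro h
    apply z.F_ne_zero
    have h2 : substitute (frameMatrixInv σ (z.flagCoord σ)) (z.normalForm σ) = z.F.1 := by
      rw [Frame.normalForm, substitute_mul, frameMatrix_mul_inv, substitute_one]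
    rw [h, map_zero] at h2
    exact Subtype.ext h2.symm
  obtain ⟨e, he⟩ := ne_zero_iff.1 hne
  have hhom : (z.normalForm σ).IsHomogeneous d := substitute_isHomogeneous _ z.F.2
  refine ⟨σ, ⟨e, ?_, fun k hk => ?_⟩, hz, he⟩
  · rw [Finsupp.degree_eq_weight_one]
    exact hhom he
  · rintro rfl
    exact he (coeff_normalForm_lineExp σ hz hY hk)

end Chart

/-! ### The topology of the charts -/

section ChartTopology

variable {K Ω : Type*} [Field K] [Field Ω] [Algebra K Ω]

/-- The value of a regular function at a point. -/
def regularEval {τ Z : Type*} (c : Z → τ → Ω) (V : Set Z) (z : Z) : regular K c V →+* Ω :=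
  (Pi.evalRingHom (fun _ : Z => Ω) z).comp (regular K c V).val.toRingHom

theorem regularEval_mem_regular {τ Z : Type*} {c : Z → τ → Ω} {V : Set Z} (a : regular K c V) :
    (fun z => regularEval c V z a) ∈ regular K c V := a.2

/-- The Zariski topology on the set of frames. -/
@[reducible]
def frameZariski (K Ω : Type*) [Field K] [Field Ω] [Algebra K Ω] (n d : ℕ) :
    TopologicalSpace (Frame Ω n d) :=
  TopologicalSpace.induced Frame.coords (affineZariski K Ω (FrameCoord n d))

theorem isInducing_frameCoords (K Ω : Type*) [Field K] [Field Ω] [Algebra K Ω] (n d : ℕ) :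
    @IsInducing _ _ (frameZariski K Ω n d) _
      (fun z : Frame Ω n d => (⟨z.coords⟩ : ZariskiSpace K Ω (FrameCoord n d))) := by
  let _ := frameZariski K Ω n d
  refine ⟨?_⟩
  change _ = TopologicalSpace.induced _ (TopologicalSpace.induced _ _)
  rw [induced_compose]
  rfl

variable {n d m : ℕ} (σ : Equiv.Perm (Fin (n + 1 + 1)))

theorem isOpen_flagChart : @IsOpen _ (frameZariski K Ω (n + 1) d) (flagChart Ω n d σ) := by
  let _ := frameZariski K Ω (n + 1) d
  have hu : ∀ i, (fun z : Frame Ω (n + 1) d => z.u i) ∈ regular K Frame.coords Set.univ :=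
    fun i => coord_mem_regular (Sum.inr (Sum.inl i))
  have hv : ∀ i, (fun z : Frame Ω (n + 1) d => z.v i) ∈ regular K Frame.coords Set.univ :=
    fun i => coord_mem_regular (Sum.inr (Sum.inr i))
  have hc := (isInducing_frameCoords K Ω (n + 1) d).continuous
  have h1 := isOpen_regular_ne_zero hc isOpen_univ (hu (σ 0))
  have h2 := isOpen_regular_ne_zero hc isOpen_univ
    (sub_mem (mul_mem (hu (σ 0)) (hv (σ 1))) (mul_mem (hv (σ 0)) (hu (σ 1))))
  convert h1.inter h2 using 1
  ext z
  simp [flagChart]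

theorem flagCoord_mem_regular (l : Fin (n + 1) ⊕ Fin n) :
    (fun z : Frame Ω (n + 1) d => z.flagCoord σ l) ∈
      regular K Frame.coords (flagChart Ω n d σ) := by
  have hu : ∀ i, (fun z : Frame Ω (n + 1) d => z.u i) ∈
      regular K Frame.coords (flagChart Ω n d σ) := fun i => coord_mem_regular (Sum.inr (Sum.inl i))
  have hv : ∀ i, (fun z : Frame Ω (n + 1) d => z.v i) ∈
      regular K Frame.coords (flagChart Ω n d σ) := fun i => coord_mem_regular (Sum.inr (Sum.inr i))
  rcases l with i | i
  · exact div_mem_regular (hu _) (hu _) fun z hz => hz.1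
  · exact div_mem_regular (sub_mem (mul_mem (hu _) (hv _)) (mul_mem (hv _) (hu _)))
      (sub_mem (mul_mem (hu _) (hv _)) (mul_mem (hv _) (hu _))) fun z hz => hz.2

/-- The substitution is carried out once over the ring of regular functions and then evaluated at
each frame, which makes the coefficients visibly regular. The same device is used for
`coords_chartFrame_mem_regular`. -/
theorem coeff_normalForm_mem_regular (e : Fin (n + 1 + 1) →₀ ℕ) :
    (fun z : Frame Ω (n + 1) d => coeff e (z.normalForm σ)) ∈
      regular K Frame.coords (flagChart Ω n d σ) := by
  let F : MvPolynomial (Fin (n + 1 + 1)) (regular K Frame.coords (flagChart Ω n d σ)) :=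
    formOf fun e : {e : Fin (n + 1 + 1) →₀ ℕ // e.degree = d} =>
      ⟨fun z => z.coords (Sum.inl e), coord_mem_regular _⟩
  convert regularEval_mem_regular (coeff e (substitute (frameMatrix σ fun l =>
    (⟨_, flagCoord_mem_regular σ l⟩ : regular K Frame.coords (flagChart Ω n d σ))) F)) using 2 with z
  rw [← coeff_map, map_substitute, frameMatrix_map, map_formOf]
  have hF : z.F.1 = formOf fun e : {e : Fin (n + 1 + 1) →₀ ℕ // e.degree = d} => coeff e.1 z.F.1 :=
    eq_formOf fun e he => by
      by_contra h
      exact he (by rw [Finsupp.degree_eq_weight_one]; exact z.F.2 h)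
  rw [Frame.normalForm, hF]
  rfl

theorem coords_chartFrame_mem_regular {e₀ : ContactExp n d m} (s : FrameCoord (n + 1) d) :
    (fun x : ZariskiSpace K Ω (ChartCoord n d m e₀) => (chartFrame σ x.coord).coords s) ∈
      regular K ZariskiSpace.coord Set.univ := by
  let X : ChartCoord n d m e₀ →
      regular K (ZariskiSpace.coord : ZariskiSpace K Ω (ChartCoord n d m e₀) → _) Set.univ :=
    fun s => ⟨fun x => x.coord s, coord_mem_regular s⟩
  rcases s with e | i | i
  · convert regularEval_mem_regular (coeff e.1 (substitute (frameMatrixInv σ fun l =>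
      X (Sum.inl l)) (formOf (fullCoeff X)))) using 2 with x
    rw [← coeff_map, map_substitute, frameMatrixInv_map, map_formOf]
    simp only [map_fullCoeff]
    rfl
  · convert regularEval_mem_regular (frameMatrix σ (fun l => X (Sum.inl l)) i 0) using 2 with x
    have := congrFun (congrFun (frameMatrix_map σ (fun l => X (Sum.inl l))
      (regularEval ZariskiSpace.coord Set.univ x)) i) 0
    rw [Matrix.map_apply] at this
    rw [this]
    rfl
  · convert regularEval_mem_regular (frameMatrix σ (fun l => X (Sum.inl l)) i 1) using 2 with x
    have := congrFun (congrFun (frameMatrix_map σ (fun l => X (Sum.inl l))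
      (regularEval ZariskiSpace.coord Set.univ x)) i) 1
    rw [Matrix.map_apply] at this
    rw [this]
    rfl

theorem continuous_chartFrame {e₀ : ContactExp n d m} :
    @Continuous _ _ _ (frameZariski K Ω (n + 1) d)
      (fun x : ZariskiSpace K Ω (ChartCoord n d m e₀) => chartFrame σ x.coord) := by
  let _ := frameZariski K Ω (n + 1) d
  rw [(isInducing_frameCoords K Ω (n + 1) d).continuous_iff]
  exact continuous_of_regular (c := ZariskiSpace.coord) continuous_id
    (coords_chartFrame_mem_regular σ)

/-- The affine charts of `Y`. -/
def chartMap {e₀ : ContactExp n d m} (x : ZariskiSpace K Ω (ChartCoord n d m e₀)) :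
    Y K Ω (n + 1) d m :=
  ⟨(chartFrame σ x.coord).toFlag K, chartFrame_mem_Y σ x.coord⟩

theorem continuous_toFlag (n d : ℕ) :
    @Continuous _ _ (frameZariski K Ω n d) _ (Frame.toFlag K : Frame Ω n d → _) :=
  continuous_coinduced_rng

theorem toFlag_surjective {K Ω : Type*} [Field Ω] (n d : ℕ) :
    Function.Surjective (Frame.toFlag K : Frame Ω n d → _) := by
  rintro ⟨F, p, L, hL, hp⟩
  have hpL : p.rep ∈ L := hp (by
    rw [Projectivization.submodule_eq]
    exact Submodule.mem_span_singleton_self _)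
  have hle : Submodule.span Ω {p.rep} ≤ L := (Submodule.span_singleton_le_iff_mem _ _).2 hpL
  have hlt : Submodule.span Ω {p.rep} < L := by
    refine lt_of_le_of_ne hle fun h => ?_
    rw [← h, finrank_span_singleton p.rep_nonzero] at hL
    omega
  obtain ⟨v, hvL, hv⟩ := SetLike.exists_of_lt hlt
  have hli : LinearIndependent Ω ![p.rep, v] := by
    refine (LinearIndependent.pair_iff' p.rep_nonzero).2 fun a h => hv ?_
    exact Submodule.mem_span_singleton.2 ⟨a, h⟩
  let z : Frame Ω n d := ⟨F.rep, p.rep, v, F.rep_nonzero, hli⟩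
  have hzL : Submodule.span Ω {p.rep, v} = L := by
    refine Submodule.eq_of_le_of_finrank_eq (Submodule.span_le.2 ?_) ?_
    · rintro _ (rfl | rfl) <;> assumption
    · rw [hL]
      exact (z.toFlag K).finrank_L
  refine ⟨z, ?_⟩
  simp only [Frame.toFlag, z, Projectivization.mk_rep, hzL]

/-- The chart coordinates are regular on frames and constant on the fibres of `Frame.toFlag`. This
gives injectivity, and it makes the frames whose coordinates lie in a given basic open set an open
saturated set, whose image is open in the quotient topology. -/
theorem isOpenEmbedding_chartMap {e₀ : ContactExp n d m} :
    IsOpenEmbedding (chartMap σ : ZariskiSpace K Ω (ChartCoord n d m e₀) → Y K Ω (n + 1) d m) := by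
  let _ := frameZariski K Ω (n + 1) d
  refine IsOpenEmbedding.of_continuous_injective_isOpenMap ?_ ?_ ?_
  · exact ((continuous_toFlag (n + 1) d).comp (continuous_chartFrame σ)).subtype_mk _
  · intro x x' h
    have h1 := (chartCoord_congr σ (congrArg Subtype.val h)
      (chartFrame_mem_frameChart σ x.coord)).2
    rw [chartCoord_chartFrame, chartCoord_chartFrame] at h1
    exact ZariskiSpace.ext h1.symm
  · rw [ZariskiSpace.isTopologicalBasis.isOpenMap_iff]
    rintro _ ⟨f, rfl⟩
    have hc := (isInducing_frameCoords K Ω (n + 1) d).continuous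
    have hopen : IsOpen (frameChart Ω σ e₀) :=
      isOpen_regular_ne_zero hc (isOpen_flagChart (K := K) σ)
        (coeff_normalForm_mem_regular (K := K) σ e₀.1)
    have hle : regular K Frame.coords (flagChart Ω n d σ) ≤
      regular K Frame.coords (frameChart Ω σ e₀) := regular_anti fun z hz => hz.1
    have hreg : ∀ s, (fun z : Frame Ω (n + 1) d => z.chartCoord σ e₀ s) ∈
        regular K Frame.coords (frameChart Ω σ e₀) := by
      intro s
      rcases s with l | e
      · exact hle (flagCoord_mem_regular σ l)
      · exact div_mem_regular (hle (coeff_normalForm_mem_regular σ _))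
          (hle (coeff_normalForm_mem_regular σ _)) fun z hz => hz.2
    have hO := isOpen_regular_ne_zero hc hopen (aeval_mem_regular hreg f)
    set O := {z : Frame Ω (n + 1) d | z ∈ frameChart Ω σ e₀ ∧ aeval (z.chartCoord σ e₀) f ≠ 0}
      with hO_def
    have hsat : Frame.toFlag K ⁻¹' (Frame.toFlag K '' O) = O := by
      refine subset_antisymm ?_ (Set.subset_preimage_image _ _)
      rintro z ⟨z', hz', h⟩
      obtain ⟨h1, h2⟩ := chartCoord_congr σ h hz'.1
      refine ⟨h1, ?_⟩
      rw [h2]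
      exact hz'.2
    have hO' : IsOpen (Frame.toFlag K '' O) := by
      rw [isOpen_coinduced, hsat]
      exact hO
    convert hO'.preimage continuous_subtype_val using 1
    ext y
    constructor
    · rintro ⟨x, hx, rfl⟩
      refine ⟨_, ⟨chartFrame_mem_frameChart σ x.coord, ?_⟩, rfl⟩
      rw [chartCoord_chartFrame]
      exact hx
    · rintro ⟨z, hz, h⟩
      refine ⟨⟨z.chartCoord σ e₀⟩, hz.2, Subtype.ext ?_⟩
      refine Eq.trans ?_ h
      refine (toFlag_chartFrame_chartCoord σ hz.1 ?_).symm
      rw [h]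
      exact y.2

theorem exists_chartMap_eq (y : Y K Ω (n + 1) d m) :
    ∃ (i : Equiv.Perm (Fin (n + 1 + 1)) × ContactExp n d m)
      (x : ZariskiSpace K Ω (ChartCoord n d m i.2)), chartMap i.1 x = y := by
  obtain ⟨z, hz⟩ := toFlag_surjective (n + 1) d y.1
  have hY : z.toFlag K ∈ Y K Ω (n + 1) d m := by
    rw [hz]
    exact y.2
  obtain ⟨σ, e₀, h⟩ := exists_mem_frameChart hY
  refine ⟨⟨σ, e₀⟩, ⟨z.chartCoord σ e₀⟩, Subtype.ext ?_⟩
  exact (toFlag_chartFrame_chartCoord σ h hY).symm.trans hz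

instance (σ : Type*) [Finite σ] : NoetherianSpace (ZariskiSpace K Ω σ) :=
  ZariskiSpace.isInducing_toPrimeSpectrum.noetherianSpace

instance (n d : ℕ) : NoetherianSpace (HypersurfaceFlag K Ω n d) := by
  let _ := frameZariski K Ω n d
  have := (isInducing_frameCoords K Ω n d).noetherianSpace
  exact noetherianSpace_of_surjective _ (continuous_toFlag n d) (toFlag_surjective n d)

end ChartTopology

/-! ### Relations between the coefficients on the degeneracy locus -/

section Relations

variable {F : Type*} [Field F] {n d m : ℕ} {g : (Fin (n + 1 + 1) →₀ ℕ) → F}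

/-- The first row is then zero. The bound $m\ge2$ keeps the entry involving $m$, which stands in the
last row, out of it. -/
theorem rowDependent_of_normalExp_eq_zero (hm : 2 ≤ m)
    (h : ∀ i, g (normalExp n d i 0) = 0) : RowDependent (contactMatrix d m g) := by
  refine ⟨Pi.single ⟨0, by omega⟩ 1, fun h0 => ?_, ?_⟩
  · simpa using congrFun h0 ⟨0, by omega⟩
  · rw [Matrix.single_one_vecMul]
    funext c
    rcases c with _ | i | i
    · have : ¬ 1 = m := by omega
      simp [contactMatrix, this]
    · simp [contactMatrix, h]
    · simp [contactMatrix]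

theorem rowDependent_one_iff : RowDependent (contactMatrix d 1 g) ↔
    g (lineExp n d 1) = 0 ∧ ∀ i, g (normalExp n d i 0) = 0 := by
  constructor
  · rintro ⟨l, hl, h⟩
    have hl0 : l 0 ≠ 0 := fun h0 => hl (by
      funext k
      rw [Subsingleton.elim k 0, h0]
      rfl)
    have h' : ∀ c, l 0 * contactMatrix d 1 g 0 c = 0 := fun c => by
      have := congrFun h c
      simpa [Matrix.vecMul, dotProduct] using this
    exact ⟨by simpa [contactMatrix, hl0] using h' none,
      fun i => by simpa [contactMatrix, hl0] using h' (some (Sum.inl i))⟩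
  · rintro ⟨h1, h2⟩
    refine ⟨1, one_ne_zero, ?_⟩
    funext c
    rcases c with _ | i | i <;> simp [contactMatrix, Matrix.vecMul, dotProduct, h1, h2]

/-- The two kinds of columns yield the dependency and its shift, so its last nonzero entry solves
for two consecutive rows of coefficients. The position of that entry is written $r+2$, since
positions $0$ and $1$ are excluded by $g_{i_0,0}\ne0$. -/
theorem exists_relations (h : RowDependent (contactMatrix d m g)) {i₀ : Fin n}
    (hi₀ : g (normalExp n d i₀ 0) ≠ 0) : ∃ (r : ℕ) (l : ℕ → F), r + 2 < m ∧
      (∀ i, g (normalExp n d i (r + 2)) = ∑ k ∈ Finset.range (r + 2), l k * g (normalExp n d i k)) ∧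
      (∀ i, g (normalExp n d i (r + 1)) =
        ∑ k ∈ Finset.range (r + 1), l (k + 1) * g (normalExp n d i k)) ∧
      (r + 3 = m → g (lineExp n d m) * (m : F) = 0) := by
  classical
  obtain ⟨l, hl, h⟩ := h
  set l' : ℕ → F := fun k => if hk : k < m then l ⟨k, hk⟩ else 0 with hl'
  have hl'm : ∀ k, m ≤ k → l' k = 0 := fun k hk => dif_neg (by omega)
  have hl'v : ∀ k : Fin m, l k = l' k.val := fun k => by simp [hl']
  obtain ⟨k₀, hk₀⟩ := Function.ne_iff.1 hl
  have hk₀' : l' k₀ ≠ 0 := by rwa [← hl'v]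
  set r := Nat.findGreatest (fun k => l' k ≠ 0) m with hr_def
  have hr : l' r ≠ 0 := Nat.findGreatest_spec (P := fun k => l' k ≠ 0) k₀.2.le hk₀'
  have hmax : ∀ k, r < k → l' k = 0 := by
    intro k hk
    rcases le_or_gt k m with h | h
    · simpa using Nat.findGreatest_is_greatest hk h
    · exact hl'm k h.le
  have hrm : r < m := by
    by_contra h
    exact hr (hl'm r (by omega))
  have hsum : ∀ f : ℕ → F, ∑ k : Fin m, l k * f k.val = ∑ k ∈ Finset.range (r + 1), l' k * f k := by
    intro f
    simp only [hl'v]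
    rw [Fin.sum_univ_eq_sum_range (fun k => l' k * f k) m]
    refine (Finset.sum_subset (Finset.range_mono (by omega)) fun k _ hk => ?_).symm
    rw [hmax k (by simpa using hk), zero_mul]
  have hinl : ∀ i, ∑ k ∈ Finset.range (r + 1), l' k * g (normalExp n d i k) = 0 := by
    intro i
    rw [← hsum fun k => g (normalExp n d i k)]
    exact congrFun h (some (Sum.inl i))
  have hinr : ∀ i, ∑ k ∈ Finset.range r, l' (k + 1) * g (normalExp n d i k) = 0 := by
    intro i
    have h1 := hsum fun k => if k = 0 then 0 else g (normalExp n d i (k - 1))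
    rw [Finset.sum_range_succ'] at h1
    simp only [if_true, mul_zero, add_zero, Nat.add_sub_cancel, Nat.succ_ne_zero, if_false] at h1
    rw [← h1]
    exact congrFun h (some (Sum.inr i))
  have hnone : r + 1 = m → g (lineExp n d m) * (m : F) = 0 := by
    intro hrm
    have h1 := hsum fun k => if k + 1 = m then g (lineExp n d m) * (m : F) else 0
    have h2 : ∑ k : Fin m, l k * (if k.val + 1 = m then g (lineExp n d m) * (m : F) else 0) = 0 :=
      congrFun h none
    rw [h2, Finset.sum_range_succ, Finset.sum_eq_zero, zero_add, if_pos hrm] at h1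
    · exact (mul_eq_zero.1 h1.symm).resolve_left hr
    · intro k hk
      rw [if_neg (by have := Finset.mem_range.1 hk; omega), mul_zero]
  clear_value r
  -- Position $0$ contradicts the unshifted relation and position $1$ the shifted one, both at
  -- $i_0$.
  match r, hr, hrm, hinl, hinr, hnone with
  | 0, hr, _, hinl, _, _ =>
    have := hinl i₀
    simp [hr, hi₀] at this
  | 1, hr, _, _, hinr, _ =>
    have := hinr i₀
    simp [hr, hi₀] at this
  | r + 2, hr, hrm, hinl, hinr, hnone =>
    refine ⟨r, fun k => -(l' k / l' (r + 2)), hrm, fun i => ?_, fun i => ?_, hnone⟩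
    · have h1 := hinl i
      rw [Finset.sum_range_succ] at h1
      simp only [neg_mul, div_mul_eq_mul_div, Finset.sum_neg_distrib, ← Finset.sum_div]
      field_simp
      linear_combination h1
    · have h1 := hinr i
      rw [Finset.sum_range_succ] at h1
      simp only [neg_mul, div_mul_eq_mul_div, Finset.sum_neg_distrib, ← Finset.sum_div]
      field_simp
      linear_combination h1

theorem rowDependent_two_iff :
    RowDependent (contactMatrix d 2 g) ↔ ∀ i, g (normalExp n d i 0) = 0 := by
  refine ⟨fun h i => ?_, rowDependent_of_normalExp_eq_zero le_rfl⟩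
  by_contra hi
  obtain ⟨r, _, hr, _⟩ := exists_relations h hi
  omega

end Relations

/-! ### Lower bounds for the codimension -/

section Lower

variable {K κ : Type*} [Field K] [Field κ] [Algebra K κ] {n d m : ℕ}

/-- The exponent `normalExp n d i k`, as an exponent of a form in contact with the line. -/
def normalIdx (m : ℕ) (i : Fin n) {k : ℕ} (hk : k < d) : ContactExp n d m :=
  ⟨normalExp n d i k, degree_normalExp hk i, fun _ _ => normalExp_ne_lineExp _ _ _ _ _⟩

/-- The exponent of `x₀ ^ (d - m) x₁ ^ m`. -/
def lineIdx (n : ℕ) (h : m ≤ d) : ContactExp n d m :=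
  ⟨lineExp n d m, degree_lineExp h, fun k hk he => by
    have := DFunLike.congr_fun he 1
    rw [lineExp_one, lineExp_one] at this
    omega⟩

variable {e₀ : ContactExp n d m} {x : ChartCoord n d m e₀ → κ}

theorem card_le_height_of_fullCoeff_eq_zero (R : Finset (ContactExp n d m))
    (h : ∀ e ∈ R, fullCoeff x e = 0) :
    (R.card : ℕ∞) ≤ (RingHom.ker (aeval x : MvPolynomial _ K →ₐ[K] κ)).height := by
  have := card_relations_le_height_add (K := K) x (fullCoeff x) (fullCoeff_self x)
    (fun e => (fullCoeff_of_ne x e).symm) R ∅ fun e he => by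
      rw [h e he]
      exact zero_mem _
  simpa using this

theorem le_height_of_normalIdx_eq_zero (hd : 0 < d) (h : ∀ i, fullCoeff x (normalIdx m i hd) = 0) :
    (n : ℕ∞) ≤ (RingHom.ker (aeval x : MvPolynomial _ K →ₐ[K] κ)).height := by
  classical
  have := card_le_height_of_fullCoeff_eq_zero (K := K) (x := x)
    (Finset.univ.image fun i => normalIdx m i hd) (by simpa using h)
  rwa [Finset.card_image_of_injective, Finset.card_univ, Fintype.card_fin] at this
  intro i i' h
  exact (normalExp_inj.1 (congrArg Subtype.val h)).1

theorem le_height_of_lineIdx_eq_zero (hd : 0 < d) (hmd : m ≤ d) (h0 : fullCoeff x (lineIdx n hmd) = 0)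
    (h : ∀ i, fullCoeff x (normalIdx m i hd) = 0) :
    ((n + 1 : ℕ) : ℕ∞) ≤ (RingHom.ker (aeval x : MvPolynomial _ K →ₐ[K] κ)).height := by
  classical
  have := card_le_height_of_fullCoeff_eq_zero (K := K) (x := x)
    (insert (lineIdx n hmd) (Finset.univ.image fun i => normalIdx m i hd)) (by simpa [h0] using h)
  rwa [Finset.card_insert_of_notMem, Finset.card_image_of_injective, Finset.card_univ,
    Fintype.card_fin] at this
  · intro i i' h
    exact (normalExp_inj.1 (congrArg Subtype.val h)).1
  · simp only [Finset.mem_image, Finset.mem_univ, true_and, not_exists]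
    exact fun i hi => normalExp_ne_lineExp _ _ _ _ _ (congrArg Subtype.val hi)

/-- The relations determine $2n$ coefficients at the cost of $r+2\le m-1$ parameters. When $r+3=m$
and $m$ is nonzero in the field, the vanishing coefficient of $x_0^{d-m}x_1^m$ supplies one more
relation; when $r+3<m$, one parameter fewer was spent. Either way the second estimate gains one. -/
theorem le_height_add_of_rowDependent (hmd : m ≤ d)
    (h : RowDependent (contactMatrix d m fun e => coeff e (formOf (fullCoeff x)))) {i₀ : Fin n}
    (hi₀ : coeff (normalExp n d i₀ 0) (formOf (fullCoeff x)) ≠ 0) :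
    ((2 * n + 1 : ℕ) : ℕ∞) ≤ (RingHom.ker (aeval x : MvPolynomial _ K →ₐ[K] κ)).height + m ∧
    ((m : κ) ≠ 0 → ((2 * n + 2 : ℕ) : ℕ∞) ≤
      (RingHom.ker (aeval x : MvPolynomial _ K →ₐ[K] κ)).height + m) := by
  classical
  obtain ⟨r, l, hr, h1, h2, h3⟩ := exists_relations h hi₀
  have hN : ∀ i k (hk : k < d), coeff (normalExp n d i k) (formOf (fullCoeff x)) =
      fullCoeff x (normalIdx m i hk) := fun i k hk => coeff_formOf (fullCoeff x) (normalIdx m i hk)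
  set R : Finset (ContactExp n d m) :=
    (Finset.univ.image fun i => normalIdx m i (show r + 1 < d by omega)) ∪
      Finset.univ.image fun i => normalIdx m i (show r + 2 < d by omega) with hR
  set Λ : Finset κ := (Finset.range (r + 2)).image l with hΛ
  have hΛcard : Λ.card ≤ r + 2 := Finset.card_image_le.trans (Finset.card_range _).le
  have hRcard : R.card = 2 * n := by
    rw [hR, Finset.card_union_of_disjoint, Finset.card_image_of_injective,
      Finset.card_image_of_injective, Finset.card_univ, Fintype.card_fin, two_mul]
    · exact fun i i' h => (normalExp_inj.1 (congrArg Subtype.val h)).1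
    · exact fun i i' h => (normalExp_inj.1 (congrArg Subtype.val h)).1
    · rw [Finset.disjoint_left]
      simp only [Finset.mem_image, Finset.mem_univ, true_and, not_exists]
      rintro _ ⟨i, rfl⟩ i' h
      have := (normalExp_inj.1 (congrArg Subtype.val h)).2
      omega
  have hlR : lineIdx n hmd ∉ R := by
    simp only [hR, Finset.mem_union, Finset.mem_image, Finset.mem_univ, true_and, not_or, not_exists]
    exact ⟨fun i hi => normalExp_ne_lineExp _ _ _ _ _ (congrArg Subtype.val hi),
      fun i hi => normalExp_ne_lineExp _ _ _ _ _ (congrArg Subtype.val hi)⟩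
  -- Used with `R' = R` and with the coefficient at `lineIdx` adjoined. The coefficients in row
  -- $r+2$ involve those in row $r+1$, which are eliminated first.
  have key : ∀ R' : Finset (ContactExp n d m), R ⊆ R' →
      (∀ e ∈ R', e ∈ R ∨ e = lineIdx n hmd ∧ fullCoeff x e = 0) →
      (R'.card : ℕ∞) ≤ (RingHom.ker (aeval x : MvPolynomial _ K →ₐ[K] κ)).height + Λ.card := by
    intro R' hRR' hR'
    set A := IntermediateField.adjoin K (Λ : Set κ)
    set N := Submodule.span A (fullCoeff x '' (R' : Set (ContactExp n d m))ᶜ) with hNdef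
    have hl : ∀ k < r + 2, ∀ y ∈ N, l k * y ∈ N := by
      intro k hk y hy
      have hkA : l k ∈ A := IntermediateField.subset_adjoin K _
        (Finset.mem_coe.2 (Finset.mem_image_of_mem l (Finset.mem_range.2 hk)))
      exact N.smul_mem (⟨l k, hkA⟩ : A) hy
    have hlow : ∀ i k, k < r + 1 → coeff (normalExp n d i k) (formOf (fullCoeff x)) ∈ N := by
      intro i k hk
      rw [hN i k (by omega)]
      refine Submodule.subset_span ⟨_, fun hmem => ?_, rfl⟩
      rcases hR' _ hmem with hmem | ⟨hmem, -⟩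
      · simp only [hR, Finset.mem_union, Finset.mem_image, Finset.mem_univ, true_and] at hmem
        rcases hmem with ⟨i', hi'⟩ | ⟨i', hi'⟩
        · have := (normalExp_inj.1 (congrArg Subtype.val hi')).2
          omega
        · have := (normalExp_inj.1 (congrArg Subtype.val hi')).2
          omega
      · exact normalExp_ne_lineExp _ _ _ _ _ (congrArg Subtype.val hmem)
    have hmid : ∀ i, coeff (normalExp n d i (r + 1)) (formOf (fullCoeff x)) ∈ N := by
      intro i
      rw [h2]
      refine sum_mem fun k hk => ?_
      have := Finset.mem_range.1 hk
      exact hl _ (by omega) _ (hlow _ _ this)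
    have htop : ∀ i, coeff (normalExp n d i (r + 2)) (formOf (fullCoeff x)) ∈ N := by
      intro i
      rw [h1]
      refine sum_mem fun k hk => ?_
      have := Finset.mem_range.1 hk
      refine hl _ this _ ?_
      rcases Nat.lt_succ_iff_lt_or_eq.1 this with h | rfl
      · exact hlow _ _ h
      · exact hmid i
    refine card_relations_le_height_add x (fullCoeff x) (fullCoeff_self x)
      (fun e => (fullCoeff_of_ne x e).symm) R' Λ fun e he => ?_
    rcases hR' e he with he | ⟨-, he⟩
    · simp only [hR, Finset.mem_union, Finset.mem_image, Finset.mem_univ, true_and] at he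
      rcases he with ⟨i, rfl⟩ | ⟨i, rfl⟩
      · rw [← hN]
        exact hmid i
      · rw [← hN]
        exact htop i
    · rw [he]
      exact zero_mem _
  set H := (RingHom.ker (aeval x : MvPolynomial _ K →ₐ[K] κ)).height
  have h2n : ((2 * n : ℕ) : ℕ∞) ≤ H + Λ.card := by
    rw [← hRcard]
    exact key R subset_rfl fun e he => Or.inl he
  constructor
  · calc ((2 * n + 1 : ℕ) : ℕ∞) = (2 * n : ℕ) + 1 := by push_cast; rfl
      _ ≤ H + Λ.card + 1 := by gcongr
      _ = H + (Λ.card + 1 : ℕ) := by push_cast; rw [add_assoc]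
      _ ≤ H + m := by
        gcongr
        omega
  · intro hm
    by_cases hrm : r + 3 = m
    · have h0 : fullCoeff x (lineIdx n hmd) = 0 := by
        rw [← coeff_formOf (fullCoeff x) (lineIdx n hmd)]
        exact (mul_eq_zero.1 (h3 hrm)).resolve_right hm
      have := key (insert (lineIdx n hmd) R) (Finset.subset_insert _ _) fun e he => by
        rcases Finset.mem_insert.1 he with rfl | he
        · exact Or.inr ⟨rfl, h0⟩
        · exact Or.inl he
      rw [Finset.card_insert_of_notMem hlR, hRcard] at this
      calc ((2 * n + 2 : ℕ) : ℕ∞) = (2 * n + 1 : ℕ) + 1 := by push_cast; rw [add_assoc]; rfl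
        _ ≤ H + Λ.card + 1 := by gcongr
        _ = H + (Λ.card + 1 : ℕ) := by push_cast; rw [add_assoc]
        _ ≤ H + m := by
          gcongr
          omega
    · calc ((2 * n + 2 : ℕ) : ℕ∞) = (2 * n : ℕ) + 2 := by push_cast; rfl
        _ ≤ H + Λ.card + 2 := by gcongr
        _ = H + (Λ.card + 2 : ℕ) := by push_cast; rw [add_assoc]
        _ ≤ H + m := by
          gcongr
          omega

end Lower

/-! ### Generic points -/

section Generic

variable {n d m : ℕ} {e₀ : ContactExp n d m}

/-- The contact matrix of the form with given chart coordinates. -/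
abbrev chartMatrix {R : Type*} [CommRing R] (m' : ℕ) (x : ChartCoord n d m e₀ → R) :
    Matrix (Fin m') (Option (Fin n ⊕ Fin n)) R :=
  contactMatrix d m' fun e => coeff e (formOf (fullCoeff x))

theorem chartMatrix_map {R S : Type*} [CommRing R] [CommRing S] (f : R →+* S) (m' : ℕ)
    (x : ChartCoord n d m e₀ → R) : (chartMatrix m' x).map f = chartMatrix m' fun s => f (x s) := by
  rw [chartMatrix, contactMatrix_map]
  simp only [← coeff_map, map_formOf, map_fullCoeff]

variable {K F : Type*} [Field K] [Field F] [Algebra K F]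

theorem aeval_fullCoeff_X (x : ChartCoord n d m e₀ → F) (e : ContactExp n d m) :
    aeval x (fullCoeff (X : ChartCoord n d m e₀ → MvPolynomial _ K) e) = fullCoeff x e := by
  refine (map_fullCoeff (aeval x : MvPolynomial _ K →ₐ[K] F).toRingHom _ e).trans ?_
  congr 1
  funext s
  exact aeval_X x s

theorem aeval_det_chartMatrix_X {m' k : ℕ} (x : ChartCoord n d m e₀ → F) (r : Fin k → Fin m')
    (c : Fin k → Option (Fin n ⊕ Fin n)) :
    aeval x ((chartMatrix m' (X : ChartCoord n d m e₀ → MvPolynomial _ K)).submatrix r c).det =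
      ((chartMatrix m' x).submatrix r c).det := by
  rw [AlgHom.map_det, AlgHom.mapMatrix_apply, ← Matrix.submatrix_map]
  congr 2
  refine (chartMatrix_map (aeval x : MvPolynomial _ K →ₐ[K] F).toRingHom m' _).trans ?_
  congr 1
  funext s
  exact aeval_X x s

variable {Ω : Type*} [Field Ω] [Algebra K Ω]

/-- The point is the tautological one over the function field of $D$. There the ratios of a
dependency become elements of a single field, so parameters can be counted by transcendence degree.
-/
theorem exists_generic_point.{u, v, w} {K : Type u} {Ω : Type v} {σ : Type w} [Field K] [Field Ω]
    [Algebra K Ω] {D : Set (ZariskiSpace K Ω σ)} (hD : IsIrreducible D) :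
    ∃ (κ : Type (max u w)) (_ : Field κ) (_ : Algebra K κ) (x : σ → κ),
      RingHom.ker (aeval x : MvPolynomial σ K →ₐ[K] κ) = ZariskiSpace.ideal D := by
  have := ZariskiSpace.isIrreducible_iff.1 hD
  refine ⟨FractionRing (MvPolynomial σ K ⧸ ZariskiSpace.ideal D), inferInstance, inferInstance,
    fun s => algebraMap (MvPolynomial σ K ⧸ ZariskiSpace.ideal D) _ (Ideal.Quotient.mk _ (X s)), ?_⟩
  ext p
  have : aeval (fun s => algebraMap (MvPolynomial σ K ⧸ ZariskiSpace.ideal D)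
      (FractionRing (MvPolynomial σ K ⧸ ZariskiSpace.ideal D)) (Ideal.Quotient.mk _ (X s))) p =
      algebraMap (MvPolynomial σ K ⧸ ZariskiSpace.ideal D) _ (Ideal.Quotient.mk _ p) := by
    have h := comp_aeval_apply (X : σ → MvPolynomial σ K)
      ((IsScalarTower.toAlgHom K (MvPolynomial σ K ⧸ ZariskiSpace.ideal D)
        (FractionRing (MvPolynomial σ K ⧸ ZariskiSpace.ideal D))).comp
        (Ideal.Quotient.mkₐ K (ZariskiSpace.ideal D))) p
    rw [aeval_X_left_apply] at h
    exact h.symm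
  rw [RingHom.mem_ker, this, FaithfulSMul.algebraMap_eq_zero_iff, Ideal.Quotient.eq_zero_iff_mem]

variable {D : Set (ZariskiSpace K Ω (ChartCoord n d m e₀))} {κ : Type*} [Field κ] [Algebra K κ]
  {x : ChartCoord n d m e₀ → κ}

theorem fullCoeff_generic_eq_zero_iff
    (hx : RingHom.ker (aeval x : MvPolynomial _ K →ₐ[K] κ) = ZariskiSpace.ideal D)
    {e : ContactExp n d m} : fullCoeff x e = 0 ↔ ∀ z ∈ D, fullCoeff z.coord e = 0 := by
  rw [← aeval_fullCoeff_X (K := K), ← RingHom.mem_ker, hx, ZariskiSpace.mem_ideal]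
  simp only [aeval_fullCoeff_X]

/-- The minors vanish on $D$, so they belong to its ideal and vanish at the generic point. -/
theorem rowDependent_generic
    (hx : RingHom.ker (aeval x : MvPolynomial _ K →ₐ[K] κ) = ZariskiSpace.ideal D) {m' : ℕ}
    (h : ∀ z ∈ D, RowDependent (chartMatrix m' z.coord)) : RowDependent (chartMatrix m' x) := by
  rw [rowDependent_iff_det_eq_zero]
  intro c
  rw [← aeval_det_chartMatrix_X (K := K), ← RingHom.mem_ker, hx, ZariskiSpace.mem_ideal]
  intro z hz
  rw [aeval_det_chartMatrix_X]
  exact rowDependent_iff_det_eq_zero.1 (h z hz) c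

end Generic

/-! ### Bounds for the codimension in terms of charts -/

section Codim

variable {K Ω : Type*} [Field K] [Field Ω] [Algebra K Ω] {n d m : ℕ}

theorem codim_anti {X : Type*} [TopologicalSpace X] {Y W W' : Set X} (h : W ⊆ W') :
    codim Y W' ≤ codim Y W :=
  le_iInf₂ fun Z hZ => iInf₂_le Z (hZ.trans (closure_mono (Set.preimage_mono h)))

/-- All charts must be considered here, whereas an upper bound may be proved in a single chart, for
which the identity permutation suffices. -/
theorem le_codim [IsAlgClosed Ω] {S : Set (HypersurfaceFlag K Ω (n + 1) d)} {c : ℕ∞}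
    (h : ∀ (σ : Equiv.Perm (Fin (n + 1 + 1))) (e₀ : ContactExp n d m)
      (D : Set (ZariskiSpace K Ω (ChartCoord n d m e₀))), IsIrreducible D →
      (∀ z ∈ D, (chartFrame σ z.coord).toFlag K ∈ S) → c ≤ (ZariskiSpace.ideal D).height) :
    c ≤ codim (Y K Ω (n + 1) d m) S := by
  have : NoetherianSpace (Y K Ω (n + 1) d m) := IsInducing.subtypeVal.noetherianSpace
  refine le_iInf₂ fun Z hZ => le_coheight_of_subset_closure
    (fun i : Equiv.Perm (Fin (n + 1 + 1)) × ContactExp n d m => isOpenEmbedding_chartMap i.1)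
    exists_chartMap_eq (fun i D hD hS => h i.1 i.2 D hD fun z hz => hS ⟨z, hz, rfl⟩) Z hZ

theorem codim_le [IsAlgClosed Ω] {S : Set (HypersurfaceFlag K Ω (n + 1) d)} {e₀ : ContactExp n d m}
    (g : Finset (MvPolynomial (ChartCoord n d m e₀) K))
    {O : Set (ZariskiSpace K Ω (ChartCoord n d m e₀))} (hO : IsOpen O)
    {x₀ : ZariskiSpace K Ω (ChartCoord n d m e₀)} (hx₀ : x₀ ∈ O)
    (hg : ∀ p ∈ g, aeval x₀.coord p = 0)
    (h : ∀ x ∈ O, (∀ p ∈ g, aeval x.coord p = 0) → (chartFrame 1 x.coord).toFlag K ∈ S) :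
    codim (Y K Ω (n + 1) d m) S ≤ g.card := by
  obtain ⟨Z, hZ, hc⟩ := exists_irreducibleCloseds_coheight_le (isOpenEmbedding_chartMap 1)
    (S := Subtype.val ⁻¹' S) g hO hx₀ hg h
  exact (iInf₂_le Z hZ).trans hc

/-! ### Lower bounds -/

theorem le_codim_W_one [IsAlgClosed Ω] (hd : 1 ≤ d) :
    ((n + 1 : ℕ) : ℕ∞) ≤ codim (Y K Ω (n + 1) d 1) (W K Ω (n + 1) d 1) := by
  refine le_codim fun σ e₀ D hD hS => ?_
  obtain ⟨κ, _, _, x, hx⟩ := exists_generic_point hD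
  have h := rowDependent_one_iff.1
    (rowDependent_generic hx fun z hz => (chartFrame_mem_W_iff σ le_rfl hd _).1 (hS z hz))
  rw [← hx]
  refine le_height_of_lineIdx_eq_zero hd hd ?_ fun i => ?_
  · rw [← coeff_formOf (fullCoeff x)]
    exact h.1
  · rw [← coeff_formOf (fullCoeff x)]
    exact h.2 i

theorem le_codim_W_two [IsAlgClosed Ω] (hd : 2 ≤ d) :
    (n : ℕ∞) ≤ codim (Y K Ω (n + 1) d 2) (W K Ω (n + 1) d 2) := by
  refine le_codim fun σ e₀ D hD hS => ?_
  obtain ⟨κ, _, _, x, hx⟩ := exists_generic_point hD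
  have h := rowDependent_two_iff.1
    (rowDependent_generic hx fun z hz => (chartFrame_mem_W_iff σ le_rfl hd _).1 (hS z hz))
  rw [← hx]
  refine le_height_of_normalIdx_eq_zero (by omega) fun i => ?_
  rw [← coeff_formOf (fullCoeff x)]
  exact h i

theorem le_of_natCast_le_add {a b c : ℕ} {H : ℕ∞} (h : (a : ℕ∞) ≤ H + b) (hc : c + b ≤ a) :
    (c : ℕ∞) ≤ H := by
  have : (c : ℕ∞) + b ≤ H + b := le_trans (by exact_mod_cast hc) h
  exact (ENat.add_le_add_iff_right (ENat.natCast_ne_top b)).1 this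

/-- The bound for the codimension of `W₀`. -/
theorem le_height_of_mem_W (hmd : m ≤ d) (hd : 0 < d) {c : ℕ} (hc : c + m ≤ 2 * n + 2)
    (hc' : (m : K) = 0 → c + m ≤ 2 * n + 1) (σ : Equiv.Perm (Fin (n + 1 + 1)))
    {e₀ : ContactExp n d m} {D : Set (ZariskiSpace K Ω (ChartCoord n d m e₀))}
    (hD : IsIrreducible D) (hS : ∀ z ∈ D, (chartFrame σ z.coord).toFlag K ∈ W K Ω (n + 1) d m) :
    (∀ z ∈ D, ∀ i, fullCoeff z.coord (normalIdx m i hd) = 0) ∧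
        (n : ℕ∞) ≤ (ZariskiSpace.ideal D).height ∨
      (c : ℕ∞) ≤ (ZariskiSpace.ideal D).height := by
  obtain ⟨κ, _, _, x, hx⟩ := exists_generic_point hD
  have h := rowDependent_generic hx fun z hz => (chartFrame_mem_W_iff σ le_rfl hmd _).1 (hS z hz)
  -- If these coefficients vanish at the generic point, they vanish on all of $D$. That alternative
  -- gives height at least $n$ for $W$ and is impossible for $W^0$.
  by_cases h0 : ∀ i, fullCoeff x (normalIdx m i hd) = 0
  · left
    refine ⟨fun z hz i => (fullCoeff_generic_eq_zero_iff hx).1 (h0 i) z hz, ?_⟩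
    rw [← hx]
    exact le_height_of_normalIdx_eq_zero hd h0
  · right
    push Not at h0
    obtain ⟨i, hi⟩ := h0
    rw [← coeff_formOf (fullCoeff x)] at hi
    obtain ⟨h1, h2⟩ := le_height_add_of_rowDependent (K := K) hmd h hi
    rw [hx] at h1 h2
    by_cases hm : (m : K) = 0
    · exact le_of_natCast_le_add h1 (hc' hm)
    · refine le_of_natCast_le_add (h2 ?_) hc
      rw [← map_natCast (algebraMap K κ)]
      exact (map_ne_zero _).2 hm

theorem le_codim_W [IsAlgClosed Ω] (hm : 1 ≤ m) (hmd : m ≤ d) {c : ℕ} (hc : c + m ≤ 2 * n + 2)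
    (hc' : (m : K) = 0 → c + m ≤ 2 * n + 1) (hcn : c ≤ n) :
    (c : ℕ∞) ≤ codim (Y K Ω (n + 1) d m) (W K Ω (n + 1) d m) := by
  refine le_codim fun σ e₀ D hD hS => ?_
  rcases le_height_of_mem_W hmd (by omega) hc hc' σ hD hS with ⟨-, h⟩ | h
  · exact le_trans (by exact_mod_cast hcn) h
  · exact h

theorem le_codim_W₀ [IsAlgClosed Ω] (hm : 2 ≤ m) (hmd : m ≤ d) {c : ℕ} (hc : c + m ≤ 2 * n + 2)
    (hc' : (m : K) = 0 → c + m ≤ 2 * n + 1) :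
    (c : ℕ∞) ≤ codim (Y K Ω (n + 1) d m) (W₀ K Ω (n + 1) d m) := by
  refine le_codim fun σ e₀ D hD hS => ?_
  rcases le_height_of_mem_W hmd (by omega) hc hc' σ hD (fun z hz => (hS z hz).1) with ⟨h, -⟩ | h
  · obtain ⟨z, hz⟩ := hD.nonempty
    refine absurd ((chartFrame_mem_W_iff σ hm hmd _).2 (rowDependent_two_iff.2 fun i => ?_))
      (hS z hz).2
    exact (coeff_formOf (fullCoeff z.coord) (normalIdx m i (by omega))).trans (h z hz i)
  · exact h

end Codim

/-! ### Upper bounds -/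

/-- Bordered minors: where one minor of order $m$ on the first $m$ rows is nonzero, rank at most $m$
needs only one equation for each remaining column instead of all maximal minors. -/
theorem rowDependent_of_det_eq_zero {F ι : Type*} [Field F] [Fintype ι] {m : ℕ}
    {A : Matrix (Fin (m + 1)) ι F} (C : Fin m → ι) (h0 : (A.submatrix Fin.castSucc C).det ≠ 0)
    (h : ∀ c ∉ Set.range C, (A.submatrix id (Fin.snoc C c : Fin (m + 1) → ι)).det = 0) :
    RowDependent A := by
  have h' : ∀ c, (A.submatrix id (Fin.snoc C c : Fin (m + 1) → ι)).det = 0 := by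
    intro c
    by_cases hc : c ∈ Set.range C
    · obtain ⟨j, rfl⟩ := hc
      refine Matrix.det_zero_of_column_eq (Fin.castSucc_lt_last j).ne fun i => ?_
      rw [Matrix.submatrix_apply, Matrix.submatrix_apply, Fin.snoc_castSucc, Fin.snoc_last]
    · exact h c hc
  -- The dependency consists of the cofactors along the bordering column: pairing it with a column
  -- $c$ gives the minor bordered by $c$, and its last entry is up to sign the nonzero minor.
  refine ⟨fun i => (-1) ^ (i.val + m) * (A.submatrix i.succAbove C).det, fun hl => ?_, ?_⟩
  · have := congrFun hl (Fin.last m)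
    simp only [Fin.succAbove_last, Pi.zero_apply, mul_eq_zero] at this
    rcases this with h | h
    · exact pow_ne_zero _ (neg_ne_zero.2 one_ne_zero) h
    · exact h0 h
  · funext c
    rw [Pi.zero_apply, ← h' c, Matrix.det_succ_column _ (Fin.last m), Matrix.vecMul, dotProduct]
    refine Finset.sum_congr rfl fun i _ => ?_
    have : (A.submatrix id (Fin.snoc C c : Fin (m + 1) → ι)).submatrix i.succAbove
        (Fin.last m).succAbove = A.submatrix i.succAbove C := by
      ext a b
      simp
    rw [this]
    simp only [Matrix.submatrix_apply, Fin.snoc_last, id, Fin.val_last]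
    ring

section Upper

variable {K Ω : Type*} [Field K] [Field Ω] [Algebra K Ω] {n d m : ℕ}

/-- The $n$ equations $g_{i,0}=0$ suffice, in a chart where the coefficient of $x_0^{d-m}x_1^m$ is
normalized to $1$; the origin of that chart satisfies them. -/
theorem codim_W_le [IsAlgClosed Ω] (hm : 2 ≤ m) (hmd : m ≤ d) :
    codim (Y K Ω (n + 1) d m) (W K Ω (n + 1) d m) ≤ n := by
  classical
  have hd : 0 < d := by omega
  have hne : ∀ i, normalIdx m i hd ≠ lineIdx n hmd :=
    fun i h => normalExp_ne_lineExp _ _ _ _ _ (congrArg Subtype.val h)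
  have hcard : (Finset.univ.image fun i => (X (Sum.inr ⟨normalIdx m i hd, hne i⟩) :
      MvPolynomial (ChartCoord n d m (lineIdx n hmd)) K)).card ≤ n :=
    Finset.card_image_le.trans (by simp)
  refine (codim_le (e₀ := lineIdx n hmd) (x₀ := ⟨0⟩) _ isOpen_univ trivial ?_ ?_).trans
    (by exact_mod_cast hcard)
  · simp
  · intro x _ hx
    rw [chartFrame_mem_W_iff 1 le_rfl hmd]
    refine rowDependent_of_normalExp_eq_zero hm fun i => ?_
    refine (coeff_formOf (fullCoeff x.coord) (normalIdx m i hd)).trans ?_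
    rw [fullCoeff_of_ne x.coord ⟨_, hne i⟩]
    have := hx _ (Finset.mem_image_of_mem _ (Finset.mem_univ i))
    rwa [aeval_X] at this

theorem codim_W_one_le [IsAlgClosed Ω] (hd : 2 ≤ d) :
    codim (Y K Ω (n + 1) d 1) (W K Ω (n + 1) d 1) ≤ (n + 1 : ℕ) := by
  classical
  have hd0 : 0 < d := by omega
  have hd1 : 1 ≤ d := by omega
  -- The coefficient of $x_0^{d-1}x_1$ must now vanish, so another monomial has to be normalized;
  -- $x_0^{d-2}x_1^2$ exists because $d\ge2$.
  let e₀ : ContactExp n d 1 := ⟨lineExp n d 2, degree_lineExp hd, fun k hk he => by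
    have := DFunLike.congr_fun he 1
    rw [lineExp_one, lineExp_one] at this
    omega⟩
  have hne : ∀ i, normalIdx 1 i hd0 ≠ e₀ :=
    fun i h => normalExp_ne_lineExp _ _ _ _ _ (congrArg Subtype.val h)
  have hne' : lineIdx n hd1 ≠ e₀ := fun h => by
    have := DFunLike.congr_fun (congrArg Subtype.val h) 1
    change lineExp n d 1 1 = lineExp n d 2 1 at this
    rw [lineExp_one, lineExp_one] at this
    omega
  have hcard : (insert (X (Sum.inr ⟨lineIdx n hd1, hne'⟩))
      (Finset.univ.image fun i => (X (Sum.inr ⟨normalIdx 1 i hd0, hne i⟩) :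
        MvPolynomial (ChartCoord n d 1 e₀) K))).card ≤ n + 1 :=
    (Finset.card_insert_le _ _).trans (Nat.succ_le_succ (Finset.card_image_le.trans (by simp)))
  refine (codim_le (e₀ := e₀) (x₀ := ⟨0⟩) _ isOpen_univ trivial ?_ ?_).trans
    (by exact_mod_cast hcard)
  · simp
  · intro x _ hx
    rw [chartFrame_mem_W_iff 1 le_rfl hd1, rowDependent_one_iff]
    constructor
    · refine (coeff_formOf (fullCoeff x.coord) (lineIdx n hd1)).trans ?_
      rw [fullCoeff_of_ne x.coord ⟨_, hne'⟩]
      have := hx _ (Finset.mem_insert_self _ _)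
      rwa [aeval_X] at this
    · intro i
      refine (coeff_formOf (fullCoeff x.coord) (normalIdx 1 i hd0)).trans ?_
      rw [fullCoeff_of_ne x.coord ⟨_, hne i⟩]
      have := hx _ (Finset.mem_insert_of_mem (Finset.mem_image_of_mem _ (Finset.mem_univ i)))
      rwa [aeval_X] at this

theorem le_natCast_min {a b : ℕ} {c : ℕ∞} (ha : c ≤ a) (hb : c ≤ b) : c ≤ (min a b : ℕ) := by
  rcases min_choice a b with h | h <;> rwa [h]

/-- Columns of the contact matrix whose leading minor is generically nonzero. -/
def pivotColumn (hmn : m ≤ 2 * n) (k : Fin m) : Fin n ⊕ Fin n :=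
  if k.val % 2 = 0 ∧ k.val + 1 ≠ m then Sum.inl ⟨k.val / 2, by omega⟩
  else Sum.inr ⟨k.val / 2, by omega⟩

-- The multiplicity here is $m+1$. With $m$ pivot columns, each of the other $2n-m$ normal columns
-- costs one bordered minor. The column of $\xi_1$ costs the vanishing of one coefficient, and
-- nothing if $m+1=0$ in $K$. Normalizing $g_{0,0}=1$ keeps the chart away from $W_{d,2}$.
open Classical in
theorem codim_W₀_le [IsAlgClosed Ω] (hm : 2 ≤ m) (hmn : m ≤ 2 * n) (hmd : m + 1 ≤ d) :
    codim (Y K Ω (n + 1) d (m + 1)) (W₀ K Ω (n + 1) d (m + 1)) ≤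
      (2 * n - m + if ((m + 1 : ℕ) : K) = 0 then 0 else 1 : ℕ) := by
  have hd0 : 0 < d := by omega
  let i₀ : Fin n := ⟨0, by omega⟩
  let e₀ : ContactExp n d (m + 1) := normalIdx (m + 1) i₀ hd0
  -- At the base point the two columns of index $i$ are the unit vectors at $s$ and $s+1$ with
  -- $s=\min(2i,m-2)$. They cover rows $0,\dots,m-1$, so the pivot minor is that of the identity
  -- matrix, while the cap $m-2$ keeps row $m$ zero.
  let ind : (Fin (n + 1 + 1) →₀ ℕ) → Ω :=
    fun e => if ∃ i : Fin n, e = normalExp n d i (min (2 * i.val) (m - 2)) then 1 else 0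
  have hind : ∀ i k, ind (normalExp n d i k) = if k = min (2 * i.val) (m - 2) then 1 else 0 := by
    intro i k
    simp only [ind, normalExp_inj]
    congr 1
    exact propext ⟨fun ⟨i', h, h'⟩ => h ▸ h', fun h => ⟨i, rfl, h⟩⟩
  let x₀ : ChartCoord n d (m + 1) e₀ → Ω := Sum.elim (fun _ => 0) fun e => ind e.1.1
  have hx₀ : ∀ e, fullCoeff x₀ e = ind e.1 := by
    intro e
    by_cases he : e = e₀
    · rw [he, fullCoeff_self]
      exact ((hind i₀ 0).trans (if_pos (by simp [i₀]))).symm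
    · exact fullCoeff_of_ne x₀ ⟨e, he⟩
  have hline : ∀ x : ChartCoord n d (m + 1) e₀ → Ω,
      coeff (lineExp n d (m + 1)) (formOf (fullCoeff x)) = fullCoeff x (lineIdx n hmd) :=
    fun x => coeff_formOf (fullCoeff x) (lineIdx n hmd)
  have hlne : lineIdx n hmd ≠ e₀ :=
    fun h => normalExp_ne_lineExp _ _ _ _ _ (congrArg Subtype.val h).symm
  have hline₀ : ind (lineExp n d (m + 1)) = 0 := if_neg fun ⟨i, hi⟩ =>
    normalExp_ne_lineExp _ _ _ _ _ hi.symm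
  have hnormal₀ : ∀ i k, k < d → coeff (normalExp n d i k) (formOf (fullCoeff x₀)) =
      if k = min (2 * i.val) (m - 2) then 1 else 0 := by
    intro i k hk
    rw [← hind]
    exact (coeff_formOf (fullCoeff x₀) (normalIdx (m + 1) i hk)).trans (hx₀ _)
  -- the contact matrix at the point `x₀`
  have hA₀ : ∀ (k : Fin (m + 1)) (c : Fin n ⊕ Fin n), chartMatrix (m + 1) x₀ k (some c) =
      if k.val = Sum.elim (fun i : Fin n => min (2 * i.val) (m - 2))
        (fun i : Fin n => min (2 * i.val) (m - 2) + 1) c then 1 else 0 := by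
    intro k c
    rcases c with i | i
    · exact hnormal₀ i k (by omega)
    · change (if k.val = 0 then (0 : Ω) else _) = _
      by_cases hk : k.val = 0
      · rw [if_pos hk, if_neg]
        rw [hk]
        exact (Nat.succ_ne_zero _).symm
      · rw [if_neg hk, hnormal₀ i _ (by omega)]
        congr 1
        simp only [Sum.elim_inr, eq_iff_iff]
        omega
  let C : Fin m → Option (Fin n ⊕ Fin n) := fun k => some (pivotColumn hmn k)
  have hpivot : (chartMatrix (m + 1) x₀).submatrix Fin.castSucc C = 1 := by
    ext k k'
    rw [Matrix.submatrix_apply, hA₀, Matrix.one_apply]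
    congr 1
    rw [eq_iff_iff, pivotColumn, Fin.ext_iff, Fin.val_castSucc]
    split_ifs with h
    · simp only [Sum.elim_inl]
      omega
    · simp only [Sum.elim_inr]
      omega
  have hCinj : Function.Injective (pivotColumn hmn) := by
    intro k k' h
    have h1 := congrFun (congrFun hpivot k) k
    have h2 := congrFun (congrFun hpivot k) k'
    rw [Matrix.submatrix_apply, Matrix.one_apply_eq] at h1
    by_contra hk
    rw [Matrix.submatrix_apply, Matrix.one_apply_ne hk, show C k' = C k from by simp [C, h], h1]
      at h2
    exact one_ne_zero h2
  let B : Option (Fin n ⊕ Fin n) → MvPolynomial (ChartCoord n d (m + 1) e₀) K := fun c =>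
    ((chartMatrix (m + 1) X).submatrix id (Fin.snoc C c : Fin (m + 1) → _)).det
  let S : Finset (Fin n ⊕ Fin n) := Finset.univ \ Finset.univ.image (pivotColumn hmn)
  have hS : S.card = 2 * n - m := by
    rw [Finset.card_sdiff_of_subset (Finset.subset_univ _), Finset.card_image_of_injective _ hCinj]
    simp [two_mul]
  let g₁ : Finset (MvPolynomial (ChartCoord n d (m + 1) e₀) K) :=
    S.image fun c => B (some c)
  let g : Finset (MvPolynomial (ChartCoord n d (m + 1) e₀) K) :=
    if ((m + 1 : ℕ) : K) = 0 then g₁ else insert (X (Sum.inr ⟨lineIdx n hmd, hlne⟩)) g₁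
  have hg₁ : g₁ ⊆ g := by
    simp only [g]
    split_ifs
    · exact subset_rfl
    · exact Finset.subset_insert _ _
  have hgcard : g.card ≤ 2 * n - m + if ((m + 1 : ℕ) : K) = 0 then 0 else 1 := by
    have : g₁.card ≤ 2 * n - m := Finset.card_image_le.trans hS.le
    simp only [g]
    split_ifs
    · exact this
    · exact (Finset.card_insert_le _ _).trans (Nat.succ_le_succ this)
  refine (codim_le g (x₀ := ⟨x₀⟩) (ZariskiSpace.isOpen_aeval_ne_zero
    ((chartMatrix (m + 1) X).submatrix Fin.castSucc C).det) ?_ ?_ ?_).trans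
    (by exact_mod_cast hgcard)
  · change aeval x₀ _ ≠ 0
    rw [aeval_det_chartMatrix_X, hpivot, Matrix.det_one]
    exact one_ne_zero
  · have h1 : ∀ p ∈ g₁, aeval x₀ p = 0 := by
      intro p hp
      obtain ⟨c, -, rfl⟩ := Finset.mem_image.1 hp
      rw [aeval_det_chartMatrix_X]
      -- Every bordered minor by a normal column contains the last row, which is zero in those
      -- columns at the base point.
      refine Matrix.det_eq_zero_of_row_eq_zero (Fin.last m) fun j => ?_
      have : ∀ c, chartMatrix (m + 1) x₀ (Fin.last m) (some c) = 0 := by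
        intro c
        rw [hA₀, if_neg]
        rcases c with i | i <;> simp only [Sum.elim_inl, Sum.elim_inr, Fin.val_last] <;> omega
      rw [Matrix.submatrix_apply, id]
      refine Fin.lastCases ?_ (fun j => ?_) j
      · rw [Fin.snoc_last, this]
      · rw [Fin.snoc_castSucc, this]
    intro p hp
    simp only [g] at hp
    split_ifs at hp
    · exact h1 p hp
    · rcases Finset.mem_insert.1 hp with rfl | hp
      · rw [aeval_X]
        exact hline₀
      · exact h1 p hp
  · intro x hxO hx
    constructor
    · rw [chartFrame_mem_W_iff 1 le_rfl hmd]
      refine rowDependent_of_det_eq_zero C ?_ ?_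
      · rw [← aeval_det_chartMatrix_X (K := K)]
        exact hxO
      · intro c hc
        rcases c with _ | c
        · refine Matrix.det_eq_zero_of_column_eq_zero (Fin.last m) fun k => ?_
          rw [Matrix.submatrix_apply, Fin.snoc_last]
          change (if k.val + 1 = m + 1 then
            coeff (lineExp n d (m + 1)) (formOf (fullCoeff x.coord)) * ((m + 1 : ℕ) : Ω) else 0) = 0
          rw [hline, fullCoeff_of_ne x.coord ⟨_, hlne⟩]
          by_cases hK : ((m + 1 : ℕ) : K) = 0
          · rw [← map_natCast (algebraMap K Ω), hK, map_zero, mul_zero, ite_self]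
          · have := hx (X (Sum.inr ⟨lineIdx n hmd, hlne⟩)) (by
              simp only [g]
              rw [if_neg hK]
              exact Finset.mem_insert_self _ _)
            rw [aeval_X] at this
            rw [this, zero_mul, ite_self]
        · rw [← aeval_det_chartMatrix_X (K := K)]
          refine hx _ (hg₁ (Finset.mem_image_of_mem _ ?_))
          simp only [S, Finset.mem_sdiff, Finset.mem_univ, Finset.mem_image, true_and]
          rintro ⟨k, hk⟩
          exact hc ⟨k, congrArg some hk⟩
    · rw [chartFrame_mem_W_iff 1 (by omega) hmd, rowDependent_two_iff]
      intro h
      have h1 := (coeff_formOf (fullCoeff x.coord) e₀).symm.trans (h i₀)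
      rw [fullCoeff_self] at h1
      exact one_ne_zero h1

/-- For a linear form, the degeneracy conditions and the vanishing at $p$ together kill every
coefficient, including the one normalized to $1$. -/
theorem W_one_one_eq_empty : W K Ω (n + 1) 1 1 = ∅ := by
  refine Set.eq_empty_of_forall_notMem fun y hy => ?_
  obtain ⟨⟨σ, e₀⟩, x, hx⟩ := exists_chartMap_eq (⟨y, hy.1⟩ : Y K Ω (n + 1) 1 1)
  have hxy : (chartFrame σ x.coord).toFlag K = y := congrArg Subtype.val hx
  rw [← hxy, chartFrame_mem_W_iff σ le_rfl le_rfl, rowDependent_one_iff] at hy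
  obtain ⟨h1, h2⟩ := hy
  have h0 : coeff e₀.1 (formOf (fullCoeff x.coord)) = 0 := by
    by_cases h : ∃ i : Fin n, e₀.1 i.succ.succ ≠ 0
    · obtain ⟨i, hi⟩ := h
      have hle : normalExp n 1 i 0 ≤ e₀.1 := by
        have : normalExp n 1 i 0 = Finsupp.single i.succ.succ 1 := by simp [normalExp, lineExp]
        rw [this, Finsupp.single_le_iff]
        exact Nat.pos_of_ne_zero hi
      have hdeg : (e₀.1 - normalExp n 1 i 0).degree = 0 := by
        have := congrArg Finsupp.degree (tsub_add_cancel_of_le hle)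
        rw [map_add, degree_normalExp one_pos, e₀.2.1] at this
        omega
      have : e₀.1 = normalExp n 1 i 0 := by
        rw [← tsub_add_cancel_of_le hle, (Finsupp.degree_eq_zero_iff _).1 hdeg, zero_add]
      rw [this]
      exact h2 i
    · push Not at h
      have he := eq_lineExp e₀.2.1 h
      have hle : e₀.1 1 ≤ 1 := (Finsupp.le_degree 1 e₀.1).trans e₀.2.1.le
      have hne : e₀.1 1 ≠ 0 := fun h' => e₀.2.2 0 one_pos (by rw [← h']; exact he)
      rw [he, show e₀.1 1 = 1 by omega]
      exact h1
  rw [coeff_formOf, fullCoeff_self] at h0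
  exact one_ne_zero h0

end Upper

end PointLine

end

/-! ### Assembly of the bounds -/

theorem proposition4 (K Ω : Type*) [Field K] [Field Ω] [Algebra K Ω] [IsAlgClosure K Ω]
    (n d m : ℕ) (hn : 1 ≤ n) (hm : 1 ≤ m) (hmd : m ≤ d) :
    (m = 1 → (2 ≤ d → PointLine.codim (PointLine.Y K Ω n d m) (PointLine.W K Ω n d m) = (n : ℕ∞)) ∧
      (d = 1 → PointLine.W K Ω n d m = ∅)) ∧
    (m = 2 →
      PointLine.codim (PointLine.Y K Ω n d m) (PointLine.W K Ω n d m) = ((n - 1 : ℕ) : ℕ∞)) ∧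
    (m = 2 * n - 1 → ¬ ringChar K ∣ m → 2 ≤ d →
      PointLine.codim (PointLine.Y K Ω n d m) (PointLine.W K Ω n d m) = 1) ∧
    (3 ≤ m → m ≤ 2 * n - 2 → ¬ ringChar K ∣ m →
      PointLine.codim (PointLine.Y K Ω n d m) (PointLine.W K Ω n d m) =
        ((min (n - 1) (2 * n - m) : ℕ) : ℕ∞) ∧
      PointLine.codim (PointLine.Y K Ω n d m) (PointLine.W₀ K Ω n d m) =
        ((2 * n - m : ℕ) : ℕ∞)) ∧
    (3 ≤ m → m ≤ 2 * n - 2 → ringChar K ∣ m →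
      PointLine.codim (PointLine.Y K Ω n d m) (PointLine.W K Ω n d m) =
        ((min (n - 1) (2 * n - m - 1) : ℕ) : ℕ∞) ∧
      PointLine.codim (PointLine.Y K Ω n d m) (PointLine.W₀ K Ω n d m) =
        ((2 * n - m - 1 : ℕ) : ℕ∞)) := by
  have : IsAlgClosed Ω := IsAlgClosure.isAlgClosed K
  obtain ⟨n, rfl⟩ : ∃ n', n = n' + 1 := ⟨n - 1, by omega⟩
  have hW₀ : PointLine.W₀ K Ω (n + 1) d m ⊆ PointLine.W K Ω (n + 1) d m := Set.sdiff_subset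
  refine ⟨?_, ?_, ?_, ?_, ?_⟩
  · rintro rfl
    refine ⟨fun hd => le_antisymm (PointLine.codim_W_one_le hd) (PointLine.le_codim_W_one hmd), ?_⟩
    rintro rfl
    exact PointLine.W_one_one_eq_empty
  · rintro rfl
    exact le_antisymm (PointLine.codim_W_le le_rfl hmd) (PointLine.le_codim_W_two hmd)
  · rintro hmn hchar hd
    rw [← ringChar.spec] at hchar
    -- On the projective line $m=2n-1$ becomes $m=1$, where the bound through $W^0$ is not available
    -- and the case $m=1$ applies directly.
    rcases Nat.eq_zero_or_pos n with rfl | hn0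
    · obtain rfl : m = 1 := by omega
      exact le_antisymm (PointLine.codim_W_one_le hd) (PointLine.le_codim_W_one hmd)
    · obtain ⟨m, rfl⟩ : ∃ m', m = m' + 1 := ⟨m - 1, by omega⟩
      refine le_antisymm ((PointLine.codim_anti hW₀).trans ?_) ?_
      · refine (PointLine.codim_W₀_le (by omega) (by omega) hmd).trans ?_
        rw [if_neg hchar]
        exact_mod_cast (by omega : 2 * n - m + 1 ≤ 1)
      · exact_mod_cast PointLine.le_codim_W (K := K) (Ω := Ω) (c := 1) hm hmd (by omega)
          (fun h => absurd h hchar) hn0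
  · intro hm3 hmn hchar
    rw [← ringChar.spec] at hchar
    obtain ⟨m, rfl⟩ : ∃ m', m = m' + 1 := ⟨m - 1, by omega⟩
    have h := PointLine.codim_W₀_le (K := K) (Ω := Ω) (n := n) (by omega) (by omega) hmd
    rw [if_neg hchar, show 2 * n - m + 1 = 2 * (n + 1) - (m + 1) by omega] at h
    refine ⟨le_antisymm ?_ ?_, le_antisymm h ?_⟩
    -- The two terms of the minimum come from the locus $g_{i,0}=0$ and from $W^0\subseteq W$.
    · exact PointLine.le_natCast_min (PointLine.codim_W_le (by omega) hmd) ((PointLine.codim_anti hW₀).trans h)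
    · exact PointLine.le_codim_W hm hmd (by omega) (fun h => absurd h hchar) (by omega)
    · exact PointLine.le_codim_W₀ (by omega) hmd (by omega) fun h => absurd h hchar
  · intro hm3 hmn hchar
    rw [← ringChar.spec] at hchar
    obtain ⟨m, rfl⟩ : ∃ m', m = m' + 1 := ⟨m - 1, by omega⟩
    have h := PointLine.codim_W₀_le (K := K) (Ω := Ω) (n := n) (by omega) (by omega) hmd
    rw [if_pos hchar, show 2 * n - m + 0 = 2 * (n + 1) - (m + 1) - 1 by omega] at h
    refine ⟨le_antisymm ?_ ?_, le_antisymm h ?_⟩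
    · exact PointLine.le_natCast_min (PointLine.codim_W_le (by omega) hmd) ((PointLine.codim_anti hW₀).trans h)
    · exact PointLine.le_codim_W hm hmd (by omega) (fun _ => by omega) (by omega)
    · exact PointLine.le_codim_W₀ (by omega) hmd (by omega) fun _ => by omega
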